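/- **Strict tensor categories.** Let $\mathbf{Str.T}$ be the category of small strict tensor categories (strictly associative and strictly unital monoidal categories, with morphisms composed as usual) and strict tensor functors (functors that preserve $\otimes$ and the unit object on the nose). **Tensor schemes.** A tensor scheme $D$ consists of a set $Ob(D)$, a set $Mor(D)$ and two maps $s,t$ from $Mor(D)$ to the set of non-empty words in $Ob(D)$. A morphism $\varphi:D\to E$ consists of maps $\varphi_o:Ob(D)\to Ob(E)$ and $\varphi_m:Mor(D)\to Mor(E)$ with $s(\varphi_m f)=\varphi_o(s(f))$ and $t(\varphi_m f)=\varphi_o(t(f))$, where $\varphi_o$ is applied to words letter by letter. Tensor schemes and their morphisms form a category $\mathbf{T.Sch}$. **Planar graphs.** A graph is a finite set $H$ of half-edges with a partition of $H$ into non-empty blocks (the vertices) and an involution of $H$ whose orbits are the edges. An edge with two elements that lies inside one vertex is called virtual; a vertex that contains a virtual edge is called virtual and is required to have exactly two elements; the other vertices are called real. A planar graph is a graph together with * a sign $+$ or $-$ for each half-edge such that the two half-edges of any two-element edge have opposite signs and such that every vertex $v$ has at least one half-edge of sign $+$ (an input of $v$) and at least one of sign $-$ (an output of $v$); an edge is directed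 out of the vertex of its $-$ half-edge and into the vertex of its $+$ half-edge. Write $e_1\to e_2$ if $e_1\ne e_2$ and there is a directed path that begins with the edge $e_1$ and ends with the edge $e_2$; * a linear order $<$ on the set of edges such that $e_1\to e_2$ implies $e_1<e_2$, and such that $e_1\to e_2$ and $e_1<e<e_2$ imply $e_1\to e$ or $e\to e_2$. The inputs of the graph are the half-edges of sign $+$ that form a one-element edge or belong to a virtual edge, and the outputs are the half-edges of sign $-$ with the same property. The inputs and outputs of a vertex, and those of the graph, are listed in the order of their edges. A planar graph is prime if it has exactly one vertex and this vertex is real. **Planar diagrams.** A planar diagram in a tensor scheme $D$ is a planar graph with a decoration of every edge by an object of $D$ and of every real vertex $v$ by some $f\in Mor(D)$ such that $s(f)$ is the word of the decorations of the inputs of $v$ and $t(f)$ the word of the decorations of its outputs. A planar diagram in a small strict tensor category $V$ is a planar graph with a decoration of every edge by an object of $V$ and of every real vertex $v$ by a morphism $x_1\otimes\cdots\otimes x_m\to y_1\otimes\cdots\otimes y_n$ of $V$, where $x_1\cdots x_m$ and $y_1\cdots y_n$ are the words of the decorations of the inputs and of the outputs of $v$. The domain and the codomain of a diagram are the words of the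 decorations of its inputs and of its outputs. An isomorphism of diagrams is a bijection of half-edges that preserves vertices, involution, signs, edge order and decorations. Maps of objects and morphisms that come from a morphism of tensor schemes, or from a strict tensor functor, push diagrams forward by applying them to all decorations. **Operations on planar diagrams in $D$.** * The identity of a word $x_1\cdots x_n$ is the diagram with exactly $n$ vertices, all virtual, whose edges $e_1<\cdots<e_n$ are decorated by $x_1,\dots,x_n$. * The tensor product $X\otimes Y$ is the disjoint union in which all edges of $X$ precede all edges of $Y$. * If the codomain of $X$ is the domain of $Y$, the composite $Y\circ X$ is obtained by grafting the $k$-th output $o_k$ of $X$ to the $k$-th input $i_k$ of $Y$ for each $k=1,\dots,n$: if neither belongs to a virtual edge, $o_k$ and $i_k$ form a new two-element edge; if exactly one does, its virtual edge (with the vertex) is removed; if both do, $o_k$ and $i_k$ are removed and their partners form a new virtual edge and vertex. Let $e_k$ be the resulting edge. The edges of the composite are ordered as $$Q_1<e_1<P_1<Q_2<e_2<P_2<\cdots<Q_n<e_n<P_n,$$ where $Q_k$ consists of the edges of $X$ strictly between its $(k-1)$-st and its $k$-th output edge (for $k=1$: before the first), and $P_k$ of the edges of $Y$ strictly between its $k$-th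 and its $(k+1)$-st input edge (for $k=n$: after the last), in their given orders. **Theorem.** For every tensor scheme $D$ these operations are well defined on isomorphism classes and make $F(D)$, with the words in $Ob(D)$ as objects (tensor product: juxtaposition; unit object: the empty word) and the isomorphism classes of planar diagrams in $D$ as morphisms from their domain to their codomain, a strict tensor category. For a morphism $\varphi$ of tensor schemes, $\varphi_o$ on words and push-forward on diagrams form a strict tensor functor $F(\varphi)$, which makes $F:\mathbf{T.Sch}\to\mathbf{Str.T}$ a functor. For a small strict tensor category $V$ let $U(V)$ be the tensor scheme with the objects of $V$ as objects and the isomorphism classes of prime diagrams in $V$ as morphisms, the source and target of such a class being its domain and codomain; with push-forward along strict tensor functors, $U:\mathbf{Str.T}\to\mathbf{T.Sch}$ is a functor. The functor $F$ is left adjoint to $U$. -/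

import Mathlib

open CategoryTheory

universe u

namespace TensorCalculus

/-! ### Small strict tensor categories -/

/-- A strict tensor category structure on a graph `src, tgt : Mor → Ob`: a category with set of
objects `Ob` and set of morphisms `Mor`, a strictly associative and strictly unital bifunctor,
and a unit object. `comp g f` is the composite `g ∘ f`, defined when `tgt f = src g`. -/
structure StrictTensorStructure (Ob Mor : Type u) (src tgt : Mor → Ob) where
  id : Ob → Mor
  comp : ∀ g f : Mor, tgt f = src g → Mor
  unit : Ob
  tensorOb : Ob → Ob → Ob
  tensorMor : Mor → Mor → Mor
  src_id : ∀ x, src (id x) = x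
  tgt_id : ∀ x, tgt (id x) = x
  src_comp : ∀ g f h, src (comp g f h) = src f
  tgt_comp : ∀ g f h, tgt (comp g f h) = tgt g
  id_comp : ∀ f h, comp (id (tgt f)) f h = f
  comp_id : ∀ f h, comp f (id (src f)) h = f
  comp_assoc : ∀ (k g f : Mor) (hgf : tgt f = src g) (hkg : tgt g = src k),
    comp k (comp g f hgf) ((tgt_comp g f hgf).trans hkg) =
      comp (comp k g hkg) f (hgf.trans (src_comp k g hkg).symm)
  src_tensor : ∀ f g, src (tensorMor f g) = tensorOb (src f) (src g)
  tgt_tensor : ∀ f g, tgt (tensorMor f g) = tensorOb (tgt f) (tgt g)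
  tensor_id : ∀ x y, tensorMor (id x) (id y) = id (tensorOb x y)
  interchange : ∀ (g f g' f' : Mor) (h : tgt f = src g) (h' : tgt f' = src g'),
    tensorMor (comp g f h) (comp g' f' h') =
      comp (tensorMor g g') (tensorMor f f')
        (by rw [tgt_tensor, src_tensor, h, h'])
  tensorOb_assoc : ∀ x y z, tensorOb (tensorOb x y) z = tensorOb x (tensorOb y z)
  unit_tensorOb : ∀ x, tensorOb unit x = x
  tensorOb_unit : ∀ x, tensorOb x unit = x
  tensorMor_assoc : ∀ f g k, tensorMor (tensorMor f g) k = tensorMor f (tensorMor g k)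
  unit_tensorMor : ∀ f, tensorMor (id unit) f = f
  tensorMor_unit : ∀ f, tensorMor f (id unit) = f

/-- The pair `(o, m)` of functions on objects and on morphisms is a strict tensor functor. -/
structure IsStrictTensorFunctor {Ob₁ Mor₁ Ob₂ Mor₂ : Type u}
    {src₁ tgt₁ : Mor₁ → Ob₁} {src₂ tgt₂ : Mor₂ → Ob₂}
    (S₁ : StrictTensorStructure Ob₁ Mor₁ src₁ tgt₁)
    (S₂ : StrictTensorStructure Ob₂ Mor₂ src₂ tgt₂)
    (o : Ob₁ → Ob₂) (m : Mor₁ → Mor₂) : Prop where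
  src_map : ∀ f, src₂ (m f) = o (src₁ f)
  tgt_map : ∀ f, tgt₂ (m f) = o (tgt₁ f)
  map_id : ∀ x, m (S₁.id x) = S₂.id (o x)
  map_comp : ∀ (g f : Mor₁) (h : tgt₁ f = src₁ g),
    m (S₁.comp g f h) = S₂.comp (m g) (m f) (by rw [tgt_map, src_map, h])
  map_unit : o S₁.unit = S₂.unit
  map_tensorOb : ∀ x y, o (S₁.tensorOb x y) = S₂.tensorOb (o x) (o y)
  map_tensorMor : ∀ f g, m (S₁.tensorMor f g) = S₂.tensorMor (m f) (m g)

/-- A small strict tensor category. -/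
structure StrT where
  Ob : Type u
  Mor : Type u
  src : Mor → Ob
  tgt : Mor → Ob
  str : StrictTensorStructure Ob Mor src tgt

/-- The tensor product `x₁ ⊗ ⋯ ⊗ xₙ` of a word of objects (the unit object for the empty word). -/
def StrT.tensorWord (V : StrT.{u}) (w : List V.Ob) : V.Ob :=
  w.foldr V.str.tensorOb V.str.unit

/-- A strict tensor functor between small strict tensor categories. -/
@[ext]
structure StrT.Functor (V W : StrT.{u}) where
  o : V.Ob → W.Ob
  m : V.Mor → W.Mor
  isFunctor : IsStrictTensorFunctor V.str W.str o m

/-- The category of small strict tensor categories and strict tensor functors. -/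
instance : Category StrT.{u} where
  Hom := StrT.Functor
  id V := ⟨fun x => x, fun f => f,
    ⟨fun _ => rfl, fun _ => rfl, fun _ => rfl, fun _ _ _ => rfl, rfl, fun _ _ => rfl,
      fun _ _ => rfl⟩⟩
  comp {V W X} K L := ⟨fun x => L.o (K.o x), fun f => L.m (K.m f),
    { src_map := fun f => by rw [L.isFunctor.src_map, K.isFunctor.src_map]
      tgt_map := fun f => by rw [L.isFunctor.tgt_map, K.isFunctor.tgt_map]
      map_id := fun x => by rw [K.isFunctor.map_id, L.isFunctor.map_id]
      map_comp := fun g f h => by rw [K.isFunctor.map_comp, L.isFunctor.map_comp]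
      map_unit := by rw [K.isFunctor.map_unit, L.isFunctor.map_unit]
      map_tensorOb := fun x y => by rw [K.isFunctor.map_tensorOb, L.isFunctor.map_tensorOb]
      map_tensorMor := fun f g => by
        rw [K.isFunctor.map_tensorMor, L.isFunctor.map_tensorMor] }⟩

theorem StrT.Functor.o_tensorWord {V W : StrT.{u}} (K : V.Functor W) (w : List V.Ob) :
    K.o (V.tensorWord w) = W.tensorWord (w.map K.o) := by
  induction w with
  | nil => exact K.isFunctor.map_unit
  | cons x w ih =>
    change K.o (V.str.tensorOb x (V.tensorWord w)) = W.str.tensorOb (K.o x) _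
    rw [K.isFunctor.map_tensorOb, ih]
    rfl

/-! ### Tensor schemes -/

/-- A tensor scheme: sources and targets of morphisms are (non-empty) words in the objects. -/
structure TSch where
  Ob : Type u
  Mor : Type u
  src : Mor → List Ob
  tgt : Mor → List Ob
  src_ne : ∀ f, src f ≠ []
  tgt_ne : ∀ f, tgt f ≠ []

/-- A morphism of tensor schemes. -/
@[ext]
structure TSch.Hom (D E : TSch.{u}) where
  o : D.Ob → E.Ob
  m : D.Mor → E.Mor
  src_map : ∀ f, E.src (m f) = (D.src f).map o
  tgt_map : ∀ f, E.tgt (m f) = (D.tgt f).map o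

/-- The category of tensor schemes. -/
instance : Category TSch.{u} where
  Hom := TSch.Hom
  id D := ⟨fun x => x, fun f => f, fun _ => (List.map_id' _).symm, fun _ => (List.map_id' _).symm⟩
  comp φ ψ := ⟨fun x => ψ.o (φ.o x), fun f => ψ.m (φ.m f),
    fun f => by rw [ψ.src_map, φ.src_map, List.map_map]; rfl,
    fun f => by rw [ψ.tgt_map, φ.tgt_map, List.map_map]; rfl⟩

/-! ### Planar diagrams

A diagram is first given by its bare data on a set `H` of half-edges. The edges are the orbits of
`inv`; a relation on the set of edges is given as a relation between half-edges representing
them. The vertices are the classes of `vert`; the decoration of the vertex of `h` is `mor h`,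
which is `none` for virtual vertices. -/

/-- The data of a diagram with set of half-edges `H`, edges decorated by elements of `O` and
real vertices decorated by elements of `M`. -/
structure RawDiagram (O M : Type u) (H : Type) where
  /-- `h` and `k` are incident to the same vertex -/
  vert : H → H → Prop
  /-- the involution whose orbits are the edges -/
  inv : H → H
  /-- `h` has sign `+`, that is, it is an input of its vertex; otherwise it has sign `-` -/
  pos : H → Prop
  /-- the edge of `h` strictly precedes the edge of `k` -/
  lt : H → H → Prop
  /-- decoration of the edges -/
  obj : H → O
  /-- decoration of the real vertices -/
  mor : H → Option M

namespace RawDiagram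

variable {O M : Type u} {H H₁ H₂ : Type}

/-- `h` and `k` belong to the same edge. -/
def SameEdge (X : RawDiagram O M H) (h k : H) : Prop := k = h ∨ k = X.inv h

/-- `h` belongs to a virtual edge: a two-element edge contained in a vertex. -/
def Virtual (X : RawDiagram O M H) (h : H) : Prop := X.inv h ≠ h ∧ X.vert h (X.inv h)

/-- The vertex of `h` is virtual: it contains a virtual edge. -/
def OnVirtualVertex (X : RawDiagram O M H) (h : H) : Prop := ∃ k, X.vert h k ∧ X.Virtual k

/-- `h` is a leg: it forms a one-element edge (real leg) or belongs to a virtual edge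
(virtual leg). -/
def Leg (X : RawDiagram O M H) (h : H) : Prop := X.inv h = h ∨ X.Virtual h

/-- The target of the edge of `a` exists and is the source of the edge of `b`. -/
def Step (X : RawDiagram O M H) (a b : H) : Prop :=
  ∃ h k, X.SameEdge a h ∧ X.SameEdge b k ∧ X.pos h ∧ ¬ X.pos k ∧ X.vert h k

/-- There is a directed path starting with the edge of `a` and ending with the edge of `b`
(where these two edges are different). -/
def Reach (X : RawDiagram O M H) : H → H → Prop := Relation.TransGen X.Step

/-- The bare data form a planar graph. -/
structure IsPlanar (X : RawDiagram O M H) : Prop where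
  vert_equiv : Equivalence X.vert
  inv_inv : ∀ h, X.inv (X.inv h) = h
  /-- virtual vertices have degree two -/
  virtual_degree : ∀ h k, X.Virtual h → X.vert h k → X.SameEdge h k
  /-- orientation: the two half-edges of a two-element edge have opposite signs -/
  oriented : ∀ h, X.inv h ≠ h → (X.pos (X.inv h) ↔ ¬ X.pos h)
  /-- directedness: every vertex has an input -/
  exists_in : ∀ h, ∃ k, X.vert h k ∧ X.pos k
  /-- directedness: every vertex has an output -/
  exists_out : ∀ h, ∃ k, X.vert h k ∧ ¬ X.pos k
  /-- `lt` is a strict linear order on the set of edges -/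
  lt_irrefl : ∀ h k, X.lt h k → ¬ X.SameEdge h k
  lt_trans : ∀ h k l, X.lt h k → X.lt k l → X.lt h l
  lt_total : ∀ h k, ¬ X.SameEdge h k → X.lt h k ∨ X.lt k h
  lt_of_reach : ∀ a b, ¬ X.SameEdge a b → X.Reach a b → X.lt a b
  reach_of_between : ∀ a b c, ¬ X.SameEdge a b → X.Reach a b → X.lt a c → X.lt c b →
    X.Reach c b ∨ X.Reach a c

/-- `l` is the increasing list of the half-edges satisfying `p`. -/
def IsOrderedList (X : RawDiagram O M H) (p : H → Prop) (l : List H) : Prop :=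
  (∀ h, h ∈ l ↔ p h) ∧ l.Pairwise X.lt

/-- The increasing list of the half-edges satisfying `p` (which belong to different edges). -/
noncomputable def orderedList (X : RawDiagram O M H) (p : H → Prop) : List H :=
  Classical.epsilon (X.IsOrderedList p)

/-- The ordered list of inputs of the vertex of `h`. -/
noncomputable def inAt (X : RawDiagram O M H) (h : H) : List H :=
  X.orderedList fun k => X.vert h k ∧ X.pos k

/-- The ordered list of outputs of the vertex of `h`. -/
noncomputable def outAt (X : RawDiagram O M H) (h : H) : List H :=
  X.orderedList fun k => X.vert h k ∧ ¬ X.pos k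

/-- The ordered list of inputs of the graph. -/
noncomputable def inputs (X : RawDiagram O M H) : List H :=
  X.orderedList fun h => X.Leg h ∧ X.pos h

/-- The ordered list of outputs of the graph. -/
noncomputable def outputs (X : RawDiagram O M H) : List H :=
  X.orderedList fun h => X.Leg h ∧ ¬ X.pos h

/-- The domain, a word. -/
noncomputable def dom (X : RawDiagram O M H) : List O := X.inputs.map X.obj

/-- The codomain, a word. -/
noncomputable def cod (X : RawDiagram O M H) : List O := X.outputs.map X.obj

/-- Isomorphism of diagrams. -/
structure IsIso (X : RawDiagram O M H₁) (Y : RawDiagram O M H₂) (e : H₁ ≃ H₂) : Prop where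
  vert : ∀ h k, Y.vert (e h) (e k) ↔ X.vert h k
  inv : ∀ h, Y.inv (e h) = e (X.inv h)
  pos : ∀ h, Y.pos (e h) ↔ X.pos h
  lt : ∀ h k, Y.lt (e h) (e k) ↔ X.lt h k
  obj : ∀ h, Y.obj (e h) = X.obj h
  mor : ∀ h, Y.mor (e h) = X.mor h

/-- Two diagrams are isomorphic. -/
def Iso (X : RawDiagram O M H₁) (Y : RawDiagram O M H₂) : Prop := ∃ e : H₁ ≃ H₂, X.IsIso Y e

/-- A prime graph: it has exactly one vertex, and this vertex is real. -/
def IsPrime (X : RawDiagram O M H) : Prop :=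
  Nonempty H ∧ (∀ h k, X.vert h k) ∧ ∀ h, ¬ X.OnVirtualVertex h

/-- The invertible diagram of a word: one virtual vertex `{(i, -), (i, +)}` for every letter. -/
def identity (w : List O) : RawDiagram O M (Fin w.length × Bool) where
  vert a b := a.1 = b.1
  inv a := (a.1, !a.2)
  pos a := a.2 = true
  lt a b := a.1 < b.1
  obj a := w.get a.1
  mor _ := none

/-- The tensor product: disjoint union, the edges of `X` preceding the edges of `Y`. -/
def tensor (X : RawDiagram O M H₁) (Y : RawDiagram O M H₂) : RawDiagram O M (H₁ ⊕ H₂) where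
  vert
    | .inl h, .inl k => X.vert h k
    | .inr h, .inr k => Y.vert h k
    | _, _ => False
  inv := Sum.map X.inv Y.inv
  pos := Sum.elim X.pos Y.pos
  lt
    | .inl h, .inl k => X.lt h k
    | .inr h, .inr k => Y.lt h k
    | .inl _, .inr _ => True
    | .inr _, .inl _ => False
  obj := Sum.elim X.obj Y.obj
  mor := Sum.elim X.mor Y.mor

/-! Composition `Y ∘ X`: for every `k`, the `k`-th output `o` of `X` is grafted to the `k`-th
input `i` of `Y`. If both legs are real, they form a new edge `{o, i}`. If exactly one of them is
virtual, its virtual edge is removed. If both are virtual, `o` and `i` are removed and their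
partners form a new virtual edge (and virtual vertex). -/

/-- `o` is the `k`-th output of `X` and `i` is the `k`-th input of `Y`, for some `k`. -/
def Matched (X : RawDiagram O M H₁) (Y : RawDiagram O M H₂) (o : H₁) (i : H₂) : Prop :=
  ∃ k : ℕ, X.outputs[k]? = some o ∧ Y.inputs[k]? = some i

/-- The half-edges that remain in the composite. -/
def Keep (X : RawDiagram O M H₁) (Y : RawDiagram O M H₂) : H₁ ⊕ H₂ → Prop
  | .inl h => ¬ (X.Virtual h ∧ ¬ X.pos h) ∧
      ¬ (X.Virtual h ∧ ∃ i, Matched X Y (X.inv h) i ∧ ¬ Y.Virtual i)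
  | .inr h => ¬ (Y.Virtual h ∧ Y.pos h) ∧
      ¬ (Y.Virtual h ∧ ∃ o, Matched X Y o (Y.inv h) ∧ ¬ X.Virtual o)

/-- `a` and `b` are the partners of two virtual legs that are grafted to each other. -/
def Fused (X : RawDiagram O M H₁) (Y : RawDiagram O M H₂) (a : H₁) (b : H₂) : Prop :=
  X.Virtual a ∧ Y.Virtual b ∧ Matched X Y (X.inv a) (Y.inv b)

/-- `a` and `b` form a new two-element edge. -/
def Joined (X : RawDiagram O M H₁) (Y : RawDiagram O M H₂) (a : H₁) (b : H₂) : Prop :=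
  (Matched X Y a b ∧ ¬ X.Virtual a ∧ ¬ Y.Virtual b) ∨ Fused X Y a b

/-- `d` is the image of `c` under the involution of the composite. -/
def CompInv (X : RawDiagram O M H₁) (Y : RawDiagram O M H₂) : H₁ ⊕ H₂ → H₁ ⊕ H₂ → Prop
  | .inl a, .inl b => (∀ i, ¬ Joined X Y a i) ∧ X.inv a = b
  | .inr a, .inr b => (∀ o, ¬ Joined X Y o a) ∧ Y.inv a = b
  | .inl a, .inr b => Joined X Y a b
  | .inr b, .inl a => Joined X Y a b

/-- The vertices of the composite. -/
def CompVert (X : RawDiagram O M H₁) (Y : RawDiagram O M H₂) : H₁ ⊕ H₂ → H₁ ⊕ H₂ → Prop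
  | .inl a, .inl b => X.vert a b
  | .inr a, .inr b => Y.vert a b
  | .inl a, .inr b => Fused X Y a b
  | .inr b, .inl a => Fused X Y a b

/-- For some `k`, the edge of `a` is at most that of the `k`-th output of `X`, and the edge of
the `k`-th input of `Y` is at most that of `b`. -/
def Before (X : RawDiagram O M H₁) (Y : RawDiagram O M H₂) (a : H₁) (b : H₂) : Prop :=
  ∃ o i, Matched X Y o i ∧ (X.lt a o ∨ X.SameEdge a o) ∧ (Y.lt i b ∨ Y.SameEdge i b)

/-- For some `k`, `a` belongs to the edge of the `k`-th output of `X` and `b` to the edge of the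
`k`-th input of `Y`, so that they belong to the same new edge. -/
def SameNewEdge (X : RawDiagram O M H₁) (Y : RawDiagram O M H₂) (a : H₁) (b : H₂) : Prop :=
  ∃ o i, Matched X Y o i ∧ X.SameEdge a o ∧ Y.SameEdge i b

/-- The order of the edges of the composite is the shuffle
`Q₁ < e₁ < P₁ < Q₂ < e₂ < P₂ < ⋯ < Qₙ < eₙ < Pₙ`, where `eₖ` is the `k`-th new edge, `Qₖ`
consists of the edges of `X` between its `(k-1)`-st and its `k`-th output edge, and `Pₖ` of the
edges of `Y` between its `k`-th and its `(k+1)`-st input edge. -/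
def CompLt (X : RawDiagram O M H₁) (Y : RawDiagram O M H₂) : H₁ ⊕ H₂ → H₁ ⊕ H₂ → Prop
  | .inl a, .inl b => X.lt a b
  | .inr a, .inr b => Y.lt a b
  | .inl a, .inr b => Before X Y a b ∧ ¬ SameNewEdge X Y a b
  | .inr b, .inl a => ¬ Before X Y a b

/-- The composite `Y ∘ X`. -/
noncomputable def comp (Y : RawDiagram O M H₂) (X : RawDiagram O M H₁) :
    RawDiagram O M {c : H₁ ⊕ H₂ // Keep X Y c} where
  vert c d := CompVert X Y c.1 d.1
  inv c := @Classical.epsilon _ ⟨c⟩ fun d => CompInv X Y c.1 d.1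
  pos c := Sum.elim X.pos Y.pos c.1
  lt c d := CompLt X Y c.1 d.1
  obj c := Sum.elim X.obj Y.obj c.1
  mor c := Sum.elim X.mor Y.mor c.1

/-- Change of decorations. -/
def map {O' M' : Type u} (a : O → O') (b : M → M') (X : RawDiagram O M H) :
    RawDiagram O' M' H where
  vert := X.vert
  inv := X.inv
  pos := X.pos
  lt := X.lt
  obj h := a (X.obj h)
  mor h := (X.mor h).map b

/-! Facts on ordered lists -/

theorem isOrderedList_unique {X : RawDiagram O M H} (hX : X.IsPlanar) {p : H → Prop}
    {l l' : List H} (hl : X.IsOrderedList p l) (hl' : X.IsOrderedList p l') : l = l' := by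
  have irr : ∀ h, ¬ X.lt h h := fun h hh => hX.lt_irrefl h h hh (Or.inl rfl)
  have nd : ∀ {m : List H}, m.Pairwise X.lt → m.Nodup := fun hm =>
    hm.imp fun {a b} hab => by rintro rfl; exact irr _ hab
  have hp : l.Perm l' := (List.perm_ext_iff_of_nodup (nd hl.2) (nd hl'.2)).2 fun a => by
    rw [hl.1, hl'.1]
  exact hp.eq_of_pairwise (fun a b _ _ hab hba => (irr _ (hX.lt_trans _ _ _ hab hba)).elim)
    hl.2 hl'.2

theorem exists_isOrderedList [Finite H] {X : RawDiagram O M H} (hX : X.IsPlanar) (p : H → Prop)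
    (hp : ∀ h k, p h → p k → X.SameEdge h k → k = h) : ∃ l, X.IsOrderedList p l := by
  classical
  have key : ∀ s : Finset H, (∀ h ∈ s, p h) →
      ∃ l : List H, (∀ h, h ∈ l ↔ h ∈ s) ∧ l.Pairwise X.lt := by
    intro s
    induction s using Finset.induction_on with
    | empty => intro _; exact ⟨[], by simp, List.Pairwise.nil⟩
    | insert a s ha ih =>
      intro hs
      obtain ⟨l, hl, hlt⟩ := ih fun h hh => hs h (Finset.mem_insert_of_mem hh)
      refine ⟨l.filter (fun b => decide (X.lt b a)) ++
        a :: l.filter (fun b => decide (¬ X.lt b a)), ?_, ?_⟩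
      · intro h
        rw [List.mem_append, List.mem_cons, List.mem_filter, List.mem_filter, hl,
          Finset.mem_insert]
        simp only [decide_eq_true_eq]
        tauto
      · have gt : ∀ b ∈ l, ¬ X.lt b a → X.lt a b := by
          intro b hb hba
          refine (hX.lt_total a b fun hab => ?_).resolve_right hba
          have hbs := (hl b).1 hb
          have := hp a b (hs a (Finset.mem_insert_self _ _))
            (hs b (Finset.mem_insert_of_mem hbs)) hab
          exact ha (this ▸ hbs)
        rw [List.pairwise_append, List.pairwise_cons]
        refine ⟨hlt.sublist List.filter_sublist, ⟨?_, hlt.sublist List.filter_sublist⟩, ?_⟩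
        · intro b hb
          rw [List.mem_filter, decide_eq_true_eq] at hb
          exact gt b hb.1 hb.2
        · intro b hb c hc
          rw [List.mem_filter, decide_eq_true_eq] at hb
          rcases List.mem_cons.1 hc with rfl | hc
          · exact hb.2
          · rw [List.mem_filter, decide_eq_true_eq] at hc
            exact hX.lt_trans _ _ _ hb.2 (gt c hc.1 hc.2)
  have : Fintype H := Fintype.ofFinite H
  obtain ⟨l, hl, hlt⟩ := key (Finset.univ.filter p) (by simp)
  exact ⟨l, by simpa using hl, hlt⟩

theorem eq_of_sameEdge_of_pos_iff {X : RawDiagram O M H} (hX : X.IsPlanar) {h k : H}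
    (hk : X.pos h ↔ X.pos k) (he : X.SameEdge h k) : k = h := by
  rcases he with he | he
  · exact he
  · by_contra hne
    have hi : X.inv h ≠ h := fun h' => hne (he.trans h')
    have := hX.oriented h hi
    rw [← he] at this
    tauto

theorem isOrderedList_inputs [Finite H] {X : RawDiagram O M H} (hX : X.IsPlanar) :
    X.IsOrderedList (fun h => X.Leg h ∧ X.pos h) X.inputs :=
  Classical.epsilon_spec (exists_isOrderedList hX _ fun h k hh hk he =>
    eq_of_sameEdge_of_pos_iff hX (by tauto) he)

theorem isOrderedList_outputs [Finite H] {X : RawDiagram O M H} (hX : X.IsPlanar) :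
    X.IsOrderedList (fun h => X.Leg h ∧ ¬ X.pos h) X.outputs :=
  Classical.epsilon_spec (exists_isOrderedList hX _ fun h k hh hk he =>
    eq_of_sameEdge_of_pos_iff hX (by tauto) he)

theorem IsIso.symm {X : RawDiagram O M H₁} {Y : RawDiagram O M H₂} {e : H₁ ≃ H₂}
    (he : X.IsIso Y e) : Y.IsIso X e.symm where
  vert h k := by rw [← he.vert, e.apply_symm_apply, e.apply_symm_apply]
  inv h := by
    apply e.injective
    rw [← he.inv, e.apply_symm_apply, e.apply_symm_apply]
  pos h := by rw [← he.pos, e.apply_symm_apply]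
  lt h k := by rw [← he.lt, e.apply_symm_apply, e.apply_symm_apply]
  obj h := by rw [← he.obj, e.apply_symm_apply]
  mor h := by rw [← he.mor, e.apply_symm_apply]

theorem IsIso.leg {X : RawDiagram O M H₁} {Y : RawDiagram O M H₂} {e : H₁ ≃ H₂}
    (he : X.IsIso Y e) (h : H₁) : Y.Leg (e h) ↔ X.Leg h := by
  simp only [Leg, Virtual, he.inv, he.vert, e.injective.eq_iff, ne_eq]

theorem IsIso.isOrderedList {X : RawDiagram O M H₁} {Y : RawDiagram O M H₂} {e : H₁ ≃ H₂}
    (he : X.IsIso Y e) {p : H₁ → Prop} {q : H₂ → Prop} (hpq : ∀ h, q (e h) ↔ p h) {l : List H₁}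
    (hl : X.IsOrderedList p l) : Y.IsOrderedList q (l.map e) := by
  refine ⟨fun k => ?_, ?_⟩
  · obtain ⟨h, rfl⟩ := e.surjective k
    rw [hpq, ← hl.1, List.mem_map_of_injective e.injective]
  · rw [List.pairwise_map]
    exact hl.2.imp fun {a b} hab => (he.lt a b).2 hab

theorem IsIso.dom_eq [Finite H₁] [Finite H₂] {X : RawDiagram O M H₁} {Y : RawDiagram O M H₂}
    {e : H₁ ≃ H₂} (he : X.IsIso Y e) (hX : X.IsPlanar) (hY : Y.IsPlanar) : X.dom = Y.dom := by
  have h := isOrderedList_unique hY (isOrderedList_inputs hY)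
    (he.isOrderedList (fun h => by rw [he.leg, he.pos]) (isOrderedList_inputs hX))
  rw [dom, dom, h, List.map_map]
  exact List.map_congr_left fun a _ => (he.obj a).symm

theorem IsIso.cod_eq [Finite H₁] [Finite H₂] {X : RawDiagram O M H₁} {Y : RawDiagram O M H₂}
    {e : H₁ ≃ H₂} (he : X.IsIso Y e) (hX : X.IsPlanar) (hY : Y.IsPlanar) : X.cod = Y.cod := by
  have h := isOrderedList_unique hY (isOrderedList_outputs hY)
    (he.isOrderedList (fun h => by rw [he.leg, he.pos]) (isOrderedList_outputs hX))
  rw [cod, cod, h, List.map_map]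
  exact List.map_congr_left fun a _ => (he.obj a).symm

theorem IsPlanar.map {O' M' : Type u} (a : O → O') (b : M → M') {X : RawDiagram O M H}
    (hX : X.IsPlanar) : (X.map a b).IsPlanar :=
  ⟨hX.vert_equiv, hX.inv_inv, hX.virtual_degree, hX.oriented, hX.exists_in, hX.exists_out,
    hX.lt_irrefl, hX.lt_trans, hX.lt_total, hX.lt_of_reach, hX.reach_of_between⟩

theorem dom_map {O' M' : Type u} (a : O → O') (b : M → M') (X : RawDiagram O M H) :
    (X.map a b).dom = X.dom.map a := by
  rw [dom, dom, List.map_map]; rfl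

theorem cod_map {O' M' : Type u} (a : O → O') (b : M → M') (X : RawDiagram O M H) :
    (X.map a b).cod = X.cod.map a := by
  rw [cod, cod, List.map_map]; rfl

end RawDiagram

/-- What planar graphs are decorated with: a set `Ob` for the edges, a set `Mor` for the vertices,
and the relations that a word is an admissible domain, or codomain, for an element of `Mor`. -/
structure Labels where
  Ob : Type u
  Mor : Type u
  IsDom : Mor → List Ob → Prop
  IsCod : Mor → List Ob → Prop

/-- Decorations in a tensor scheme. -/
abbrev TSch.labels (D : TSch.{u}) : Labels.{u} where
  Ob := D.Ob
  Mor := D.Mor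
  IsDom f w := D.src f = w
  IsCod f w := D.tgt f = w

/-- Decorations in a strict tensor category. -/
abbrev StrT.labels (V : StrT.{u}) : Labels.{u} where
  Ob := V.Ob
  Mor := V.Mor
  IsDom f w := V.src f = V.tensorWord w
  IsCod f w := V.tgt f = V.tensorWord w

/-- Maps of decorations that preserve admissible domains and codomains. -/
@[ext]
structure Labels.Hom (L L' : Labels.{u}) where
  o : L.Ob → L'.Ob
  m : L.Mor → L'.Mor
  isDom : ∀ f w, L.IsDom f w → L'.IsDom (m f) (w.map o)
  isCod : ∀ f w, L.IsCod f w → L'.IsCod (m f) (w.map o)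

/-- The decorations form a valuation: every edge is decorated by an object, and exactly the real
vertices are decorated, by a morphism from the word on the ordered list of inputs to the word on
the ordered list of outputs of the vertex. -/
structure RawDiagram.IsValuation (L : Labels.{u}) {H : Type} (X : RawDiagram L.Ob L.Mor H) :
    Prop where
  obj_inv : ∀ h, X.obj (X.inv h) = X.obj h
  mor_congr : ∀ h k, X.vert h k → X.mor h = X.mor k
  mor_virtual : ∀ h, X.OnVirtualVertex h → X.mor h = none
  mor_real : ∀ h, ¬ X.OnVirtualVertex h → ∃ f, X.mor h = some f ∧
    L.IsDom f ((X.inAt h).map X.obj) ∧ L.IsCod f ((X.outAt h).map X.obj)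

/-- A planar diagram. Since only isomorphism classes matter, the finite set of half-edges is taken
to be some `Fin n`. -/
structure Diagram (L : Labels.{u}) where
  n : ℕ
  raw : RawDiagram L.Ob L.Mor (Fin n)
  planar : raw.IsPlanar
  valuation : raw.IsValuation L

/-- Isomorphism of planar diagrams. -/
instance Diagram.setoid (L : Labels.{u}) : Setoid (Diagram L) where
  r X Y := X.raw.Iso Y.raw
  iseqv :=
    { refl := fun _ => ⟨Equiv.refl _, fun _ _ => Iff.rfl, fun _ => rfl, fun _ => Iff.rfl,
        fun _ _ => Iff.rfl, fun _ => rfl, fun _ => rfl⟩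
      symm := fun ⟨e, he⟩ => ⟨e.symm, he.symm⟩
      trans := fun ⟨e, he⟩ ⟨f, hf⟩ => ⟨e.trans f,
        { vert := fun h k => (hf.vert _ _).trans (he.vert h k)
          inv := fun h => (hf.inv _).trans (congrArg f (he.inv h))
          pos := fun h => (hf.pos _).trans (he.pos h)
          lt := fun h k => (hf.lt _ _).trans (he.lt h k)
          obj := fun h => (hf.obj _).trans (he.obj h)
          mor := fun h => (hf.mor _).trans (he.mor h) }⟩ }

/-- The set of isomorphism classes of planar diagrams. -/
def Diag (L : Labels.{u}) : Type u := Quotient (Diagram.setoid L)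

namespace Diag

variable {L L' L'' : Labels.{u}}

/-- The isomorphism class of a planar diagram. -/
def mk (X : Diagram L) : Diag L := Quotient.mk _ X

/-- The domain of an isomorphism class. -/
noncomputable def dom (q : Diag L) : List L.Ob :=
  Quotient.lift (s := Diagram.setoid L) (fun X => X.raw.dom)
    (fun X Y ⟨_, he⟩ => he.dom_eq X.planar Y.planar) q

/-- The codomain of an isomorphism class. -/
noncomputable def cod (q : Diag L) : List L.Ob :=
  Quotient.lift (s := Diagram.setoid L) (fun X => X.raw.cod)
    (fun X Y ⟨_, he⟩ => he.cod_eq X.planar Y.planar) q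

/-- The isomorphism class `q` consists of prime diagrams. -/
def IsPrime (q : Diag L) : Prop := ∃ X : Diagram L, mk X = q ∧ X.raw.IsPrime

end Diag

/-- Push-forward of planar diagrams along a map of decorations. -/
def Diagram.map {L L' : Labels.{u}} (φ : L.Hom L') (X : Diagram L) : Diagram L' where
  n := X.n
  raw := X.raw.map φ.o φ.m
  planar := X.planar.map φ.o φ.m
  valuation :=
    { obj_inv := fun h => congrArg φ.o (X.valuation.obj_inv h)
      mor_congr := fun h k hk => congrArg (Option.map φ.m) (X.valuation.mor_congr h k hk)
      mor_virtual := fun h hh => congrArg (Option.map φ.m) (X.valuation.mor_virtual h hh)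
      mor_real := fun h hh => by
        obtain ⟨f, hf, hs, ht⟩ := X.valuation.mor_real h hh
        refine ⟨φ.m f, congrArg (Option.map φ.m) hf, ?_, ?_⟩
        · have := φ.isDom f _ hs
          rw [List.map_map] at this
          exact this
        · have := φ.isCod f _ ht
          rw [List.map_map] at this
          exact this }

namespace Diag

variable {L L' L'' : Labels.{u}}

/-- Push-forward of isomorphism classes along a map of decorations. -/
def map (φ : L.Hom L') (q : Diag L) : Diag L' :=
  Quotient.map' (s₁ := Diagram.setoid L) (s₂ := Diagram.setoid L') (Diagram.map φ)
    (fun _ _ ⟨e, he⟩ => ⟨e, he.vert, he.inv, he.pos, he.lt, fun h => congrArg φ.o (he.obj h),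
      fun h => congrArg (Option.map φ.m) (he.mor h)⟩) q

theorem dom_map (φ : L.Hom L') (q : Diag L) : (q.map φ).dom = q.dom.map φ.o := by
  induction q using Quotient.inductionOn with
  | _ X => exact X.raw.dom_map φ.o φ.m

theorem cod_map (φ : L.Hom L') (q : Diag L) : (q.map φ).cod = q.cod.map φ.o := by
  induction q using Quotient.inductionOn with
  | _ X => exact X.raw.cod_map φ.o φ.m

theorem map_id (φ : L.Hom L) (ho : ∀ x, φ.o x = x) (hm : ∀ f, φ.m f = f) (q : Diag L) :
    q.map φ = q := by
  induction q using Quotient.inductionOn with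
  | _ X =>
    refine Quotient.sound ⟨Equiv.refl _, fun _ _ => Iff.rfl, fun _ => rfl, fun _ => Iff.rfl,
      fun _ _ => Iff.rfl, fun h => (ho _).symm, fun h => ?_⟩
    change X.raw.mor h = (X.raw.mor h).map φ.m
    rw [funext hm, Option.map_id']

theorem map_comp (φ : L.Hom L') (ψ : L'.Hom L'') (χ : L.Hom L'')
    (ho : ∀ x, χ.o x = ψ.o (φ.o x)) (hm : ∀ f, χ.m f = ψ.m (φ.m f)) (q : Diag L) :
    q.map χ = (q.map φ).map ψ := by
  induction q using Quotient.inductionOn with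
  | _ X =>
    refine Quotient.sound ⟨Equiv.refl _, fun _ _ => Iff.rfl, fun _ => rfl, fun _ => Iff.rfl,
      fun _ _ => Iff.rfl, fun h => (ho _).symm, fun h => ?_⟩
    change ((X.raw.mor h).map φ.m).map ψ.m = (X.raw.mor h).map χ.m
    rw [Option.map_map, funext hm]
    rfl

theorem IsPrime.map (φ : L.Hom L') {q : Diag L} (hq : q.IsPrime) : (q.map φ).IsPrime := by
  obtain ⟨X, rfl, hX⟩ := hq
  exact ⟨X.map φ, rfl, hX⟩

theorem IsPrime.leg {X : Diagram L} (hX : X.raw.IsPrime) (h : Fin X.n) : X.raw.Leg h := by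
  by_contra hn
  exact hX.2.2 h ⟨h, hX.2.1 h h, fun h' => hn (Or.inl h'), hX.2.1 _ _⟩

theorem IsPrime.dom_ne_nil {q : Diag L} (hq : q.IsPrime) : q.dom ≠ [] := by
  obtain ⟨X, rfl, hX⟩ := hq
  obtain ⟨h⟩ := hX.1
  obtain ⟨k, -, hk⟩ := X.planar.exists_in h
  have := ((RawDiagram.isOrderedList_inputs X.planar).1 k).2 ⟨IsPrime.leg hX k, hk⟩
  intro h0
  rw [List.map_eq_nil_iff.1 h0] at this
  simp at this

theorem IsPrime.cod_ne_nil {q : Diag L} (hq : q.IsPrime) : q.cod ≠ [] := by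
  obtain ⟨X, rfl, hX⟩ := hq
  obtain ⟨h⟩ := hX.1
  obtain ⟨k, -, hk⟩ := X.planar.exists_out h
  have := ((RawDiagram.isOrderedList_outputs X.planar).1 k).2 ⟨IsPrime.leg hX k, hk⟩
  intro h0
  rw [List.map_eq_nil_iff.1 h0] at this
  simp at this

end Diag

/-! ### The functor `U` -/

/-- The map of decorations given by a strict tensor functor. -/
def StrT.Functor.labelsHom {V W : StrT.{u}} (K : V.Functor W) : V.labels.Hom W.labels where
  o := K.o
  m := K.m
  isDom f w hf :=
    (K.isFunctor.src_map f).trans ((congrArg K.o hf).trans (K.o_tensorWord w))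
  isCod f w hf :=
    (K.isFunctor.tgt_map f).trans ((congrArg K.o hf).trans (K.o_tensorWord w))

/-- The tensor scheme `U(V)`: its objects are those of `V` and its morphisms are the isomorphism
classes of prime diagrams in `V`. -/
noncomputable def primeScheme (V : StrT.{u}) : TSch.{u} where
  Ob := V.Ob
  Mor := {q : Diag V.labels // q.IsPrime}
  src q := q.1.dom
  tgt q := q.1.cod
  src_ne q := q.2.dom_ne_nil
  tgt_ne q := q.2.cod_ne_nil

/-- The functor `U`, which acts on prime diagrams by push-forward. -/
noncomputable def primeFunctor : StrT.{u} ⥤ TSch.{u} where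
  obj := primeScheme
  map {V W} K :=
    { o := StrT.Functor.o K
      m := fun q => ⟨q.1.map (StrT.Functor.labelsHom K), q.2.map _⟩
      src_map := fun q => q.1.dom_map _
      tgt_map := fun q => q.1.cod_map _ }
  map_id V := by
    refine TSch.Hom.ext rfl (funext fun q => Subtype.ext ?_)
    exact Diag.map_id _ (fun _ => rfl) (fun _ => rfl) _
  map_comp {V W X} K K' := by
    refine TSch.Hom.ext rfl (funext fun q => Subtype.ext ?_)
    exact Diag.map_comp _ _ _ (fun _ => rfl) (fun _ => rfl) _

/-! ### The functor `F` -/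

/-- The map of decorations given by a morphism of tensor schemes. -/
def TSch.Hom.labelsHom {D E : TSch.{u}} (φ : D.Hom E) : D.labels.Hom E.labels where
  o := φ.o
  m := φ.m
  isDom f _ hf := (φ.src_map f).trans (congrArg (List.map φ.o) hf)
  isCod f _ hf := (φ.tgt_map f).trans (congrArg (List.map φ.o) hf)

/-- The set of morphisms of `F(D)`: isomorphism classes of planar diagrams in `D`. -/
abbrev TSch.Diag (D : TSch.{u}) : Type u := TensorCalculus.Diag D.labels

/-- The domain of a planar diagram in `D`, a word in the objects of `D`. -/
noncomputable abbrev TSch.dom (D : TSch.{u}) (q : D.Diag) : List D.Ob :=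
  TensorCalculus.Diag.dom q

/-- The codomain of a planar diagram in `D`, a word in the objects of `D`. -/
noncomputable abbrev TSch.cod (D : TSch.{u}) (q : D.Diag) : List D.Ob :=
  TensorCalculus.Diag.cod q

/-- The type of strict tensor category structures with words in the objects of `D` as objects and
classes of planar diagrams in `D` as morphisms. -/
abbrev DiagramStructure (D : TSch.{u}) : Type u :=
  StrictTensorStructure (List D.Ob) D.Diag D.dom D.cod

/-- All the operations of the strict tensor category structure `S` are the standard ones: the
empty word, juxtaposition of words, the invertible diagrams as identities, and the tensor product
and composition of planar diagrams. -/
structure IsDiagrammatic (D : TSch.{u}) (S : DiagramStructure D) : Prop where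
  unit_eq : S.unit = []
  tensorOb_eq : ∀ v w, S.tensorOb v w = v ++ w
  id_eq : ∀ w : List D.Ob, ∃ Z : Diagram D.labels,
    Z.raw.Iso (RawDiagram.identity (M := D.Mor) w) ∧ S.id w = Diag.mk Z
  tensorMor_eq : ∀ X Y : Diagram D.labels, ∃ Z : Diagram D.labels,
    Z.raw.Iso (X.raw.tensor Y.raw) ∧ S.tensorMor (Diag.mk X) (Diag.mk Y) = Diag.mk Z
  comp_eq : ∀ (Y X : Diagram D.labels) (h : D.cod (Diag.mk X) = D.dom (Diag.mk Y)),
    ∃ Z : Diagram D.labels,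
      Z.raw.Iso (Y.raw.comp X.raw) ∧ S.comp (Diag.mk Y) (Diag.mk X) h = Diag.mk Z

/-- The functor `F` for given strict tensor category structures on words and diagrams for which
the push-forwards of diagrams are strict tensor functors. -/
noncomputable def freeFunctor (S : ∀ D : TSch.{u}, DiagramStructure D)
    (hS : ∀ {D E : TSch.{u}} (φ : D.Hom E),
      IsStrictTensorFunctor (S D) (S E) (List.map φ.o) (Diag.map φ.labelsHom)) :
    TSch.{u} ⥤ StrT.{u} where
  obj D := ⟨List D.Ob, D.Diag, D.dom, D.cod, S D⟩
  map φ := ⟨List.map (TSch.Hom.o φ), Diag.map (TSch.Hom.labelsHom φ), hS φ⟩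
  map_id D := by
    refine StrT.Functor.ext (funext fun w => List.map_id' w) (funext fun q => ?_)
    exact Diag.map_id _ (fun _ => rfl) (fun _ => rfl) _
  map_comp φ ψ := by
    refine StrT.Functor.ext (funext fun w => ?_) (funext fun q => ?_)
    · exact (List.map_map (f := TSch.Hom.o φ) (g := TSch.Hom.o ψ) (l := w)).symm
    · exact Diag.map_comp _ _ _ (fun _ => rfl) (fun _ => rfl) _

end TensorCalculus

namespace TensorCalculus

/-! ### Increasing enumerations of finite linear orders -/

section SortedList

variable {E E' : Type} [LinearOrder E] [Finite E] [LinearOrder E'] [Finite E']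

/-- The increasing list of the elements satisfying `p`. -/
noncomputable def sortedList (p : E → Prop) : List E :=
  (Set.toFinite {e | p e}).toFinset.sort (· ≤ ·)

theorem mem_sortedList {p : E → Prop} {e : E} : e ∈ sortedList p ↔ p e := by
  simp [sortedList]

theorem pairwise_sortedList (p : E → Prop) : (sortedList p).Pairwise (· < ·) :=
  List.sortedLT_iff_pairwise.1 (Finset.sortedLT_sort _)

theorem eq_sortedList {p : E → Prop} {l : List E} (hl : l.Pairwise (· < ·))
    (h : ∀ e, e ∈ l ↔ p e) : l = sortedList p := by
  have nd : ∀ {m : List E}, m.Pairwise (· < ·) → m.Nodup := fun hm =>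
    hm.imp fun {a b} hab => hab.ne
  have hp : l.Perm (sortedList p) :=
    (List.perm_ext_iff_of_nodup (nd hl) (nd (pairwise_sortedList p))).2 fun a => by
      rw [h, mem_sortedList]
  exact hp.eq_of_pairwise (fun a b _ _ hab hba => (lt_asymm hab hba).elim)
    hl (pairwise_sortedList p)

theorem map_sortedList {p : E → Prop} {p' : E' → Prop} {j : E → E'} (hj : StrictMono j)
    (h : ∀ e', p' e' ↔ ∃ e, p e ∧ j e = e') : (sortedList p).map j = sortedList p' := by
  refine eq_sortedList ?_ fun e' => ?_
  · rw [List.pairwise_map]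
    exact (pairwise_sortedList p).imp fun {a b} hab => hj hab
  · simp only [List.mem_map, mem_sortedList, h]

theorem sortedList_append {p p₁ p₂ : E → Prop} (h : ∀ e, p e ↔ p₁ e ∨ p₂ e)
    (hlt : ∀ a b, p₁ a → p₂ b → a < b) : sortedList p = sortedList p₁ ++ sortedList p₂ := by
  refine (eq_sortedList ?_ fun e => ?_).symm
  · rw [List.pairwise_append]
    exact ⟨pairwise_sortedList _, pairwise_sortedList _, fun a ha b hb =>
      hlt a b (mem_sortedList.1 ha) (mem_sortedList.1 hb)⟩
  · simp only [List.mem_append, mem_sortedList, h]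

theorem exists_orderIso_subtype (p : E → Prop) :
    ∃ f : Fin (sortedList p).length ≃o {e // p e}, ∀ i, (f i).1 = (sortedList p).get i := by
  have hm : StrictMono fun i : Fin (sortedList p).length =>
      (⟨(sortedList p).get i, mem_sortedList.1 (List.get_mem _ _)⟩ : {e // p e}) := fun i j hij =>
    List.pairwise_iff_get.1 (pairwise_sortedList p) i j hij
  refine ⟨hm.orderIsoOfSurjective _ fun e => ?_, fun i => rfl⟩
  obtain ⟨i, hi⟩ := List.mem_iff_get.1 (mem_sortedList.2 e.2)
  exact ⟨i, Subtype.ext hi⟩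

/-- Equal words have equal length, so the `k`-th element on one side can be matched with the `k`-th
on the other. This is how the outputs of one graph are paired with the inputs of the next. -/
theorem exists_orderIso_of_map_sortedList_eq {O : Type u} {p : E → Prop} {p' : E' → Prop}
    {obj : E → O} {obj' : E' → O} (h : (sortedList p).map obj = (sortedList p').map obj') :
    ∃ θ : {e // p e} ≃o {e // p' e}, ∀ e, obj' (θ e).1 = obj e.1 := by
  obtain ⟨f, hf⟩ := exists_orderIso_subtype p
  obtain ⟨f', hf'⟩ := exists_orderIso_subtype p'
  have hlen : (sortedList p).length = (sortedList p').length := by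
    simpa using congrArg List.length h
  refine ⟨(f.symm.trans (Fin.castOrderIso hlen)).trans f', fun e => ?_⟩
  obtain ⟨i, rfl⟩ := f.surjective e
  have h1 : ((sortedList p).map obj)[i.1]? = ((sortedList p').map obj')[i.1]? := by rw [h]
  have h2 : i.1 < (sortedList p').length := hlen ▸ i.2
  rw [hf]
  simp only [OrderIso.trans_apply, OrderIso.symm_apply_apply, hf', List.get_eq_getElem,
    Fin.castOrderIso_apply, Fin.val_cast]
  simpa [i.2, h2] using h1.symm

-- Compatibility with `≤` and antisymmetry make the relation single-valued. Isomorphisms can thus be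
-- described by relations with several overlapping clauses, without defining a function by cases.
omit [Finite E] [Finite E'] in
theorem exists_orderIso_of_rel {R : E → E' → Prop} (h : ∀ e, ∃ e', R e e')
    (h' : ∀ e', ∃ e, R e e') (hle : ∀ a a' b b', R a a' → R b b' → (a ≤ b ↔ a' ≤ b')) :
    ∃ θ : E ≃o E', ∀ e e', R e e' ↔ θ e = e' := by
  choose f hf using h
  have hm : StrictMono f := fun a b hab => by
    rw [← not_le] at hab ⊢
    rwa [← hle _ _ _ _ (hf b) (hf a)]
  have huniq : ∀ e e', R e e' ↔ f e = e' := fun e e' => by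
    refine ⟨fun he => ?_, fun he => he ▸ hf e⟩
    exact le_antisymm ((hle _ _ _ _ (hf e) he).1 le_rfl) ((hle _ _ _ _ he (hf e)).1 le_rfl)
  exact ⟨hm.orderIsoOfSurjective _ fun e' => (h' e').imp fun e he => (huniq e e').1 he, huniq⟩

end SortedList

/-! ### Edge graphs

Planar diagrams are presented by their ordered set of edges: an edge has at most one source and
at most one target, and it is virtual if it has neither. -/

/-- A decorated graph with a linearly ordered set of edges. -/
structure EdgeGraph (O M : Type u) : Type (max 1 u) where
  E : Type
  V : Type
  [linE : LinearOrder E]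
  [finE : Finite E]
  /-- the source of an edge -/
  s : E → Option V
  /-- the target of an edge -/
  t : E → Option V
  obj : E → O
  mor : V → M

attribute [instance] EdgeGraph.linE EdgeGraph.finE

namespace EdgeGraph

variable {O M : Type u}

/-- The target of `a` is the source of `b`. -/
def Step (Z : EdgeGraph O M) (a b : Z.E) : Prop := ∃ v, Z.t a = some v ∧ Z.s b = some v

/-- There is a directed path from `a` to `b` of positive length. -/
def Reach (Z : EdgeGraph O M) : Z.E → Z.E → Prop := Relation.TransGen Z.Step

/-- The word on the edges satisfying `p`. -/
noncomputable def word (Z : EdgeGraph O M) (p : Z.E → Prop) : List O := (sortedList p).map Z.obj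

/-- The word on the inputs. -/
noncomputable def inWord (Z : EdgeGraph O M) : List O := Z.word fun e => Z.s e = none

/-- The word on the outputs. -/
noncomputable def outWord (Z : EdgeGraph O M) : List O := Z.word fun e => Z.t e = none

theorem word_append {Z : EdgeGraph O M} {p p₁ p₂ : Z.E → Prop} (h : ∀ e, p e ↔ p₁ e ∨ p₂ e)
    (hlt : ∀ a b, p₁ a → p₂ b → a < b) : Z.word p = Z.word p₁ ++ Z.word p₂ := by
  rw [word, sortedList_append h hlt, List.map_append]; rfl

theorem word_congr {Z : EdgeGraph O M} {p p' : Z.E → Prop} (h : ∀ e, p e ↔ p' e) :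
    Z.word p = Z.word p' := by
  rw [funext fun e => propext (h e)]

theorem word_eq_nil {Z : EdgeGraph O M} {p : Z.E → Prop} : Z.word p = [] ↔ ∀ e, ¬ p e := by
  rw [word, List.map_eq_nil_iff, List.eq_nil_iff_forall_not_mem]
  simp only [mem_sortedList]

/-- Planarity of the order and admissibility of the decorations. -/
structure IsDiagram (L : Labels.{u}) (Z : EdgeGraph L.Ob L.Mor) : Prop where
  exists_in : ∀ v, ∃ e, Z.t e = some v
  exists_out : ∀ v, ∃ e, Z.s e = some v
  lt_of_step : ∀ a b, Z.Step a b → a < b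
  between : ∀ a b c, Z.Reach a b → a < c → c < b → Z.Reach a c ∨ Z.Reach c b
  isDom : ∀ v, L.IsDom (Z.mor v) (Z.word fun e => Z.t e = some v)
  isCod : ∀ v, L.IsCod (Z.mor v) (Z.word fun e => Z.s e = some v)

theorem IsDiagram.lt_of_reach {L : Labels.{u}} {Z : EdgeGraph L.Ob L.Mor} (hZ : Z.IsDiagram L)
    {a b : Z.E} (h : Z.Reach a b) : a < b := by
  induction h with
  | single h => exact hZ.lt_of_step _ _ h
  | tail _ h ih => exact ih.trans (hZ.lt_of_step _ _ h)

/-- Choosing an outgoing edge for every vertex is injective, and there are finitely many edges. -/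
theorem IsDiagram.finite {L : Labels.{u}} {Z : EdgeGraph L.Ob L.Mor} (hZ : Z.IsDiagram L) :
    Finite Z.V := by
  choose f hf using hZ.exists_out
  exact Finite.of_injective f fun v w h => by
    have := hf v
    rw [h, hf] at this
    exact (Option.some.inj this).symm

/-- Passing to an outgoing edge of the target strictly increases the edge. In a finite order this
stops, and it can only stop at an edge without target. -/
theorem IsDiagram.exists_output {L : Labels.{u}} {Z : EdgeGraph L.Ob L.Mor} (hZ : Z.IsDiagram L)
    (a : Z.E) : ∃ o, Z.t o = none ∧ (a = o ∨ Z.Reach a o) := by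
  induction a using WellFoundedGT.induction with
  | ind a ih =>
    rcases ha : Z.t a with _ | v
    · exact ⟨a, ha, Or.inl rfl⟩
    · obtain ⟨b, hb⟩ := hZ.exists_out v
      have hab : Z.Step a b := ⟨v, ha, hb⟩
      obtain ⟨o, ho, h⟩ := ih b (hZ.lt_of_step _ _ hab)
      refine ⟨o, ho, Or.inr ?_⟩
      rcases h with rfl | h
      · exact .single hab
      · exact .head hab h

theorem IsDiagram.exists_input {L : Labels.{u}} {Z : EdgeGraph L.Ob L.Mor} (hZ : Z.IsDiagram L)
    (a : Z.E) : ∃ i, Z.s i = none ∧ (i = a ∨ Z.Reach i a) := by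
  induction a using WellFoundedLT.induction with
  | ind a ih =>
    rcases ha : Z.s a with _ | v
    · exact ⟨a, ha, Or.inl rfl⟩
    · obtain ⟨b, hb⟩ := hZ.exists_in v
      have hab : Z.Step b a := ⟨v, hb, ha⟩
      obtain ⟨i, hi, h⟩ := ih b (hZ.lt_of_step _ _ hab)
      refine ⟨i, hi, Or.inr ?_⟩
      rcases h with rfl | h
      · exact .single hab
      · exact .tail h hab

theorem not_reach_of_t_eq_none {Z : EdgeGraph O M} {a b : Z.E} (h : Z.t a = none) :
    ¬ Z.Reach a b := fun hr => by
  obtain ⟨c, ⟨v, hv, -⟩, -⟩ := Relation.TransGen.head'_iff.1 hr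
  simp [h] at hv

theorem not_reach_of_s_eq_none {Z : EdgeGraph O M} {a b : Z.E} (h : Z.s b = none) :
    ¬ Z.Reach a b := fun hr => by
  obtain ⟨c, -, ⟨v, -, hv⟩⟩ := Relation.TransGen.tail'_iff.1 hr
  simp [h] at hv

/-! ### Subgraphs spanned by vertices -/

/-- An embedding of `X` in `Z` whose image contains all edges at the vertices in the image. -/
structure Sub (X Z : EdgeGraph O M) where
  e : X.E → Z.E
  v : X.V → Z.V
  mono : StrictMono e
  inj : Function.Injective v
  s_iff : ∀ x b, Z.s b = some (v x) ↔ ∃ a, X.s a = some x ∧ e a = b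
  t_iff : ∀ x b, Z.t b = some (v x) ↔ ∃ a, X.t a = some x ∧ e a = b
  obj : ∀ a, Z.obj (e a) = X.obj a
  mor : ∀ x, Z.mor (v x) = X.mor x

namespace Sub

variable {X Y Z : EdgeGraph O M}

/-- The identity embedding. -/
def refl (X : EdgeGraph O M) : Sub X X where
  e a := a
  v x := x
  mono _ _ h := h
  inj _ _ h := h
  s_iff x b := by simp
  t_iff x b := by simp
  obj _ := rfl
  mor _ := rfl

/-- The composite of two embeddings. -/
def trans (j : Sub X Y) (k : Sub Y Z) : Sub X Z where
  e a := k.e (j.e a)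
  v x := k.v (j.v x)
  mono := k.mono.comp j.mono
  inj := k.inj.comp j.inj
  s_iff x b := by simp only [k.s_iff, j.s_iff]; grind
  t_iff x b := by simp only [k.t_iff, j.t_iff]; grind
  obj a := by rw [k.obj, j.obj]
  mor x := by rw [k.mor, j.mor]

/-- Only vertices in the image are controlled: an edge without source in `X` may acquire a source in
`Z` that lies outside the image. This is what happens to the inputs of the second factor of a
composite. -/
theorem s_e (j : Sub X Z) (a : X.E) (x : X.V) : Z.s (j.e a) = some (j.v x) ↔ X.s a = some x := by
  rw [j.s_iff]
  exact ⟨fun ⟨a', h, h'⟩ => j.mono.injective h' ▸ h, fun h => ⟨a, h, rfl⟩⟩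

theorem t_e (j : Sub X Z) (a : X.E) (x : X.V) : Z.t (j.e a) = some (j.v x) ↔ X.t a = some x := by
  rw [j.t_iff]
  exact ⟨fun ⟨a', h, h'⟩ => j.mono.injective h' ▸ h, fun h => ⟨a, h, rfl⟩⟩

theorem word_eq (j : Sub X Z) {p : X.E → Prop} {p' : Z.E → Prop}
    (h : ∀ b, p' b ↔ ∃ a, p a ∧ j.e a = b) : X.word p = Z.word p' := by
  rw [word, word, ← map_sortedList j.mono h, List.map_map]
  exact List.map_congr_left fun a _ => (j.obj a).symm

theorem reach (j : Sub X Z) {a b : X.E} (h : X.Reach a b) : Z.Reach (j.e a) (j.e b) :=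
  Relation.TransGen.lift j.e
    (fun _ _ ⟨v, hv, hw⟩ => ⟨j.v v, (j.t_e _ _).2 hv, (j.s_e _ _).2 hw⟩) _ _ h

end Sub

variable {L : Labels.{u}}

/-- An embedding contains all edges at each of its vertices, so the conditions at a vertex are
inherited. The condition on paths is not local; `hj` says that no path of `Z` between edges of `X`
makes a detour outside `X`. -/
theorem IsDiagram.of_sub {X Z : EdgeGraph L.Ob L.Mor} (hZ : Z.IsDiagram L) (j : Sub X Z)
    (hj : ∀ a b, Z.Reach (j.e a) (j.e b) → X.Reach a b) : X.IsDiagram L where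
  exists_in v := by
    obtain ⟨e, he⟩ := hZ.exists_in (j.v v)
    obtain ⟨a, ha, -⟩ := (j.t_iff _ _).1 he
    exact ⟨a, ha⟩
  exists_out v := by
    obtain ⟨e, he⟩ := hZ.exists_out (j.v v)
    obtain ⟨a, ha, -⟩ := (j.s_iff _ _).1 he
    exact ⟨a, ha⟩
  lt_of_step a b h := j.mono.lt_iff_lt.1 (hZ.lt_of_reach (j.reach (.single h)))
  between a b c h hac hcb :=
    (hZ.between _ _ _ (j.reach h) (j.mono hac) (j.mono hcb)).imp (hj _ _) (hj _ _)
  isDom v := by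
    rw [← j.mor, j.word_eq (p' := fun e => Z.t e = some (j.v v)) (j.t_iff v)]
    exact hZ.isDom _
  isCod v := by
    rw [← j.mor, j.word_eq (p' := fun e => Z.s e = some (j.v v)) (j.s_iff v)]
    exact hZ.isCod _

/-- All conditions except `between` concern one vertex and the edges at it, also `lt_of_step`, since
a step passes through one vertex. They can be checked in any planar subgraph containing that vertex.
-/
theorem IsDiagram.of_cover {Z : EdgeGraph L.Ob L.Mor}
    (h : ∀ z : Z.V, ∃ (X : EdgeGraph L.Ob L.Mor) (j : Sub X Z) (x : X.V), X.IsDiagram L ∧ j.v x = z)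
    (hb : ∀ a b c, Z.Reach a b → a < c → c < b → Z.Reach a c ∨ Z.Reach c b) : Z.IsDiagram L where
  exists_in z := by
    obtain ⟨X, j, x, hX, rfl⟩ := h z
    obtain ⟨a, ha⟩ := hX.exists_in x
    exact ⟨_, (j.t_e a x).2 ha⟩
  exists_out z := by
    obtain ⟨X, j, x, hX, rfl⟩ := h z
    obtain ⟨a, ha⟩ := hX.exists_out x
    exact ⟨_, (j.s_e a x).2 ha⟩
  lt_of_step a b hab := by
    obtain ⟨z, ha, hb⟩ := hab
    obtain ⟨X, j, x, hX, rfl⟩ := h z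
    obtain ⟨a', ha', rfl⟩ := (j.t_iff _ _).1 ha
    obtain ⟨b', hb', rfl⟩ := (j.s_iff _ _).1 hb
    exact j.mono (hX.lt_of_step _ _ ⟨x, ha', hb'⟩)
  between := hb
  isDom z := by
    obtain ⟨X, j, x, hX, rfl⟩ := h z
    rw [j.mor, ← j.word_eq (j.t_iff x)]
    exact hX.isDom x
  isCod z := by
    obtain ⟨X, j, x, hX, rfl⟩ := h z
    rw [j.mor, ← j.word_eq (j.s_iff x)]
    exact hX.isCod x

/-- Isomorphism of edge graphs. -/
def Iso (X Z : EdgeGraph O M) : Prop :=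
  ∃ j : Sub X Z, Function.Surjective j.e ∧ Function.Surjective j.v

theorem Iso.refl (X : EdgeGraph O M) : X.Iso X :=
  ⟨Sub.refl X, Function.surjective_id, Function.surjective_id⟩

theorem Iso.trans {X Y Z : EdgeGraph O M} (h : X.Iso Y) (k : Y.Iso Z) : X.Iso Z := by
  obtain ⟨j, h₁, h₂⟩ := h
  obtain ⟨l, h₃, h₄⟩ := k
  exact ⟨j.trans l, h₃.comp h₁, h₄.comp h₂⟩

theorem exists_equiv_of_rel {V V' : Type} {R : V → V' → Prop} (h : ∀ e, ∃ e', R e e')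
    (h' : ∀ e', ∃ e, R e e') (heq : ∀ a a' b b', R a a' → R b b' → (a = b ↔ a' = b')) :
    ∃ θ : V ≃ V', ∀ e e', R e e' ↔ θ e = e' := by
  choose f hf using h
  have hu : ∀ e e', R e e' ↔ f e = e' := fun e e' =>
    ⟨fun he => (heq _ _ _ _ (hf e) he).1 rfl, fun he => he ▸ hf e⟩
  refine ⟨Equiv.ofBijective f ⟨fun a b hab => (heq _ _ _ _ (hf a) (hf b)).2 hab, fun e' => ?_⟩, hu⟩
  exact (h' e').imp fun e he => (hu e e').1 he

/-- In the applications, edges and vertices correspond through a common third object, so the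
correspondence comes as a relation; the functions are extracted here once and for all. -/
theorem Iso.of_rel {X Z : EdgeGraph O M} (R : X.E → Z.E → Prop) (S : X.V → Z.V → Prop)
    (hR : ∀ e, ∃ e', R e e') (hR' : ∀ e', ∃ e, R e e')
    (hle : ∀ a a' b b', R a a' → R b b' → (a ≤ b ↔ a' ≤ b'))
    (hS : ∀ v, ∃ v', S v v') (hS' : ∀ v', ∃ v, S v v')
    (heq : ∀ a a' b b', S a a' → S b b' → (a = b ↔ a' = b'))
    (hs : ∀ e e' v v', R e e' → S v v' → (X.s e = some v ↔ Z.s e' = some v'))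
    (ht : ∀ e e' v v', R e e' → S v v' → (X.t e = some v ↔ Z.t e' = some v'))
    (ho : ∀ e e', R e e' → X.obj e = Z.obj e')
    (hm : ∀ v v', S v v' → X.mor v = Z.mor v') : X.Iso Z := by
  obtain ⟨θ, hθ⟩ := exists_orderIso_of_rel hR hR' hle
  obtain ⟨τ, hτ⟩ := exists_equiv_of_rel hS hS' heq
  refine ⟨⟨θ, τ, θ.strictMono, τ.injective, fun x b => ?_, fun x b => ?_, fun a => ?_, fun x => ?_⟩,
    θ.surjective, τ.surjective⟩
  · obtain ⟨a, rfl⟩ := θ.surjective b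
    rw [← hs a (θ a) x (τ x) ((hθ _ _).2 rfl) ((hτ _ _).2 rfl)]
    simp
  · obtain ⟨a, rfl⟩ := θ.surjective b
    rw [← ht a (θ a) x (τ x) ((hθ _ _).2 rfl) ((hτ _ _).2 rfl)]
    simp
  · exact (ho _ _ ((hθ _ _).2 rfl)).symm
  · exact (hm _ _ ((hτ _ _).2 rfl)).symm

theorem Iso.symm {X Z : EdgeGraph O M} (h : X.Iso Z) : Z.Iso X := by
  obtain ⟨j, h₁, h₂⟩ := h
  refine Iso.of_rel (fun e a => j.e a = e) (fun v x => j.v x = v) h₁ (fun a => ⟨_, rfl⟩) ?_ h₂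
    (fun a => ⟨_, rfl⟩) ?_ ?_ ?_ ?_ ?_
  · rintro _ a _ b rfl rfl; exact j.mono.le_iff_le
  · rintro _ a _ b rfl rfl; exact j.inj.eq_iff
  · rintro _ a _ b rfl rfl; exact j.s_e a b
  · rintro _ a _ b rfl rfl; exact j.t_e a b
  · rintro _ a rfl; exact j.obj a
  · rintro _ a rfl; exact j.mor a

theorem IsDiagram.of_iso {X Z : EdgeGraph L.Ob L.Mor} (hZ : Z.IsDiagram L) (h : X.Iso Z) :
    X.IsDiagram L := by
  obtain ⟨j, h₁, h₂⟩ := h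
  refine hZ.of_sub j fun a b hab => ?_
  have key : ∀ c d, Z.Reach c d → ∀ a b, j.e a = c → j.e b = d → X.Reach a b := by
    intro c d hcd
    have step : ∀ a b, Z.Step (j.e a) (j.e b) → X.Step a b := by
      rintro a b ⟨v, hv, hw⟩
      obtain ⟨x, rfl⟩ := h₂ v
      exact ⟨x, (j.t_e _ _).1 hv, (j.s_e _ _).1 hw⟩
    induction hcd with
    | single h => rintro a b rfl rfl; exact .single (step _ _ h)
    | @tail d' d _ h ih =>
      rintro a b rfl rfl
      obtain ⟨c, rfl⟩ := h₁ d'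
      exact .tail (ih _ _ rfl rfl) (step _ _ h)
  exact key _ _ hab _ _ rfl rfl

theorem Sub.s_e_eq_none {X Z : EdgeGraph O M} (j : Sub X Z) (h : Function.Surjective j.v) (a : X.E) :
    Z.s (j.e a) = none ↔ X.s a = none := by
  simp only [Option.eq_none_iff_forall_not_mem, Option.mem_def, h.forall, j.s_e]

theorem Sub.t_e_eq_none {X Z : EdgeGraph O M} (j : Sub X Z) (h : Function.Surjective j.v) (a : X.E) :
    Z.t (j.e a) = none ↔ X.t a = none := by
  simp only [Option.eq_none_iff_forall_not_mem, Option.mem_def, h.forall, j.t_e]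

/-- The tensor product: the edges of `X` precede the edges of `Y`. -/
def tensor (X Y : EdgeGraph O M) : EdgeGraph O M where
  E := X.E ⊕ₗ Y.E
  V := X.V ⊕ Y.V
  finE := inferInstanceAs (Finite (X.E ⊕ Y.E))
  s c := Sum.elim (fun a => (X.s a).map Sum.inl) (fun b => (Y.s b).map Sum.inr) (ofLex c)
  t c := Sum.elim (fun a => (X.t a).map Sum.inl) (fun b => (Y.t b).map Sum.inr) (ofLex c)
  obj c := Sum.elim X.obj Y.obj (ofLex c)
  mor := Sum.elim X.mor Y.mor

/-! ### Tensor products of edge graphs -/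

section Tensor

variable (X Y : EdgeGraph O M)

/-- An edge of the left tensor factor. -/
def inl (a : X.E) : (X.tensor Y).E := toLex (Sum.inl a)

/-- An edge of the right tensor factor. -/
def inr (b : Y.E) : (X.tensor Y).E := toLex (Sum.inr b)

/-- A vertex of the left tensor factor. -/
def vl (x : X.V) : (X.tensor Y).V := Sum.inl x

/-- A vertex of the right tensor factor. -/
def vr (y : Y.V) : (X.tensor Y).V := Sum.inr y

variable {X Y}

theorem tensor_cases {P : (X.tensor Y).E → Prop} (c : (X.tensor Y).E)
    (hl : ∀ a : X.E, P (inl X Y a)) (hr : ∀ b : Y.E, P (inr X Y b)) : P c := by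
  rcases h : ofLex c with a | b
  · have : c = inl X Y a := h
    exact this ▸ hl a
  · have : c = inr X Y b := h
    exact this ▸ hr b

@[simp] theorem inl_lt_inl {a b : X.E} : inl X Y a < inl X Y b ↔ a < b := Sum.Lex.inl_lt_inl_iff
@[simp] theorem inr_lt_inr {a b : Y.E} : inr X Y a < inr X Y b ↔ a < b := Sum.Lex.inr_lt_inr_iff
@[simp] theorem inl_lt_inr {a : X.E} {b : Y.E} : inl X Y a < inr X Y b := Sum.Lex.inl_lt_inr a b
@[simp] theorem not_inr_lt_inl {a : X.E} {b : Y.E} : ¬ inr X Y b < inl X Y a :=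
  Sum.Lex.not_inr_lt_inl
@[simp] theorem inl_le_inl {a b : X.E} : inl X Y a ≤ inl X Y b ↔ a ≤ b := Sum.Lex.inl_le_inl_iff
@[simp] theorem inr_le_inr {a b : Y.E} : inr X Y a ≤ inr X Y b ↔ a ≤ b := Sum.Lex.inr_le_inr_iff
@[simp] theorem inl_le_inr {a : X.E} {b : Y.E} : inl X Y a ≤ inr X Y b := inl_lt_inr.le
@[simp] theorem not_inr_le_inl {a : X.E} {b : Y.E} : ¬ inr X Y b ≤ inl X Y a :=
  not_le.2 inl_lt_inr
@[simp] theorem inl_inj {a b : X.E} : inl X Y a = inl X Y b ↔ a = b := by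
  simp only [le_antisymm_iff, inl_le_inl]
@[simp] theorem inr_inj {a b : Y.E} : inr X Y a = inr X Y b ↔ a = b := by
  simp only [le_antisymm_iff, inr_le_inr]
@[simp] theorem inl_ne_inr {a : X.E} {b : Y.E} : inl X Y a ≠ inr X Y b := inl_lt_inr.ne
@[simp] theorem inr_ne_inl {a : X.E} {b : Y.E} : inr X Y b ≠ inl X Y a := inl_lt_inr.ne'
theorem vertex_cases {P : (X.tensor Y).V → Prop} (c : (X.tensor Y).V)
    (hl : ∀ a : X.V, P (vl X Y a)) (hr : ∀ b : Y.V, P (vr X Y b)) : P c := by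
  rcases c with a | b
  exacts [hl a, hr b]

@[simp] theorem vl_inj {a b : X.V} : vl X Y a = vl X Y b ↔ a = b := Sum.inl_injective.eq_iff
@[simp] theorem vr_inj {a b : Y.V} : vr X Y a = vr X Y b ↔ a = b := Sum.inr_injective.eq_iff
@[simp] theorem vl_ne_vr {a : X.V} {b : Y.V} : vl X Y a ≠ vr X Y b := Sum.inl_ne_inr
@[simp] theorem vr_ne_vl {a : X.V} {b : Y.V} : vr X Y b ≠ vl X Y a := Sum.inr_ne_inl
@[simp] theorem s_inl (a : X.E) : (X.tensor Y).s (inl X Y a) = (X.s a).map (vl X Y) := rfl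
@[simp] theorem s_inr (b : Y.E) : (X.tensor Y).s (inr X Y b) = (Y.s b).map (vr X Y) := rfl
@[simp] theorem t_inl (a : X.E) : (X.tensor Y).t (inl X Y a) = (X.t a).map (vl X Y) := rfl
@[simp] theorem t_inr (b : Y.E) : (X.tensor Y).t (inr X Y b) = (Y.t b).map (vr X Y) := rfl

variable (X Y)

/-- The left tensor factor. -/
def tensorLeft : Sub X (X.tensor Y) where
  e := inl X Y
  v := vl X Y
  mono a b h := inl_lt_inl.2 h
  inj _ _ := vl_inj.1
  s_iff x b := by induction b using tensor_cases <;> simp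
  t_iff x b := by induction b using tensor_cases <;> simp
  obj _ := rfl
  mor _ := rfl

/-- The right tensor factor. -/
def tensorRight : Sub Y (X.tensor Y) where
  e := inr X Y
  v := vr X Y
  mono a b h := inr_lt_inr.2 h
  inj _ _ := vr_inj.1
  s_iff x b := by induction b using tensor_cases <;> simp
  t_iff x b := by induction b using tensor_cases <;> simp
  obj _ := rfl
  mor _ := rfl

variable {X Y}

theorem step_inl {a : X.E} {c : (X.tensor Y).E} :
    (X.tensor Y).Step (inl X Y a) c ↔ ∃ b, X.Step a b ∧ c = inl X Y b := by
  constructor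
  · rintro ⟨v, h, h'⟩
    rw [t_inl, Option.map_eq_some_iff] at h
    obtain ⟨x, hx, rfl⟩ := h
    obtain ⟨b, hb, rfl⟩ := ((tensorLeft X Y).s_iff x c).1 h'
    exact ⟨b, ⟨x, hx, hb⟩, rfl⟩
  · rintro ⟨b, ⟨x, hx, hb⟩, rfl⟩
    exact ⟨vl X Y x, by simp [hx], by simp [hb]⟩

theorem step_inr {a : Y.E} {c : (X.tensor Y).E} :
    (X.tensor Y).Step (inr X Y a) c ↔ ∃ b, Y.Step a b ∧ c = inr X Y b := by
  constructor
  · rintro ⟨v, h, h'⟩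
    rw [t_inr, Option.map_eq_some_iff] at h
    obtain ⟨x, hx, rfl⟩ := h
    obtain ⟨b, hb, rfl⟩ := ((tensorRight X Y).s_iff x c).1 h'
    exact ⟨b, ⟨x, hx, hb⟩, rfl⟩
  · rintro ⟨b, ⟨x, hx, hb⟩, rfl⟩
    exact ⟨vr X Y x, by simp [hx], by simp [hb]⟩

theorem reach_inl {a : X.E} {c : (X.tensor Y).E} :
    (X.tensor Y).Reach (inl X Y a) c ↔ ∃ b, X.Reach a b ∧ c = inl X Y b := by
  constructor
  · intro h
    induction h with
    | single h =>
      obtain ⟨b, hb, rfl⟩ := step_inl.1 h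
      exact ⟨b, .single hb, rfl⟩
    | tail _ h ih =>
      obtain ⟨b, hb, rfl⟩ := ih
      obtain ⟨b', hb', rfl⟩ := step_inl.1 h
      exact ⟨b', .tail hb hb', rfl⟩
  · rintro ⟨b, h, rfl⟩
    exact (tensorLeft X Y).reach h

theorem reach_inr {a : Y.E} {c : (X.tensor Y).E} :
    (X.tensor Y).Reach (inr X Y a) c ↔ ∃ b, Y.Reach a b ∧ c = inr X Y b := by
  constructor
  · intro h
    induction h with
    | single h =>
      obtain ⟨b, hb, rfl⟩ := step_inr.1 h
      exact ⟨b, .single hb, rfl⟩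
    | tail _ h ih =>
      obtain ⟨b, hb, rfl⟩ := ih
      obtain ⟨b', hb', rfl⟩ := step_inr.1 h
      exact ⟨b', .tail hb hb', rfl⟩
  · rintro ⟨b, h, rfl⟩
    exact (tensorRight X Y).reach h

/-- A path never leaves its tensor factor, and an edge lying between two edges of one factor belongs
to that factor, because the order is lexicographic. -/
theorem IsDiagram.tensor {X Y : EdgeGraph L.Ob L.Mor} (hX : X.IsDiagram L) (hY : Y.IsDiagram L) :
    (X.tensor Y).IsDiagram L := by
  refine .of_cover ?_ ?_
  · rintro (x | y)
    · exact ⟨X, tensorLeft X Y, x, hX, rfl⟩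
    · exact ⟨Y, tensorRight X Y, y, hY, rfl⟩
  · intro a b c hab hac hcb
    induction a using tensor_cases with
    | hl a =>
      obtain ⟨b, hab', rfl⟩ := reach_inl.1 hab
      induction c using tensor_cases with
      | hl c =>
        exact (hX.between a b c hab' (inl_lt_inl.1 hac) (inl_lt_inl.1 hcb)).imp
          (tensorLeft X Y).reach (tensorLeft X Y).reach
      | hr c => exact (not_inr_lt_inl hcb).elim
    | hr a =>
      obtain ⟨b, hab', rfl⟩ := reach_inr.1 hab
      induction c using tensor_cases with
      | hl c => exact (not_inr_lt_inl hac).elim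
      | hr c =>
        exact (hY.between a b c hab' (inr_lt_inr.1 hac) (inr_lt_inr.1 hcb)).imp
          (tensorRight X Y).reach (tensorRight X Y).reach

theorem word_tensor (p : (X.tensor Y).E → Prop) :
    (X.tensor Y).word p = (X.word fun a => p (inl X Y a)) ++ Y.word fun b => p (inr X Y b) := by
  rw [word_append (p₁ := fun c => ∃ a, p (inl X Y a) ∧ inl X Y a = c)
    (p₂ := fun c => ∃ b, p (inr X Y b) ∧ inr X Y b = c),
    (tensorLeft X Y).word_eq (fun b => Iff.rfl), (tensorRight X Y).word_eq (fun b => Iff.rfl)]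
  · rfl
  · intro c
    induction c using tensor_cases <;> simp
  · rintro _ _ ⟨a, -, rfl⟩ ⟨b, -, rfl⟩
    exact inl_lt_inr

theorem inWord_tensor : (X.tensor Y).inWord = X.inWord ++ Y.inWord := by
  rw [inWord, word_tensor]
  simp only [s_inl, s_inr]
  exact congrArg₂ _ (word_congr fun e => Option.map_eq_none_iff)
    (word_congr fun e => Option.map_eq_none_iff)

theorem outWord_tensor : (X.tensor Y).outWord = X.outWord ++ Y.outWord := by
  rw [outWord, word_tensor]
  simp only [t_inl, t_inr]
  exact congrArg₂ _ (word_congr fun e => Option.map_eq_none_iff)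
    (word_congr fun e => Option.map_eq_none_iff)

/-- Two subgraphs, the first of which precedes the second, form a tensor product. -/
def tensorSub {Z : EdgeGraph O M} (l : Sub X Z) (r : Sub Y Z) (hlt : ∀ a b, l.e a < r.e b)
    (hdisj : ∀ x y, l.v x ≠ r.v y) : Sub (X.tensor Y) Z where
  e c := Sum.elim l.e r.e (ofLex c)
  v c := Sum.elim l.v r.v c
  mono c d h := by
    induction c using tensor_cases <;> induction d using tensor_cases
    · exact l.mono (inl_lt_inl.1 h)
    · exact hlt _ _
    · exact (not_inr_lt_inl h).elim
    · exact r.mono (inr_lt_inr.1 h)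
  inj c d h := by
    induction c using vertex_cases <;> induction d using vertex_cases
    · exact congrArg _ (l.inj h)
    · exact (hdisj _ _ h).elim
    · exact (hdisj _ _ h.symm).elim
    · exact congrArg _ (r.inj h)
  s_iff x b := by
    induction x using vertex_cases with
    | hl x =>
      refine (l.s_iff x b).trans ⟨fun ⟨a, h, h'⟩ => ⟨inl X Y a, by simpa using h, h'⟩, ?_⟩
      rintro ⟨c, h, h'⟩
      induction c using tensor_cases with
      | hl a => exact ⟨a, by simpa using h, h'⟩
      | hr b => simp at h
    | hr x =>
      refine (r.s_iff x b).trans ⟨fun ⟨a, h, h'⟩ => ⟨inr X Y a, by simpa using h, h'⟩, ?_⟩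
      rintro ⟨c, h, h'⟩
      induction c using tensor_cases with
      | hl a => simp at h
      | hr b => exact ⟨b, by simpa using h, h'⟩
  t_iff x b := by
    induction x using vertex_cases with
    | hl x =>
      refine (l.t_iff x b).trans ⟨fun ⟨a, h, h'⟩ => ⟨inl X Y a, by simpa using h, h'⟩, ?_⟩
      rintro ⟨c, h, h'⟩
      induction c using tensor_cases with
      | hl a => exact ⟨a, by simpa using h, h'⟩
      | hr b => simp at h
    | hr x =>
      refine (r.t_iff x b).trans ⟨fun ⟨a, h, h'⟩ => ⟨inr X Y a, by simpa using h, h'⟩, ?_⟩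
      rintro ⟨c, h, h'⟩
      induction c using tensor_cases with
      | hl a => simp at h
      | hr b => exact ⟨b, by simpa using h, h'⟩
  obj c := by
    induction c using tensor_cases
    exacts [l.obj _, r.obj _]
  mor c := by
    induction c using vertex_cases
    exacts [l.mor _, r.mor _]

theorem iso_tensor {Z : EdgeGraph O M} (l : Sub X Z) (r : Sub Y Z) (hlt : ∀ a b, l.e a < r.e b)
    (hdisj : ∀ x y, l.v x ≠ r.v y) (hv : ∀ z, (∃ x, l.v x = z) ∨ ∃ y, r.v y = z)
    (he : ∀ e, (∃ a, l.e a = e) ∨ ∃ b, r.e b = e) : (X.tensor Y).Iso Z := by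
  refine ⟨tensorSub l r hlt hdisj, fun e => ?_, fun z => ?_⟩
  · rcases he e with ⟨a, rfl⟩ | ⟨b, rfl⟩
    exacts [⟨inl X Y a, rfl⟩, ⟨inr X Y b, rfl⟩]
  · rcases hv z with ⟨a, rfl⟩ | ⟨b, rfl⟩
    exacts [⟨vl X Y a, rfl⟩, ⟨vr X Y b, rfl⟩]

theorem Iso.tensor {X X' Y Y' : EdgeGraph O M} (h : X.Iso X') (k : Y.Iso Y') :
    (X.tensor Y).Iso (X'.tensor Y') := by
  obtain ⟨i, hi, hi'⟩ := h
  obtain ⟨j, hj, hj'⟩ := k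
  refine iso_tensor (i.trans (tensorLeft X' Y')) (j.trans (tensorRight X' Y')) (fun a b => inl_lt_inr)
    (fun x y => vl_ne_vr) ?_ ?_
  · rintro (x | y)
    · exact Or.inl ((hi' x).imp fun a ha => congrArg (vl X' Y') ha)
    · exact Or.inr ((hj' y).imp fun a ha => congrArg (vr X' Y') ha)
  · intro c
    induction c using tensor_cases with
    | hl a => exact Or.inl ((hi a).imp fun a ha => congrArg _ ha)
    | hr b => exact Or.inr ((hj b).imp fun a ha => congrArg _ ha)

theorem tensor_assoc (X Y W : EdgeGraph O M) :
    ((X.tensor Y).tensor W).Iso (X.tensor (Y.tensor W)) := by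
  refine iso_tensor
    (tensorSub (tensorLeft X (Y.tensor W)) ((tensorLeft Y W).trans (tensorRight X (Y.tensor W)))
      (fun _ _ => inl_lt_inr) (fun _ _ => vl_ne_vr))
    ((tensorRight Y W).trans (tensorRight X (Y.tensor W))) ?_ ?_ ?_ ?_
  · intro a b
    induction a using tensor_cases
    exacts [inl_lt_inr, inr_lt_inr.2 inl_lt_inr]
  · intro a b
    induction a using vertex_cases
    exacts [vl_ne_vr, fun h => vl_ne_vr (vr_inj.1 h)]
  · rintro (x | y | z)
    exacts [Or.inl ⟨vl X Y x, rfl⟩, Or.inl ⟨vr X Y y, rfl⟩, Or.inr ⟨z, rfl⟩]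
  · intro c
    induction c using tensor_cases with
    | hl a => exact Or.inl ⟨inl X Y a, rfl⟩
    | hr b =>
      induction b using tensor_cases with
      | hl a => exact Or.inl ⟨inr X Y a, rfl⟩
      | hr b => exact Or.inr ⟨b, rfl⟩

theorem tensor_iso_left (X : EdgeGraph O M) {Y : EdgeGraph O M} (hE : IsEmpty Y.E)
    (hV : IsEmpty Y.V) : (X.tensor Y).Iso X :=
  Iso.symm ⟨tensorLeft X Y, fun c => by
    induction c using tensor_cases with
    | hl a => exact ⟨a, rfl⟩
    | hr b => exact hE.elim b, fun c => by
    induction c using vertex_cases with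
    | hl a => exact ⟨a, rfl⟩
    | hr b => exact hV.elim b⟩

theorem tensor_iso_right (Y : EdgeGraph O M) {X : EdgeGraph O M} (hE : IsEmpty X.E)
    (hV : IsEmpty X.V) : (X.tensor Y).Iso Y :=
  Iso.symm ⟨tensorRight X Y, fun c => by
    induction c using tensor_cases with
    | hl b => exact hE.elim b
    | hr a => exact ⟨a, rfl⟩, fun c => by
    induction c using vertex_cases with
    | hl b => exact hV.elim b
    | hr a => exact ⟨a, rfl⟩⟩

end Tensor

end EdgeGraph
end TensorCalculus

namespace TensorCalculus
namespace EdgeGraph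

variable {O M : Type u} {L : Labels.{u}}

/-! ### Composites -/

/-- `Z` is the composite of `X`, followed by `Y`. -/
structure Gluing (X Y Z : EdgeGraph O M) where
  l : Sub X Z
  r : Sub Y Z
  disj : ∀ x y, l.v x ≠ r.v y
  cover : ∀ z, (∃ x, l.v x = z) ∨ ∃ y, r.v y = z
  s_none : ∀ e, Z.s e = none ↔ ∃ a, X.s a = none ∧ l.e a = e
  t_none : ∀ e, Z.t e = none ↔ ∃ b, Y.t b = none ∧ r.e b = e
  -- The shuffle condition. Together with the orders of `X` and `Y` and the matching of shared edges
  -- it fixes the whole order of `Z`.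
  cross : ∀ a b, l.e a ≤ r.e b → ∃ o i, l.e o = r.e i ∧ a ≤ o ∧ i ≤ b

namespace Gluing

variable {X Y Z : EdgeGraph O M} (g : Gluing X Y Z)

/-- An edge with a source lies in the part of its source, and an edge without source is an input,
hence lies in the first part. -/
theorem cover_e (e : Z.E) : (∃ a, g.l.e a = e) ∨ ∃ b, g.r.e b = e := by
  rcases h : Z.s e with _ | z
  · obtain ⟨a, -, ha⟩ := (g.s_none e).1 h
    exact Or.inl ⟨a, ha⟩
  · rcases g.cover z with ⟨x, rfl⟩ | ⟨y, rfl⟩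
    · obtain ⟨a, -, ha⟩ := (g.l.s_iff _ _).1 h
      exact Or.inl ⟨a, ha⟩
    · obtain ⟨b, -, hb⟩ := (g.r.s_iff _ _).1 h
      exact Or.inr ⟨b, hb⟩

theorem s_l (a : X.E) : Z.s (g.l.e a) = (X.s a).map g.l.v := by
  rcases h : X.s a with _ | x
  · exact (g.s_none _).2 ⟨a, h, rfl⟩
  · exact (g.l.s_e a x).2 h

theorem t_r (b : Y.E) : Z.t (g.r.e b) = (Y.t b).map g.r.v := by
  rcases h : Y.t b with _ | y
  · exact (g.t_none _).2 ⟨b, h, rfl⟩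
  · exact (g.r.t_e b y).2 h

theorem exists_r {a : X.E} (h : X.t a = none) : ∃ b, g.r.e b = g.l.e a := by
  rcases h' : Z.t (g.l.e a) with _ | z
  · obtain ⟨b, -, hb⟩ := (g.t_none _).1 h'
    exact ⟨b, hb⟩
  · rcases g.cover z with ⟨x, rfl⟩ | ⟨y, rfl⟩
    · simp [(g.l.t_e a x).1 h'] at h
    · obtain ⟨b, -, hb⟩ := (g.r.t_iff _ _).1 h'
      exact ⟨b, hb⟩

theorem exists_l {b : Y.E} (h : Y.s b = none) : ∃ a, g.l.e a = g.r.e b := by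
  rcases h' : Z.s (g.r.e b) with _ | z
  · obtain ⟨a, -, ha⟩ := (g.s_none _).1 h'
    exact ⟨a, ha⟩
  · rcases g.cover z with ⟨x, rfl⟩ | ⟨y, rfl⟩
    · obtain ⟨a, -, ha⟩ := (g.l.s_iff _ _).1 h'
      exact ⟨a, ha⟩
    · simp [(g.r.s_e b y).1 h'] at h

/-- The target in `Z` of an edge of `Y` can only be a vertex of `Y`, and no vertex of `Y` is one of
`X`. With `exists_r`, `exists_l` and `s_eq_none` this shows that the shared edges are exactly the
outputs of `X`, and exactly the inputs of `Y`. -/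
theorem t_eq_none {a : X.E} {b : Y.E} (h : g.l.e a = g.r.e b) : X.t a = none := by
  rcases ha : X.t a with _ | x
  · rfl
  · have h1 := (g.l.t_e a x).2 ha
    rw [h, g.t_r, Option.map_eq_some_iff] at h1
    obtain ⟨y, -, hy⟩ := h1
    exact (g.disj _ _ hy.symm).elim

theorem s_eq_none {a : X.E} {b : Y.E} (h : g.l.e a = g.r.e b) : Y.s b = none := by
  rcases hb : Y.s b with _ | y
  · rfl
  · have h1 := (g.r.s_e b y).2 hb
    rw [← h, g.s_l, Option.map_eq_some_iff] at h1
    obtain ⟨x, -, hx⟩ := h1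
    exact (g.disj _ _ hx).elim

theorem t_l {a : X.E} {b : Y.E} (h : g.l.e a = g.r.e b) :
    Z.t (g.l.e a) = (Y.t b).map g.r.v := by rw [h, g.t_r]

theorem s_r {a : X.E} {b : Y.E} (h : g.l.e a = g.r.e b) :
    Z.s (g.r.e b) = (X.s a).map g.l.v := by rw [← h, g.s_l]

theorem inWord_eq (g : Gluing X Y Z) : Z.inWord = X.inWord := (g.l.word_eq g.s_none).symm

theorem outWord_eq (g : Gluing X Y Z) : Z.outWord = Y.outWord := (g.r.word_eq g.t_none).symm

/-- Both words are the word of `Z` on the shared edges. -/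
theorem outWord_eq_inWord (g : Gluing X Y Z) : X.outWord = Y.inWord := by
  rw [outWord, inWord, g.l.word_eq (p' := fun e => ∃ a b, g.l.e a = e ∧ g.r.e b = e),
    g.r.word_eq (p' := fun e => ∃ a b, g.l.e a = e ∧ g.r.e b = e)]
  · intro e
    constructor
    · rintro ⟨a, b, ha, hb⟩
      exact ⟨b, g.s_eq_none (ha.trans hb.symm), hb⟩
    · rintro ⟨b, hb, rfl⟩
      obtain ⟨a, ha⟩ := g.exists_l hb
      exact ⟨a, b, ha, rfl⟩
  · intro e
    constructor
    · rintro ⟨a, b, ha, hb⟩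
      exact ⟨a, g.t_eq_none (ha.trans hb.symm), ha⟩
    · rintro ⟨a, ha, rfl⟩
      obtain ⟨b, hb⟩ := g.exists_r ha
      exact ⟨a, b, rfl, hb⟩

theorem step_r {b : Y.E} {e : Z.E} (h : Z.Step (g.r.e b) e) : ∃ b', Y.Step b b' ∧ g.r.e b' = e := by
  obtain ⟨z, hz, hz'⟩ := h
  rw [g.t_r, Option.map_eq_some_iff] at hz
  obtain ⟨y, hy, rfl⟩ := hz
  obtain ⟨b', hb, rfl⟩ := (g.r.s_iff _ _).1 hz'
  exact ⟨b', ⟨y, hy, hb⟩, rfl⟩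

theorem step_l {a : X.E} {e : Z.E} (h : Z.Step e (g.l.e a)) : ∃ a', X.Step a' a ∧ g.l.e a' = e := by
  obtain ⟨z, hz, hz'⟩ := h
  rw [g.s_l, Option.map_eq_some_iff] at hz'
  obtain ⟨x, hx, rfl⟩ := hz'
  obtain ⟨a', ha, rfl⟩ := (g.l.t_iff _ _).1 hz
  exact ⟨a', ⟨x, ha, hx⟩, rfl⟩

/-- A path that has entered the second part stays there, since the targets of edges of `Y` are
vertices of `Y`. Dually, a path ending in the first part lies in it (`reach_l`). Hence both factors
satisfy the hypothesis on paths in `IsDiagram.of_sub`. -/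
theorem reach_r {b : Y.E} {e : Z.E} (h : Z.Reach (g.r.e b) e) :
    ∃ b', Y.Reach b b' ∧ g.r.e b' = e := by
  induction h with
  | single h =>
    obtain ⟨b', hb, rfl⟩ := g.step_r h
    exact ⟨b', .single hb, rfl⟩
  | tail _ h ih =>
    obtain ⟨b', hb, rfl⟩ := ih
    obtain ⟨b'', hb', rfl⟩ := g.step_r h
    exact ⟨b'', .tail hb hb', rfl⟩

theorem reach_l {a : X.E} {e : Z.E} (h : Z.Reach e (g.l.e a)) :
    ∃ a', X.Reach a' a ∧ g.l.e a' = e := by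
  induction h using Relation.TransGen.head_induction_on with
  | single h =>
    obtain ⟨b', hb, rfl⟩ := g.step_l h
    exact ⟨b', .single hb, rfl⟩
  | head h _ ih =>
    obtain ⟨b', hb, rfl⟩ := ih
    obtain ⟨b'', hb', rfl⟩ := g.step_l h
    exact ⟨b'', .head hb' hb, rfl⟩

theorem reach_l_l {a a' : X.E} (h : Z.Reach (g.l.e a) (g.l.e a')) : X.Reach a a' := by
  obtain ⟨b, hb, h'⟩ := g.reach_l h
  exact g.l.mono.injective h' ▸ hb

theorem reach_r_r {b b' : Y.E} (h : Z.Reach (g.r.e b) (g.r.e b')) : Y.Reach b b' := by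
  obtain ⟨c, hc, h'⟩ := g.reach_r h
  exact g.r.mono.injective h' ▸ hc

/-- The path changes from `X` to `Y` exactly once, and it does so at a shared edge, because the edge
at which it leaves `X` has no target in `X`. -/
theorem reach_l_r {a : X.E} {b : Y.E} (h : Z.Reach (g.l.e a) (g.r.e b)) :
    ∃ o i, g.l.e o = g.r.e i ∧ (a = o ∨ X.Reach a o) ∧ (i = b ∨ Y.Reach i b) := by
  have key : ∀ e, Z.Reach (g.l.e a) e → (∃ a', X.Reach a a' ∧ g.l.e a' = e) ∨
      ∃ o i b, g.l.e o = g.r.e i ∧ (a = o ∨ X.Reach a o) ∧ Y.Reach i b ∧ g.r.e b = e := by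
    intro e he
    have step : ∀ a' e', Z.Step (g.l.e a') e' → (∃ a'', X.Step a' a'' ∧ g.l.e a'' = e') ∨
        ∃ i b, g.l.e a' = g.r.e i ∧ Y.Step i b ∧ g.r.e b = e' := by
      rintro a' e' hs
      rcases ha : X.t a' with _ | x
      · obtain ⟨b, hb⟩ := g.exists_r ha
        rw [← hb] at hs
        obtain ⟨b', hb', rfl⟩ := g.step_r hs
        exact Or.inr ⟨b, b', hb.symm, hb', rfl⟩
      · obtain ⟨z, hz, hz'⟩ := hs
        rw [(g.l.t_e a' x).2 ha, Option.some.injEq] at hz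
        subst hz
        obtain ⟨a'', h'', rfl⟩ := (g.l.s_iff _ _).1 hz'
        exact Or.inl ⟨a'', ⟨x, ha, h''⟩, rfl⟩
    induction he with
    | single h =>
      rcases step _ _ h with ⟨a'', h'', rfl⟩ | ⟨i, b, h1, h2, rfl⟩
      · exact Or.inl ⟨a'', .single h'', rfl⟩
      · exact Or.inr ⟨a, i, b, h1, Or.inl rfl, .single h2, rfl⟩
    | tail _ h ih =>
      rcases ih with ⟨a', ha', rfl⟩ | ⟨o, i, b, h1, h2, h3, rfl⟩
      · rcases step _ _ h with ⟨a'', h'', rfl⟩ | ⟨i, b, h1, h2, rfl⟩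
        · exact Or.inl ⟨a'', .tail ha' h'', rfl⟩
        · exact Or.inr ⟨a', i, b, h1, Or.inr ha', .single h2, rfl⟩
      · obtain ⟨b', hb', rfl⟩ := g.step_r h
        exact Or.inr ⟨o, i, b', h1, h2, .tail h3 hb', rfl⟩
  rcases key _ h with ⟨a', ha', h'⟩ | ⟨o, i, b', h1, h2, h3, h4⟩
  · exact ⟨a', b, h', Or.inr ha', Or.inl rfl⟩
  · exact ⟨o, i, h1, h2, Or.inr (g.r.mono.injective h4 ▸ h3)⟩

theorem isDiagram_left {X Y Z : EdgeGraph L.Ob L.Mor} (g : Gluing X Y Z) (hZ : Z.IsDiagram L) :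
    X.IsDiagram L := hZ.of_sub g.l fun _ _ => g.reach_l_l

theorem isDiagram_right {X Y Z : EdgeGraph L.Ob L.Mor} (g : Gluing X Y Z) (hZ : Z.IsDiagram L) :
    Y.IsDiagram L := hZ.of_sub g.r fun _ _ => g.reach_r_r

/-- Edges of `Y` that are not inputs follow an input of `Y`. -/
theorem reach_of_reach_of_reach {a o : X.E} {i b : Y.E} (h : g.l.e o = g.r.e i)
    (ha : a = o ∨ X.Reach a o) (hb : i = b ∨ Y.Reach i b) (hne : g.l.e a ≠ g.r.e b) :
    Z.Reach (g.l.e a) (g.r.e b) := by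
  rcases ha with rfl | ha
  · rcases hb with rfl | hb
    · exact (hne h).elim
    · exact h ▸ g.r.reach hb
  · rcases hb with rfl | hb
    · exact h ▸ g.l.reach ha
    · exact (g.l.reach ha).trans (h ▸ g.r.reach hb)

theorem le_or_le {X Y Z : EdgeGraph L.Ob L.Mor} (g : Gluing X Y Z) (o i o' i')
    (h : g.l.e o = g.r.e i) (h' : g.l.e o' = g.r.e i') : o ≤ o' ↔ i ≤ i' := by
  rw [← g.l.mono.le_iff_le, ← g.r.mono.le_iff_le, h, h']

/-- Only the condition on an edge `c` between the ends of a path needs work. A path inside one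
factor with `c` in the same factor is covered by planarity of that factor. If `c` lies in the other
factor, the shuffle condition provides a shared edge, and planarity of both factors applied to
shared edges joins `c` to an end of the path. -/
theorem isDiagram {X Y Z : EdgeGraph L.Ob L.Mor} (g : Gluing X Y Z) (hX : X.IsDiagram L)
    (hY : Y.IsDiagram L) : Z.IsDiagram L := by
  have lX : ∀ {a b}, g.l.e a < g.l.e b ↔ a < b := g.l.mono.lt_iff_lt
  have lY : ∀ {a b}, g.r.e a < g.r.e b ↔ a < b := g.r.mono.lt_iff_lt
  -- Planarity of `X` for an output `c` in the middle: no path starts at `c`, so of the two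
  -- alternatives only a path from `a` to `c` remains. The next claim is the dual one for inputs of
  -- `Y`.
  have bX : ∀ a o c, (a = o ∨ X.Reach a o) → X.t c = none → a ≤ c → c ≤ o →
      (a = c ∨ X.Reach a c) := by
    intro a o c hao hc hac hco
    rcases hac.eq_or_lt with rfl | hac
    · exact Or.inl rfl
    rcases hco.eq_or_lt with rfl | hco
    · exact hao
    rcases hao with rfl | hao
    · exact (lt_asymm hac hco).elim
    · exact Or.inr ((hX.between _ _ _ hao hac hco).resolve_right (not_reach_of_t_eq_none hc))
  have bY : ∀ i b c, (i = b ∨ Y.Reach i b) → Y.s c = none → i ≤ c → c ≤ b →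
      (c = b ∨ Y.Reach c b) := by
    intro a o c hao hc hac hco
    rcases hco.eq_or_lt with rfl | hco
    · exact Or.inl rfl
    rcases hac.eq_or_lt with rfl | hac
    · exact hao
    rcases hao with rfl | hao
    · exact (lt_asymm hac hco).elim
    · exact Or.inr ((hY.between _ _ _ hao hac hco).resolve_left (not_reach_of_s_eq_none hc))
  have le_of : ∀ a o, (a = o ∨ X.Reach a o) → a ≤ o := fun a o h =>
    h.elim (fun h => h.le) fun h => (hX.lt_of_reach h).le
  have le_of' : ∀ a o, (a = o ∨ Y.Reach a o) → a ≤ o := fun a o h =>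
    h.elim (fun h => h.le) fun h => (hY.lt_of_reach h).le
  refine .of_cover ?_ ?_
  · intro z
    rcases g.cover z with ⟨x, hx⟩ | ⟨y, hy⟩
    exacts [⟨X, g.l, x, hX, hx⟩, ⟨Y, g.r, y, hY, hy⟩]
  have hll : ∀ a a' c, X.Reach a a' → g.l.e a < c → c < g.l.e a' →
      Z.Reach (g.l.e a) c ∨ Z.Reach c (g.l.e a') := by
    intro a a' c haa hac hca
    rcases g.cover_e c with ⟨c, rfl⟩ | ⟨b, rfl⟩
    · exact (hX.between _ _ _ haa (lX.1 hac) (lX.1 hca)).imp g.l.reach g.l.reach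
    · by_cases hne : ∃ d, g.l.e d = g.r.e b
      · obtain ⟨d, hd⟩ := hne
        rw [← hd] at hac hca ⊢
        exact (hX.between _ _ _ haa (lX.1 hac) (lX.1 hca)).imp g.l.reach g.l.reach
      left
      obtain ⟨o, i, hoi, hao, hib⟩ := g.cross a b hac.le
      have ho := g.t_eq_none hoi
      have hoa' : o ≤ a' := by
        by_contra hlt
        rw [not_le] at hlt
        have h1 := lX.2 hlt
        have h2 := g.r.mono.monotone hib
        rw [← hoi] at h2
        exact lt_asymm hca (h1.trans_le h2)
      have hao' : a = o ∨ X.Reach a o := bX a a' o (Or.inr haa) ho hao hoa'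
      -- There are now two shared edges: `o = i`, which `a` reaches, and `o' = i'`, which reaches
      -- `b`. If `a ≤ o'`, then `a` also reaches `o'` by `bX`; otherwise `i'` lies below `i`, and
      -- `i` also reaches `b` by `bY`. In both cases a path from `a` to `b` passes through one
      -- shared edge.
      obtain ⟨i', hi', hib'⟩ := hY.exists_input b
      obtain ⟨o', ho'⟩ := g.exists_l hi'
      by_cases hle : a ≤ o'
      · refine g.reach_of_reach_of_reach ho' (bX a a' o' (Or.inr haa) (g.t_eq_none ho') hle ?_) hib'
          hac.ne
        have h2 := g.r.mono.monotone (le_of' _ _ hib')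
        rw [← ho'] at h2
        exact (lX.1 (h2.trans_lt hca)).le
      · rw [not_le] at hle
        refine g.reach_of_reach_of_reach hoi hao' (bY i' b i hib' (g.s_eq_none hoi) ?_ hib) hac.ne
        exact (g.le_or_le _ _ _ _ ho' hoi).1 (hle.le.trans hao)
  -- The mirror image of `hll`, with outputs of `X` reached from `a` in place of inputs of `Y`.
  have hrr : ∀ b b' c, Y.Reach b b' → g.r.e b < c → c < g.r.e b' →
      Z.Reach (g.r.e b) c ∨ Z.Reach c (g.r.e b') := by
    intro b b' c hbb hbc hcb
    rcases g.cover_e c with ⟨a, rfl⟩ | ⟨c, rfl⟩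
    · by_cases hne : ∃ d, g.r.e d = g.l.e a
      · obtain ⟨d, hd⟩ := hne
        rw [← hd] at hbc hcb ⊢
        exact (hY.between _ _ _ hbb (lY.1 hbc) (lY.1 hcb)).imp g.r.reach g.r.reach
      right
      obtain ⟨o, i, hoi, hao, hib⟩ := g.cross a b' hcb.le
      have hi := g.s_eq_none hoi
      have hbi : b ≤ i := by
        by_contra hlt
        rw [not_le] at hlt
        have h1 := lY.2 hlt
        have h2 := g.l.mono.monotone hao
        rw [hoi] at h2
        exact lt_asymm hbc (h2.trans_lt h1)
      have hib'' : i = b' ∨ Y.Reach i b' := bY b b' i (Or.inr hbb) hi hbi hib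
      obtain ⟨o', ho', hao'⟩ := hX.exists_output a
      obtain ⟨i', hi'⟩ := g.exists_r ho'
      by_cases hle : i' ≤ b'
      · refine g.reach_of_reach_of_reach hi'.symm hao'
          (bY b b' i' (Or.inr hbb) (g.s_eq_none hi'.symm) ?_ hle) hcb.ne
        have h2 := g.l.mono.monotone (le_of _ _ hao')
        rw [← hi'] at h2
        exact (lY.1 (hbc.trans_le h2)).le
      · rw [not_le] at hle
        refine g.reach_of_reach_of_reach hoi (bX a o' o hao' (g.t_eq_none hoi) hao ?_) hib'' hcb.ne
        exact (g.le_or_le _ _ _ _ hoi hi'.symm).2 (hib.trans hle.le)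
    · exact (hY.between _ _ _ hbb (lY.1 hbc) (lY.1 hcb)).imp g.r.reach g.r.reach
  intro e₁ e₂ c h h1 h2
  rcases g.cover_e e₁ with ⟨a, rfl⟩ | ⟨b, rfl⟩
  · rcases g.cover_e e₂ with ⟨a', rfl⟩ | ⟨b', rfl⟩
    · exact hll _ _ _ (g.reach_l_l h) h1 h2
    · obtain ⟨o, i, hoi, hao, hib⟩ := g.reach_l_r h
      -- A path from `X` to `Y` is cut at the shared edge where it crosses, and `c` is compared with
      -- that edge.
      rcases lt_trichotomy c (g.l.e o) with hc | rfl | hc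
      · rcases hao with rfl | hao
        · exact (lt_asymm hc h1).elim
        rcases hll _ _ _ hao h1 hc with h' | h'
        · exact Or.inl h'
        · right
          rcases hib with rfl | hib
          · exact hoi ▸ h'
          · exact h'.trans (hoi ▸ g.r.reach hib)
      · rcases hao with rfl | hao
        · exact (lt_irrefl _ h1).elim
        · exact Or.inl (g.l.reach hao)
      · rw [hoi] at hc
        rcases hib with rfl | hib
        · exact (lt_asymm hc h2).elim
        rcases hrr _ _ _ hib hc h2 with h' | h'
        · left
          rcases hao with rfl | hao
          · exact hoi ▸ h'
          · exact (g.l.reach hao).trans (hoi ▸ h')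
        · exact Or.inr h'
  · obtain ⟨b', hb', rfl⟩ := g.reach_r h
    exact hrr _ _ _ hb' h1 h2

/-- The right-hand side depends only on the orders of `X` and `Y` and on which edges are shared, not
on `Z`. The converse of `cross` is monotonicity. -/
theorem le_l_r {a : X.E} {b : Y.E} :
    g.l.e a ≤ g.r.e b ↔ ∃ o i, g.l.e o = g.r.e i ∧ a ≤ o ∧ i ≤ b :=
  ⟨g.cross a b, fun ⟨_, _, h, ha, hb⟩ =>
    (g.l.mono.monotone ha).trans (h ▸ g.r.mono.monotone hb)⟩

/-- The matching of outputs and inputs is the same for all composites. -/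
theorem eq_iff_eq {Z' : EdgeGraph O M} (g' : Gluing X Y Z') (a : X.E) (b : Y.E) :
    g.l.e a = g.r.e b ↔ g'.l.e a = g'.r.e b := by
  have key : ∀ {Z : EdgeGraph O M} (g : Gluing X Y Z), ∃ θ : {a // X.t a = none} ≃o {b // Y.s b = none},
      ∀ a b, g.l.e a = g.r.e b ↔ ∃ h h', θ ⟨a, h⟩ = ⟨b, h'⟩ := by
    intro Z g
    obtain ⟨θ, hθ⟩ := exists_orderIso_of_rel
      (R := fun (a : {a // X.t a = none}) (b : {b // Y.s b = none}) => g.l.e a = g.r.e b)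
      (fun a => by
        obtain ⟨b, hb⟩ := g.exists_r a.2
        exact ⟨⟨b, g.s_eq_none hb.symm⟩, hb.symm⟩)
      (fun b => by
        obtain ⟨a, ha⟩ := g.exists_l b.2
        exact ⟨⟨a, g.t_eq_none ha⟩, ha⟩)
      (fun a a' b b' h h' => by
        rw [← Subtype.coe_le_coe, ← Subtype.coe_le_coe, ← g.l.mono.le_iff_le, h, h',
          g.r.mono.le_iff_le])
    refine ⟨θ, fun a b => ⟨fun h => ⟨g.t_eq_none h, g.s_eq_none h, (hθ _ _).1 h⟩, ?_⟩⟩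
    rintro ⟨h, h', he⟩
    exact (hθ ⟨a, h⟩ ⟨b, h'⟩).2 he
  obtain ⟨θ, hθ⟩ := key g
  obtain ⟨θ', hθ'⟩ := key g'
  -- Both composites induce order isomorphisms from the outputs of `X` to the inputs of `Y`, and a
  -- finite linear order admits at most one.
  rw [hθ, hθ', Subsingleton.elim θ θ']

/-- The edges and vertices of a composite all come from `X` or `Y`. By `eq_iff_eq` the
identifications agree in both composites, and by `le_l_r` so do the comparisons across the two
parts. -/
theorem unique (g : Gluing X Y Z) {Z' : EdgeGraph O M} (g' : Gluing X Y Z') : Z.Iso Z' := by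
  have hlr := fun a b => (g.eq_iff_eq g' a b)
  have hle : ∀ a b, g.l.e a ≤ g.r.e b ↔ g'.l.e a ≤ g'.r.e b := fun a b => by
    simp only [le_l_r, hlr]
  have hle' : ∀ a b, g.r.e b ≤ g.l.e a ↔ g'.r.e b ≤ g'.l.e a := fun a b => by
    have h1 := hle a b
    have h2 := hlr a b
    rcases lt_trichotomy (g.l.e a) (g.r.e b) with h | h | h <;>
    rcases lt_trichotomy (g'.l.e a) (g'.r.e b) with h' | h' | h' <;> grind
  refine Iso.of_rel
    (fun e e' => (∃ a, g.l.e a = e ∧ g'.l.e a = e') ∨ ∃ b, g.r.e b = e ∧ g'.r.e b = e')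
    (fun z z' => (∃ a, g.l.v a = z ∧ g'.l.v a = z') ∨ ∃ b, g.r.v b = z ∧ g'.r.v b = z')
    ?_ ?_ ?_ ?_ ?_ ?_ ?_ ?_ ?_ ?_
  · intro e
    rcases g.cover_e e with ⟨a, rfl⟩ | ⟨b, rfl⟩
    exacts [⟨_, Or.inl ⟨a, rfl, rfl⟩⟩, ⟨_, Or.inr ⟨b, rfl, rfl⟩⟩]
  · intro e
    rcases g'.cover_e e with ⟨a, rfl⟩ | ⟨b, rfl⟩
    exacts [⟨_, Or.inl ⟨a, rfl, rfl⟩⟩, ⟨_, Or.inr ⟨b, rfl, rfl⟩⟩]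
  · rintro _ _ _ _ (⟨a, rfl, rfl⟩ | ⟨b, rfl, rfl⟩) (⟨a', rfl, rfl⟩ | ⟨b', rfl, rfl⟩)
    · rw [g.l.mono.le_iff_le, g'.l.mono.le_iff_le]
    · exact hle _ _
    · exact hle' _ _
    · rw [g.r.mono.le_iff_le, g'.r.mono.le_iff_le]
  · intro z
    rcases g.cover z with ⟨a, rfl⟩ | ⟨b, rfl⟩
    exacts [⟨_, Or.inl ⟨a, rfl, rfl⟩⟩, ⟨_, Or.inr ⟨b, rfl, rfl⟩⟩]
  · intro z
    rcases g'.cover z with ⟨a, rfl⟩ | ⟨b, rfl⟩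
    exacts [⟨_, Or.inl ⟨a, rfl, rfl⟩⟩, ⟨_, Or.inr ⟨b, rfl, rfl⟩⟩]
  · rintro _ _ _ _ (⟨a, rfl, rfl⟩ | ⟨b, rfl, rfl⟩) (⟨a', rfl, rfl⟩ | ⟨b', rfl, rfl⟩)
    · rw [g.l.inj.eq_iff, g'.l.inj.eq_iff]
    · exact iff_of_false (g.disj _ _) (g'.disj _ _)
    · exact iff_of_false (g.disj _ _).symm (g'.disj _ _).symm
    · rw [g.r.inj.eq_iff, g'.r.inj.eq_iff]
  · rintro _ _ _ _ (⟨a, rfl, rfl⟩ | ⟨b, rfl, rfl⟩) (⟨x, rfl, rfl⟩ | ⟨y, rfl, rfl⟩)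
    · rw [g.l.s_e, g'.l.s_e]
    · rw [g.r.s_iff, g'.r.s_iff]
      simp only [eq_comm (b := g.l.e a), eq_comm (b := g'.l.e a), hlr]
    · rw [g.l.s_iff, g'.l.s_iff]
      simp only [hlr]
    · rw [g.r.s_e, g'.r.s_e]
  · rintro _ _ _ _ (⟨a, rfl, rfl⟩ | ⟨b, rfl, rfl⟩) (⟨x, rfl, rfl⟩ | ⟨y, rfl, rfl⟩)
    · rw [g.l.t_e, g'.l.t_e]
    · rw [g.r.t_iff, g'.r.t_iff]
      simp only [eq_comm (b := g.l.e a), eq_comm (b := g'.l.e a), hlr]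
    · rw [g.l.t_iff, g'.l.t_iff]
      simp only [hlr]
    · rw [g.r.t_e, g'.r.t_e]
  · rintro _ _ (⟨a, rfl, rfl⟩ | ⟨b, rfl, rfl⟩)
    · rw [g.l.obj, g'.l.obj]
    · rw [g.r.obj, g'.r.obj]
  · rintro _ _ (⟨a, rfl, rfl⟩ | ⟨b, rfl, rfl⟩)
    · rw [g.l.mor, g'.l.mor]
    · rw [g.r.mor, g'.r.mor]

end Gluing
end EdgeGraph
end TensorCalculus

namespace TensorCalculus
namespace EdgeGraph

variable {O M : Type u} {L : Labels.{u}}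

/-! ### Restrictions -/

open Classical in
/-- Restriction of an optional vertex to a set of vertices. -/
noncomputable def restrictVertex {V : Type} (A : V → Prop) (o : Option V) : Option {v // A v} :=
  o.bind fun v => if h : A v then some ⟨v, h⟩ else none

theorem restrictVertex_eq_some {V : Type} {A : V → Prop} {o : Option V} {v : {v // A v}} :
    restrictVertex A o = some v ↔ o = some v.1 := by
  rcases o with _ | w
  · simp [restrictVertex]
  · simp only [restrictVertex, Option.bind_some, Option.some.injEq]
    split_ifs with h
    · rw [Option.some.injEq, Subtype.ext_iff]
    · simp only [false_iff]
      rintro rfl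
      exact h v.2

theorem restrictVertex_eq_none {V : Type} {A : V → Prop} {o : Option V} :
    restrictVertex A o = none ↔ ∀ v, o = some v → ¬ A v := by
  rw [Option.eq_none_iff_forall_not_mem]
  simp only [Option.mem_def, restrictVertex_eq_some, Subtype.forall]
  exact ⟨fun h v hv hA => h v hA hv, fun h v hA hv => h v hv hA⟩

/-- The graph of the edges in `P` and the vertices in `A`. -/
noncomputable def restrict (Z : EdgeGraph O M) (P : Z.E → Prop) (A : Z.V → Prop) :
    EdgeGraph O M where
  E := {e // P e}
  V := {v // A v}
  s e := restrictVertex A (Z.s e.1)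
  t e := restrictVertex A (Z.t e.1)
  obj e := Z.obj e.1
  mor v := Z.mor v.1

/-- Restriction to a set of vertices and a set of edges that contains all edges at them. -/
noncomputable def restrictSub {Z : EdgeGraph O M} {P : Z.E → Prop} {A : Z.V → Prop}
    (hs : ∀ e v, A v → Z.s e = some v → P e) (ht : ∀ e v, A v → Z.t e = some v → P e) :
    Sub (Z.restrict P A) Z where
  e a := a.1
  v x := x.1
  mono _ _ h := h
  inj := Subtype.val_injective
  s_iff x b := ⟨fun h => ⟨⟨b, hs b _ x.2 h⟩, restrictVertex_eq_some.2 h, rfl⟩, by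
    rintro ⟨a, h, rfl⟩; exact restrictVertex_eq_some.1 h⟩
  t_iff x b := ⟨fun h => ⟨⟨b, ht b _ x.2 h⟩, restrictVertex_eq_some.2 h, rfl⟩, by
    rintro ⟨a, h, rfl⟩; exact restrictVertex_eq_some.1 h⟩
  obj _ := rfl
  mor _ := rfl

/-- A subgraph contained in a restriction. -/
noncomputable def Sub.codRestrict {Y Z : EdgeGraph O M} (j : Sub Y Z) {P : Z.E → Prop}
    {A : Z.V → Prop} (hP : ∀ a, P (j.e a)) (hA : ∀ x, A (j.v x)) : Sub Y (Z.restrict P A) where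
  e a := ⟨j.e a, hP a⟩
  v x := ⟨j.v x, hA x⟩
  mono _ _ h := j.mono h
  inj _ _ h := j.inj (congrArg Subtype.val h)
  s_iff x b := restrictVertex_eq_some.trans ((j.s_iff x b.1).trans
    (exists_congr fun a => and_congr_right fun _ => (Subtype.ext_iff (a1 := ⟨j.e a, hP a⟩) (a2 := b)).symm))
  t_iff x b := restrictVertex_eq_some.trans ((j.t_iff x b.1).trans
    (exists_congr fun a => and_congr_right fun _ => (Subtype.ext_iff (a1 := ⟨j.e a, hP a⟩) (a2 := b)).symm))
  obj a := j.obj a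
  mor x := j.mor x

/-- The edges of the lower part of a cut. -/
def Lower (Z : EdgeGraph O M) (A : Z.V → Prop) (e : Z.E) : Prop := ∀ v, Z.s e = some v → A v

/-- The edges of the upper part of a cut. -/
def Upper (Z : EdgeGraph O M) (A : Z.V → Prop) (e : Z.E) : Prop := ∀ v, Z.t e = some v → ¬ A v

/-- No edge leads from the complement of `A` to `A`. -/
def IsCut (Z : EdgeGraph O M) (A : Z.V → Prop) : Prop :=
  ∀ e v w, Z.s e = some v → Z.t e = some w → A w → A v

/-- The lower part of a cut. -/
noncomputable abbrev bot (Z : EdgeGraph O M) (A : Z.V → Prop) : EdgeGraph O M :=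
  Z.restrict (Z.Lower A) A

/-- The upper part of a cut. -/
noncomputable abbrev top (Z : EdgeGraph O M) (A : Z.V → Prop) : EdgeGraph O M :=
  Z.restrict (Z.Upper A) fun v => ¬ A v

/-- This is the shuffle condition for a cut. Following outgoing edges inside `A` leads from `a` to
an edge `o` on the cut. If `o` lies above `b`, planarity gives a path from `a` to `b`, which meets
the cut, or a path from `b` to `o`. The latter is impossible: an edge reached from an upper edge has
its source outside `A`. -/
theorem IsCut.cross {Z : EdgeGraph L.Ob L.Mor} (hZ : Z.IsDiagram L) {A : Z.V → Prop}
    (hA : Z.IsCut A) {a b : Z.E} (ha : Z.Lower A a) (hb : Z.Upper A b) (hab : a ≤ b) :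
    ∃ c, Z.Lower A c ∧ Z.Upper A c ∧ a ≤ c ∧ c ≤ b := by
  have exists_mid : ∀ a, Z.Lower A a → ∃ o, Z.Lower A o ∧ Z.Upper A o ∧ (a = o ∨ Z.Reach a o) := by
    intro a
    induction a using WellFoundedGT.induction with
    | ind a ih =>
      intro ha
      by_cases hu : Z.Upper A a
      · exact ⟨a, ha, hu, Or.inl rfl⟩
      · simp only [Upper, not_forall, not_not] at hu
        obtain ⟨v, hv, hAv⟩ := hu
        obtain ⟨c, hc⟩ := hZ.exists_out v
        have hac : Z.Step a c := ⟨v, hv, hc⟩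
        obtain ⟨o, ho, ho', h⟩ := ih c (hZ.lt_of_step _ _ hac) (fun w hw => by
          rw [hc, Option.some.injEq] at hw
          exact hw ▸ hAv)
        refine ⟨o, ho, ho', Or.inr ?_⟩
        rcases h with rfl | h
        · exact .single hac
        · exact .head hac h
  have upper_reach : ∀ b c, Z.Upper A b → Z.Reach b c → ∃ v, Z.s c = some v ∧ ¬ A v := by
    intro b c hb h
    induction h with
    | single h =>
      obtain ⟨v, h1, h2⟩ := h
      exact ⟨v, h2, hb v h1⟩
    | tail _ h ih =>
      obtain ⟨v, hv, hv'⟩ := ih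
      obtain ⟨w, h1, h2⟩ := h
      exact ⟨w, h2, fun hw => hv' (hA _ _ _ hv h1 hw)⟩
  have lower_reach : ∀ c, Z.Reach a c → Z.Lower A c ∨
      ∃ i, Z.Lower A i ∧ Z.Upper A i ∧ a ≤ i ∧ i ≤ c := by
    have step : ∀ c d, Z.Lower A c → a ≤ c → Z.Step c d → Z.Lower A d ∨
        ∃ i, Z.Lower A i ∧ Z.Upper A i ∧ a ≤ i ∧ i ≤ d := by
      rintro c d hc hac hcd
      obtain ⟨w, h1, h2⟩ := hcd
      by_cases hw : A w
      · exact Or.inl fun v hv => by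
          rw [h2, Option.some.injEq] at hv
          exact hv ▸ hw
      · refine Or.inr ⟨c, hc, fun v hv => ?_, hac, (hZ.lt_of_step _ _ ⟨w, h1, h2⟩).le⟩
        rw [h1, Option.some.injEq] at hv
        exact hv ▸ hw
    intro c h
    induction h with
    | single h => exact step _ _ ha le_rfl h
    | tail h' h ih =>
      rcases ih with ih | ⟨i, h1, h2, h3, h4⟩
      · exact step _ _ ih (hZ.lt_of_reach h').le h
      · exact Or.inr ⟨i, h1, h2, h3, h4.trans (hZ.lt_of_step _ _ h).le⟩
  obtain ⟨o, ho, ho', hao⟩ := exists_mid a ha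
  rcases hab.eq_or_lt with rfl | hab
  · exact ⟨a, ha, hb, le_rfl, le_rfl⟩
  have hle : a ≤ o := hao.elim (fun h => h.le) fun h => (hZ.lt_of_reach h).le
  rcases le_or_gt o b with hob | hbo
  · exact ⟨o, ho, ho', hle, hob⟩
  rcases hao with rfl | hao
  · exact (lt_asymm hab hbo).elim
  rcases hZ.between _ _ _ hao hab hbo with h | h
  · rcases lower_reach _ h with h | h
    · exact ⟨b, h, hb, hab.le, le_rfl⟩
    · exact h
  · obtain ⟨v, hv, hv'⟩ := upper_reach _ _ hb h
    exact (hv' (ho v hv)).elim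

/-- A diagram is the composite of the two parts of a cut. -/
noncomputable def IsCut.gluing {Z : EdgeGraph L.Ob L.Mor} (hZ : Z.IsDiagram L) {A : Z.V → Prop}
    (hA : Z.IsCut A) : Gluing (Z.bot A) (Z.top A) Z where
  l := restrictSub (fun e v hv h w hw => by rw [h, Option.some.injEq] at hw; exact hw ▸ hv)
    (fun e v hv h w hw => hA _ _ _ hw h hv)
  r := restrictSub (fun e v hv h w hw hAw => hv (hA _ _ _ h hw hAw))
    (fun e v hv h w hw => by rw [h, Option.some.injEq] at hw; exact hw ▸ hv)
  disj x y h := y.2 ((show x.1 = y.1 from h) ▸ x.2)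
  cover z := by
    by_cases hz : A z
    exacts [Or.inl ⟨⟨z, hz⟩, rfl⟩, Or.inr ⟨⟨z, hz⟩, rfl⟩]
  s_none e := by
    constructor
    · intro h
      exact ⟨⟨e, fun v hv => by simp [h] at hv⟩,
        restrictVertex_eq_none.2 fun v hv => by simp [h] at hv, rfl⟩
    · rintro ⟨a, ha, rfl⟩
      have := restrictVertex_eq_none.1 ha
      refine Option.eq_none_iff_forall_not_mem.2 fun v hv => this v hv (a.2 v hv)
  t_none e := by
    constructor
    · intro h
      exact ⟨⟨e, fun v hv => by simp [h] at hv⟩,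
        restrictVertex_eq_none.2 fun v hv => by simp [h] at hv, rfl⟩
    · rintro ⟨a, ha, rfl⟩
      have := restrictVertex_eq_none.1 ha
      refine Option.eq_none_iff_forall_not_mem.2 fun v hv => this v hv (a.2 v hv)
  cross a b hab := by
    obtain ⟨c, h1, h2, h3, h4⟩ := hA.cross hZ a.2 b.2 hab
    exact ⟨⟨c, h1⟩, ⟨c, h2⟩, rfl, h3, h4⟩

/-! ### Composites under isomorphisms, identities and tensor products -/

namespace Gluing

variable {X Y Z : EdgeGraph O M}

/-- Transport of a composite along isomorphisms. -/
def transport {X' Y' Z' : EdgeGraph O M} (g : Gluing X Y Z) (i : Sub X' X)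
    (hi : Function.Surjective i.e) (hi' : Function.Surjective i.v) (j : Sub Y' Y)
    (hj : Function.Surjective j.e) (hj' : Function.Surjective j.v) (k : Sub Z Z')
    (hk : Function.Surjective k.e) (hk' : Function.Surjective k.v) : Gluing X' Y' Z' where
  l := (i.trans g.l).trans k
  r := (j.trans g.r).trans k
  disj x y h := g.disj _ _ (k.inj h)
  cover z := by
    obtain ⟨z, rfl⟩ := hk' z
    rcases g.cover z with ⟨x, rfl⟩ | ⟨y, rfl⟩
    · obtain ⟨x, rfl⟩ := hi' x
      exact Or.inl ⟨x, rfl⟩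
    · obtain ⟨y, rfl⟩ := hj' y
      exact Or.inr ⟨y, rfl⟩
  s_none e := by
    obtain ⟨e, rfl⟩ := hk e
    rw [k.s_e_eq_none hk', g.s_none, hi.exists]
    exact exists_congr fun a => and_congr (i.s_e_eq_none hi' a) k.mono.injective.eq_iff.symm
  t_none e := by
    obtain ⟨e, rfl⟩ := hk e
    rw [k.t_e_eq_none hk', g.t_none, hj.exists]
    exact exists_congr fun a => and_congr (j.t_e_eq_none hj' a) k.mono.injective.eq_iff.symm
  cross a b h := by
    obtain ⟨o, i', h1, h2, h3⟩ := g.cross _ _ (k.mono.le_iff_le.1 h)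
    obtain ⟨o, rfl⟩ := hi o
    obtain ⟨i', rfl⟩ := hj i'
    exact ⟨o, i', congrArg k.e h1, i.mono.le_iff_le.1 h2, j.mono.le_iff_le.1 h3⟩

theorem of_iso {X' Y' Z' : EdgeGraph O M} (g : Gluing X Y Z) (h : X'.Iso X) (h' : Y'.Iso Y)
    (h'' : Z.Iso Z') : Nonempty (Gluing X' Y' Z') := by
  obtain ⟨i, h1, h2⟩ := h
  obtain ⟨j, h3, h4⟩ := h'
  obtain ⟨k, h5, h6⟩ := h''
  exact ⟨g.transport i h1 h2 j h3 h4 k h5 h6⟩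

/-- The lower vertices determine the factorization: the edges of the lower part are the inputs of
`Z` and the edges starting at a lower vertex, those of the upper part are the outputs of `Z` and the
edges ending at an upper vertex. -/
theorem iso_of_vertices_eq {X' Y' : EdgeGraph O M} (g : Gluing X Y Z) (g' : Gluing X' Y' Z)
    (h : ∀ z, (∃ x, g.l.v x = z) ↔ ∃ x, g'.l.v x = z) : X.Iso X' ∧ Y.Iso Y' := by
  have hr : ∀ z, (∃ x, g.r.v x = z) ↔ ∃ x, g'.r.v x = z := by
    intro z
    have h1 : (∃ x, g.r.v x = z) ↔ ¬ ∃ x, g.l.v x = z :=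
      ⟨fun ⟨y, hy⟩ ⟨x, hx⟩ => g.disj x y (hx.trans hy.symm), fun hn => (g.cover z).resolve_left hn⟩
    have h2 : (∃ x, g'.r.v x = z) ↔ ¬ ∃ x, g'.l.v x = z :=
      ⟨fun ⟨y, hy⟩ ⟨x, hx⟩ => g'.disj x y (hx.trans hy.symm),
        fun hn => (g'.cover z).resolve_left hn⟩
    rw [h1, h2, h]
  have hl : ∀ {X Y X' Y' : EdgeGraph O M} (g : Gluing X Y Z) (g' : Gluing X' Y' Z),
      (∀ z, (∃ x, g.l.v x = z) → ∃ x, g'.l.v x = z) → ∀ a, ∃ a', g.l.e a = g'.l.e a' := by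
    intro X Y X' Y' g g' h a
    rcases ha : X.s a with _ | x
    · obtain ⟨a', -, h'⟩ := (g'.s_none _).1 ((g.s_none _).2 ⟨a, ha, rfl⟩)
      exact ⟨a', h'.symm⟩
    · obtain ⟨x', hx'⟩ := h _ ⟨x, rfl⟩
      have := (g.l.s_e a x).2 ha
      rw [← hx', g'.l.s_iff] at this
      obtain ⟨a', -, h'⟩ := this
      exact ⟨a', h'.symm⟩
  have hR : ∀ {X Y X' Y' : EdgeGraph O M} (g : Gluing X Y Z) (g' : Gluing X' Y' Z),
      (∀ z, (∃ x, g.r.v x = z) → ∃ x, g'.r.v x = z) → ∀ a, ∃ a', g.r.e a = g'.r.e a' := by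
    intro X Y X' Y' g g' h a
    rcases ha : Y.t a with _ | x
    · obtain ⟨a', -, h'⟩ := (g'.t_none _).1 ((g.t_none _).2 ⟨a, ha, rfl⟩)
      exact ⟨a', h'.symm⟩
    · obtain ⟨x', hx'⟩ := h _ ⟨x, rfl⟩
      have := (g.r.t_e a x).2 ha
      rw [← hx', g'.r.t_iff] at this
      obtain ⟨a', -, h'⟩ := this
      exact ⟨a', h'.symm⟩
  have key : ∀ {X X' : EdgeGraph O M} (j : Sub X Z) (j' : Sub X' Z),
      (∀ a, ∃ a', j.e a = j'.e a') → (∀ a', ∃ a, j.e a = j'.e a') →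
      (∀ z, (∃ x, j.v x = z) ↔ ∃ x, j'.v x = z) → X.Iso X' := by
    intro X X' j j' h1 h2 h3
    refine Iso.of_rel (fun a a' => j.e a = j'.e a') (fun x x' => j.v x = j'.v x') h1 h2 ?_ ?_ ?_
      ?_ ?_ ?_ ?_ ?_
    · intro a a' b b' h h'
      rw [← j.mono.le_iff_le, h, h', j'.mono.le_iff_le]
    · intro x
      obtain ⟨x', hx'⟩ := (h3 _).1 ⟨x, rfl⟩
      exact ⟨x', hx'.symm⟩
    · exact fun x => (h3 _).2 ⟨x, rfl⟩
    · intro a a' b b' h h'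
      rw [← j.inj.eq_iff, h, h', j'.inj.eq_iff]
    · intro e e' v v' h h'
      rw [← j.s_e, h, h', j'.s_e]
    · intro e e' v v' h h'
      rw [← j.t_e, h, h', j'.t_e]
    · intro e e' h
      rw [← j.obj, h, j'.obj]
    · intro e e' h
      rw [← j.mor, h, j'.mor]
  exact ⟨key g.l g'.l (hl g g' fun z => (h z).1)
      (fun a' => (hl g' g (fun z => (h z).2) a').imp fun _ h => h.symm) h,
    key g.r g'.r (hR g g' fun z => (hr z).1)
      (fun a' => (hR g' g (fun z => (hr z).2) a').imp fun _ h => h.symm) hr⟩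

/-- All edges of `I` are outputs and are identified with the inputs of `X`, so that `X` itself
serves as the composite. The shuffle condition is witnessed by the edge of `I` itself, which is
shared. -/
theorem exists_of_isEmpty_left {I X : EdgeGraph O M} (hI : IsEmpty I.V)
    (h : I.outWord = X.inWord) : Nonempty (Gluing I X X) := by
  obtain ⟨θ, hθ⟩ := exists_orderIso_of_map_sortedList_eq h
  have ht : ∀ a, I.t a = none := fun a => Option.eq_none_iff_forall_not_mem.2 fun v => hI.elim v
  have hs : ∀ a, I.s a = none := fun a => Option.eq_none_iff_forall_not_mem.2 fun v => hI.elim v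
  exact ⟨{
    l := ⟨fun a => (θ ⟨a, ht a⟩).1, fun x => hI.elim x, fun a b hab => θ.strictMono hab,
      fun x => hI.elim x, fun x => hI.elim x, fun x => hI.elim x, fun a => hθ ⟨a, ht a⟩,
      fun x => hI.elim x⟩
    r := Sub.refl X
    disj := fun x => hI.elim x
    cover := fun z => Or.inr ⟨z, rfl⟩
    s_none := fun e => by
      constructor
      · intro he
        obtain ⟨a, ha⟩ := θ.surjective ⟨e, he⟩
        exact ⟨a.1, hs _, congrArg Subtype.val ha⟩
      · rintro ⟨a, -, rfl⟩
        exact (θ ⟨a, ht a⟩).2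
    t_none := fun e => ⟨fun h => ⟨e, h, rfl⟩, by rintro ⟨_, h, rfl⟩; exact h⟩
    cross := fun a b h => ⟨a, _, rfl, le_rfl, h⟩ }⟩

theorem exists_of_isEmpty_right {I X : EdgeGraph O M} (hI : IsEmpty I.V)
    (h : X.outWord = I.inWord) : Nonempty (Gluing X I X) := by
  obtain ⟨θ, hθ⟩ := exists_orderIso_of_map_sortedList_eq h.symm
  have ht : ∀ a, I.t a = none := fun a => Option.eq_none_iff_forall_not_mem.2 fun v => hI.elim v
  have hs : ∀ a, I.s a = none := fun a => Option.eq_none_iff_forall_not_mem.2 fun v => hI.elim v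
  exact ⟨{
    r := ⟨fun a => (θ ⟨a, hs a⟩).1, fun x => hI.elim x, fun a b hab => θ.strictMono hab,
      fun x => hI.elim x, fun x => hI.elim x, fun x => hI.elim x, fun a => hθ ⟨a, hs a⟩,
      fun x => hI.elim x⟩
    l := Sub.refl X
    disj := fun _ x => hI.elim x
    cover := fun z => Or.inl ⟨z, rfl⟩
    t_none := fun e => by
      constructor
      · intro he
        obtain ⟨a, ha⟩ := θ.surjective ⟨e, he⟩
        exact ⟨a.1, ht _, congrArg Subtype.val ha⟩
      · rintro ⟨a, -, rfl⟩
        exact (θ ⟨a, hs a⟩).2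
    s_none := fun e => ⟨fun h => ⟨e, h, rfl⟩, by rintro ⟨_, h, rfl⟩; exact h⟩
    cross := fun a b h => ⟨_, b, rfl, h, le_rfl⟩ }⟩

/-- The tensor product of two composites. -/
def tensor {X' Y' Z' : EdgeGraph O M} (g : Gluing X Y Z) (g' : Gluing X' Y' Z')
    (hX : ∀ a : X.E, ∃ o, X.t o = none ∧ a ≤ o) :
    Gluing (X.tensor X') (Y.tensor Y') (Z.tensor Z') where
  l := tensorSub (g.l.trans (tensorLeft Z Z')) (g'.l.trans (tensorRight Z Z'))
    (fun _ _ => inl_lt_inr) (fun _ _ => vl_ne_vr)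
  r := tensorSub (g.r.trans (tensorLeft Z Z')) (g'.r.trans (tensorRight Z Z'))
    (fun _ _ => inl_lt_inr) (fun _ _ => vl_ne_vr)
  disj x y := by
    induction x using vertex_cases <;> induction y using vertex_cases
    · exact fun h => g.disj _ _ (vl_inj.1 h)
    · exact vl_ne_vr
    · exact vr_ne_vl
    · exact fun h => g'.disj _ _ (vr_inj.1 h)
  cover z := by
    induction z using vertex_cases with
    | hl z =>
      exact (g.cover z).imp (fun ⟨x, hx⟩ => ⟨vl X X' x, congrArg (vl Z Z') hx⟩)
        (fun ⟨x, hx⟩ => ⟨vl Y Y' x, congrArg (vl Z Z') hx⟩)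
    | hr z =>
      exact (g'.cover z).imp (fun ⟨x, hx⟩ => ⟨vr X X' x, congrArg (vr Z Z') hx⟩)
        (fun ⟨x, hx⟩ => ⟨vr Y Y' x, congrArg (vr Z Z') hx⟩)
  s_none e := by
    constructor
    · intro h
      induction e using tensor_cases with
      | hl e =>
        rw [s_inl, Option.map_eq_none_iff, g.s_none] at h
        obtain ⟨a, ha, rfl⟩ := h
        exact ⟨inl X X' a, by simp [ha], rfl⟩
      | hr e =>
        rw [s_inr, Option.map_eq_none_iff, g'.s_none] at h
        obtain ⟨a, ha, rfl⟩ := h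
        exact ⟨inr X X' a, by simp [ha], rfl⟩
    · rintro ⟨a, ha, rfl⟩
      induction a using tensor_cases with
      | hl a =>
        rw [s_inl, Option.map_eq_none_iff] at ha
        exact Option.map_eq_none_iff.2 ((g.s_none _).2 ⟨a, ha, rfl⟩)
      | hr a =>
        rw [s_inr, Option.map_eq_none_iff] at ha
        exact Option.map_eq_none_iff.2 ((g'.s_none _).2 ⟨a, ha, rfl⟩)
  t_none e := by
    constructor
    · intro h
      induction e using tensor_cases with
      | hl e =>
        rw [t_inl, Option.map_eq_none_iff, g.t_none] at h
        obtain ⟨a, ha, rfl⟩ := h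
        exact ⟨inl Y Y' a, by simp [ha], rfl⟩
      | hr e =>
        rw [t_inr, Option.map_eq_none_iff, g'.t_none] at h
        obtain ⟨a, ha, rfl⟩ := h
        exact ⟨inr Y Y' a, by simp [ha], rfl⟩
    · rintro ⟨a, ha, rfl⟩
      induction a using tensor_cases with
      | hl a =>
        rw [t_inl, Option.map_eq_none_iff] at ha
        exact Option.map_eq_none_iff.2 ((g.t_none _).2 ⟨a, ha, rfl⟩)
      | hr a =>
        rw [t_inr, Option.map_eq_none_iff] at ha
        exact Option.map_eq_none_iff.2 ((g'.t_none _).2 ⟨a, ha, rfl⟩)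
  cross a b h := by
    induction a using tensor_cases <;> induction b using tensor_cases
    · obtain ⟨o, i, h1, h2, h3⟩ := g.cross _ _ (inl_le_inl.1 h)
      exact ⟨inl X X' o, inl Y Y' i, congrArg (inl Z Z') h1, inl_le_inl.2 h2, inl_le_inl.2 h3⟩
    -- Here `a` lies below `b` only because of the order of the tensor factors. A shared edge
    -- between them must be found in the left factor, above `a`; this is the purpose of `hX`.
    · rename_i a b
      obtain ⟨o, ho, hao⟩ := hX a
      obtain ⟨i, hi⟩ := g.exists_r ho
      exact ⟨inl X X' o, inl Y Y' i, congrArg (inl Z Z') hi.symm, inl_le_inl.2 hao, inl_le_inr⟩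
    · exact (not_inr_le_inl h).elim
    · obtain ⟨o, i, h1, h2, h3⟩ := g'.cross _ _ (inr_le_inr.1 h)
      exact ⟨inr X X' o, inr Y Y' i, congrArg (inr Z Z') h1, inr_le_inr.2 h2, inr_le_inr.2 h3⟩

end Gluing
end EdgeGraph
end TensorCalculus

namespace TensorCalculus
namespace EdgeGraph

variable {O M : Type u} {L : Labels.{u}}

namespace Gluing

/-! ### Associativity -/

section Assoc

variable {X Y P T W : EdgeGraph O M} (g : Gluing X Y P) (g' : Gluing P T W)

/-- In a composite of three graphs, the part of the last two. -/
noncomputable def upper : EdgeGraph O M :=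
  W.restrict (fun e => (∃ y, g'.l.e (g.r.e y) = e) ∨ ∃ t, g'.r.e t = e)
    fun z => (∃ y, g'.l.v (g.r.v y) = z) ∨ ∃ t, g'.r.v t = z

theorem not_upper (x : X.V) : ¬ ((∃ y, g'.l.v (g.r.v y) = g'.l.v (g.l.v x)) ∨
    ∃ t, g'.r.v t = g'.l.v (g.l.v x)) := by
  rintro (⟨y, hy⟩ | ⟨t, ht⟩)
  · exact g.disj _ _ (g'.l.inj hy).symm
  · exact g'.disj _ _ ht.symm

/-- The first of three graphs followed by the composite of the last two. -/
noncomputable def assocLower : Gluing X (upper g g') W where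
  l := g.l.trans g'.l
  r := restrictSub
    (by
      rintro e _ (⟨y, rfl⟩ | ⟨t, rfl⟩) h
      · obtain ⟨p, hp, rfl⟩ := (g'.l.s_iff _ _).1 h
        obtain ⟨b, hb, rfl⟩ := (g.r.s_iff _ _).1 hp
        exact Or.inl ⟨b, rfl⟩
      · obtain ⟨p, hp, rfl⟩ := (g'.r.s_iff _ _).1 h
        exact Or.inr ⟨p, rfl⟩)
    (by
      rintro e _ (⟨y, rfl⟩ | ⟨t, rfl⟩) h
      · obtain ⟨p, hp, rfl⟩ := (g'.l.t_iff _ _).1 h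
        obtain ⟨b, hb, rfl⟩ := (g.r.t_iff _ _).1 hp
        exact Or.inl ⟨b, rfl⟩
      · obtain ⟨p, hp, rfl⟩ := (g'.r.t_iff _ _).1 h
        exact Or.inr ⟨p, rfl⟩)
  disj x y h := not_upper g g' x ((show g'.l.v (g.l.v x) = y.1 from h) ▸ y.2)
  cover z := by
    rcases g'.cover z with ⟨p, rfl⟩ | ⟨t, rfl⟩
    · rcases g.cover p with ⟨x, rfl⟩ | ⟨y, rfl⟩
      · exact Or.inl ⟨x, rfl⟩
      · exact Or.inr ⟨⟨_, Or.inl ⟨y, rfl⟩⟩, rfl⟩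
    · exact Or.inr ⟨⟨_, Or.inr ⟨t, rfl⟩⟩, rfl⟩
  s_none e := by
    rw [g'.s_none]
    constructor
    · rintro ⟨p, hp, rfl⟩
      obtain ⟨a, ha, rfl⟩ := (g.s_none _).1 hp
      exact ⟨a, ha, rfl⟩
    · rintro ⟨a, ha, rfl⟩
      exact ⟨_, (g.s_none _).2 ⟨a, ha, rfl⟩, rfl⟩
  t_none e := by
    constructor
    · intro h
      obtain ⟨t, ht, rfl⟩ := (g'.t_none _).1 h
      exact ⟨⟨_, Or.inr ⟨t, rfl⟩⟩, restrictVertex_eq_none.2 fun v hv => by simp [h] at hv, rfl⟩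
    · rintro ⟨⟨b, hb⟩, h, rfl⟩
      change W.t b = none
      have h' := restrictVertex_eq_none.1 h
      refine Option.eq_none_iff_forall_not_mem.2 fun z hz => ?_
      have hz' := h' z hz
      rw [Option.mem_def] at hz
      rcases g'.cover z with ⟨p, rfl⟩ | ⟨t, rfl⟩
      · rcases g.cover p with ⟨x, rfl⟩ | ⟨y, rfl⟩
        · obtain ⟨p, hp, rfl⟩ := (g'.l.t_iff _ _).1 hz
          obtain ⟨a, ha, rfl⟩ := (g.l.t_iff _ _).1 hp
          rcases hb with ⟨y, hy⟩ | ⟨t, ht⟩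
          · simp [g.t_eq_none (g'.l.mono.injective hy).symm] at ha
          · simp [g'.t_eq_none ht.symm] at hp
        · exact hz' (Or.inl ⟨y, rfl⟩)
      · exact hz' (Or.inr ⟨t, rfl⟩)
  cross := by
    rintro a ⟨_, ⟨y, rfl⟩ | ⟨t, rfl⟩⟩ h
    · obtain ⟨o, i, h1, h2, h3⟩ := g.cross a y (g'.l.mono.le_iff_le.1 h)
      exact ⟨o, ⟨_, Or.inl ⟨i, rfl⟩⟩, congrArg g'.l.e h1, h2, g'.l.mono.monotone (g.r.mono.monotone h3)⟩
    · obtain ⟨p, i, h1, h2, h3⟩ := g'.cross _ _ h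
      -- The edge shared by `P` and `T` is an output of `P`, hence an output of `Y`, so the shuffle
      -- condition of `g` applies to it in turn.
      obtain ⟨y, -, rfl⟩ := (g.t_none _).1 (g'.t_eq_none h1)
      obtain ⟨o, i', h4, h5, h6⟩ := g.cross _ _ h2
      exact ⟨o, ⟨_, Or.inl ⟨i', rfl⟩⟩, congrArg g'.l.e h4, h5,
        (g'.l.mono.monotone (g.r.mono.monotone h6)).trans (h1.trans_le (g'.r.mono.monotone h3))⟩

/-- The composite of the last two of three graphs. -/
noncomputable def assocUpper : Gluing Y T (upper g g') where
  l := (g.r.trans g'.l).codRestrict (fun a => Or.inl ⟨a, rfl⟩) fun a => Or.inl ⟨a, rfl⟩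
  r := g'.r.codRestrict (fun a => Or.inr ⟨a, rfl⟩) fun a => Or.inr ⟨a, rfl⟩
  disj x y h := g'.disj _ _ (congrArg Subtype.val h)
  cover := by
    rintro ⟨_, ⟨y, rfl⟩ | ⟨t, rfl⟩⟩
    exacts [Or.inl ⟨y, rfl⟩, Or.inr ⟨t, rfl⟩]
  s_none := by
    rintro ⟨e, he⟩
    constructor
    · intro h
      have h' := restrictVertex_eq_none.1 h
      have hy : ∀ y, g'.l.e (g.r.e y) = e → Y.s y = none := by
        rintro y rfl
        refine Option.eq_none_iff_forall_not_mem.2 fun v hv => ?_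
        exact h' _ (((g.r.trans g'.l).s_e y v).2 hv) (Or.inl ⟨v, rfl⟩)
      rcases he with ⟨y, rfl⟩ | ⟨t, rfl⟩
      · exact ⟨y, hy _ rfl, rfl⟩
      · have ht : T.s t = none := Option.eq_none_iff_forall_not_mem.2 fun v hv =>
          h' _ ((g'.r.s_e t v).2 hv) (Or.inr ⟨v, rfl⟩)
        obtain ⟨p, hp⟩ := g'.exists_l ht
        obtain ⟨y, -, rfl⟩ := (g.t_none _).1 (g'.t_eq_none hp)
        exact ⟨y, hy _ hp, Subtype.ext hp⟩
    · rintro ⟨y, hy, h⟩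
      obtain rfl : g'.l.e (g.r.e y) = e := congrArg Subtype.val h
      refine restrictVertex_eq_none.2 fun v hv hA => ?_
      rcases hA with ⟨y', rfl⟩ | ⟨t, rfl⟩
      · simp [((g.r.trans g'.l).s_e y y').1 hv] at hy
      · change W.s (g'.l.e (g.r.e y)) = _ at hv
        rw [g'.s_l, Option.map_eq_some_iff] at hv
        obtain ⟨p, -, hp⟩ := hv
        exact g'.disj _ _ hp
  t_none := by
    rintro ⟨e, he⟩
    constructor
    · intro h
      have h' : W.t e = none := ((assocLower g g').t_none e).2 ⟨⟨e, he⟩, h, rfl⟩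
      obtain ⟨t, ht, rfl⟩ := (g'.t_none _).1 h'
      exact ⟨t, ht, rfl⟩
    · rintro ⟨t, ht, h⟩
      obtain rfl : g'.r.e t = e := congrArg Subtype.val h
      have h' : W.t (g'.r.e t) = none := (g'.t_none _).2 ⟨t, ht, rfl⟩
      exact restrictVertex_eq_none.2 fun v hv => by simp [h'] at hv
  cross a b h := by
    obtain ⟨p, i, h1, h2, h3⟩ := g'.cross _ _ h
    obtain ⟨y, -, rfl⟩ := (g.t_none _).1 (g'.t_eq_none h1)
    exact ⟨y, i, Subtype.ext h1, g.r.mono.le_iff_le.1 h2, h3⟩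

/-- The composite `W` of `P` and `T` is also a composite of `X` with its subgraph `upper g g'`, and
that subgraph is a composite of `Y` and `T`. Uniqueness, used once for the subgraph and once for
`W`, gives the claim. -/
theorem assoc (g : Gluing X Y P) (g' : Gluing P T W) {Q W' : EdgeGraph O M} (k : Gluing Y T Q) (k' : Gluing X Q W') : W.Iso W' := by
  obtain ⟨k''⟩ := k'.of_iso (Iso.refl X) ((assocUpper g g').unique k) (Iso.refl W')
  exact (assocLower g g').unique k''

end Assoc

/-! ### Existence of composites -/

section Existence

variable {X Y : EdgeGraph O M} (θ : {a // X.t a = none} ≃o {b // Y.s b = none})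

/-- The edges of `X` and those of `Y`. -/
@[nolint unusedArguments]
def Edges (_ : {a // X.t a = none} ≃o {b // Y.s b = none}) : Type := X.E ⊕ Y.E

/-- `a` is at most an output of `X` for which the corresponding input of `Y` is at most `b`. -/
def Precedes (a : X.E) (b : Y.E) : Prop := ∃ o, a ≤ o.1 ∧ (θ o).1 ≤ b

/-- The shuffle of the edges of `X` and `Y`. -/
def edgesLE : Edges θ → Edges θ → Prop
  | .inl a, .inl a' => a ≤ a'
  | .inr b, .inr b' => b ≤ b'
  | .inl a, .inr b => Precedes θ a b
  | .inr b, .inl a => ¬ Precedes θ a b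

/-- Antisymmetry and totality across the two summands hold by definition, one comparison being the
negation of the other. In this order a matched pair is still two different, adjacent elements, the
output of `X` coming first. -/
noncomputable instance : LinearOrder (Edges θ) where
  le := edgesLE θ
  le_refl := by rintro (a | b); exacts [le_refl a, le_refl b]
  le_trans := by
    rintro (a | b) (a' | b') (a'' | b'') h h'
    · exact le_trans (α := X.E) h h'
    · obtain ⟨o, h1, h2⟩ := h'
      exact ⟨o, le_trans (α := X.E) h h1, h2⟩
    · obtain ⟨o, h1, h2⟩ := h
      have : ¬ a'' ≤ o.1 := fun h3 => h' ⟨o, h3, h2⟩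
      exact h1.trans (not_le.1 this).le
    · obtain ⟨o, h1, h2⟩ := h
      exact ⟨o, h1, le_trans (α := Y.E) h2 h'⟩
    · exact fun ⟨o, h1, h2⟩ => h ⟨o, le_trans (α := X.E) h' h1, h2⟩
    · obtain ⟨o, h1, h2⟩ := h'
      have : ¬ (θ o).1 ≤ b := fun h3 => h ⟨o, h1, h3⟩
      exact (not_le.1 this).le.trans h2
    · exact fun ⟨o, h1, h2⟩ => h' ⟨o, h1, le_trans (α := Y.E) h2 h⟩
    · exact le_trans (α := Y.E) h h'
  le_antisymm := by
    rintro (a | b) (a' | b') h h'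
    · exact congrArg Sum.inl (le_antisymm (α := X.E) h h')
    · exact (h' h).elim
    · exact (h h').elim
    · exact congrArg Sum.inr (le_antisymm (α := Y.E) h h')
  le_total := by
    rintro (a | b) (a' | b')
    · exact le_total (α := X.E) a a'
    · exact em _
    · exact (em _).symm
    · exact le_total (α := Y.E) b b'
  toDecidableLE := Classical.decRel _

open Classical in
/-- The composite of `X`, followed by `Y`, with respect to a bijection of the outputs of `X` and
the inputs of `Y`. -/
noncomputable def composite : EdgeGraph O M where
  -- Matched edges are merged by discarding the inputs of `Y`; a merged edge is represented by the
  -- output of `X`.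
  E := {c : Edges θ // ∀ b, c = Sum.inr b → Y.s b ≠ none}
  V := X.V ⊕ Y.V
  finE := haveI : Finite (Edges θ) := inferInstanceAs (Finite (X.E ⊕ Y.E)); inferInstance
  s c := Sum.elim (fun a => (X.s a).map Sum.inl) (fun b => (Y.s b).map Sum.inr) c.1
  t c := Sum.elim
    (fun a => if h : X.t a = none then (Y.t (θ ⟨a, h⟩).1).map Sum.inr else (X.t a).map Sum.inl)
    (fun b => (Y.t b).map Sum.inr) c.1
  obj c := Sum.elim X.obj Y.obj c.1
  mor := Sum.elim X.mor Y.mor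

/-- A vertex of `X` in the composite. -/
def compVL (x : X.V) : (composite θ).V := Sum.inl x

/-- A vertex of `Y` in the composite. -/
def compVR (y : Y.V) : (composite θ).V := Sum.inr y

@[simp] theorem compVL_inj {a b : X.V} : compVL θ a = compVL θ b ↔ a = b :=
  Sum.inl_injective.eq_iff
@[simp] theorem compVR_inj {a b : Y.V} : compVR θ a = compVR θ b ↔ a = b :=
  Sum.inr_injective.eq_iff
@[simp] theorem compVL_ne_compVR {a : X.V} {b : Y.V} : compVL θ a ≠ compVR θ b := Sum.inl_ne_inr
@[simp] theorem compVR_ne_compVL {a : X.V} {b : Y.V} : compVR θ b ≠ compVL θ a := Sum.inr_ne_inl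

/-- An edge of `X` in the composite. -/
def compL (a : X.E) : (composite θ).E := ⟨Sum.inl a, fun _ h => (Sum.inl_ne_inr h).elim⟩

open Classical in
/-- An edge of `Y` in the composite. -/
noncomputable def compR (b : Y.E) : (composite θ).E :=
  if h : Y.s b = none then compL θ (θ.symm ⟨b, h⟩).1
  else ⟨Sum.inr b, fun b' h' => by rwa [← Sum.inr_injective h']⟩

theorem compR_none {b : Y.E} (h : Y.s b = none) : compR θ b = compL θ (θ.symm ⟨b, h⟩).1 := dif_pos h

theorem compR_some {b : Y.E} (h : Y.s b ≠ none) :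
    compR θ b = ⟨Sum.inr b, fun b' h' => by rwa [← Sum.inr_injective h']⟩ := dif_neg h

theorem compR_apply (a : X.E) (h : X.t a = none) : compR θ (θ ⟨a, h⟩).1 = compL θ a := by
  rw [compR_none θ (θ ⟨a, h⟩).2, Subtype.coe_eta, OrderIso.symm_apply_apply]

theorem composite_cases {P : (composite θ).E → Prop} (c : (composite θ).E)
    (hl : ∀ a : X.E, P (compL θ a)) (hr : ∀ b : Y.E, Y.s b ≠ none → P (compR θ b)) : P c := by
  rcases c with ⟨a | b, h⟩
  · exact hl a
  · have := hr b (h b rfl)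
    rwa [compR_some θ (h b rfl)] at this

theorem compL_lt_compL {a a' : X.E} : compL θ a < compL θ a' ↔ a < a' := by
  rw [← not_le, ← not_le]; rfl

theorem compL_inj {a a' : X.E} : compL θ a = compL θ a' ↔ a = a' := by
  rw [le_antisymm_iff, le_antisymm_iff]; rfl

theorem compL_le_compR {a : X.E} {b : Y.E} : compL θ a ≤ compR θ b ↔ Precedes θ a b := by
  by_cases h : Y.s b = none
  · rw [compR_none θ h]
    constructor
    · intro h'
      exact ⟨θ.symm ⟨b, h⟩, h', by rw [OrderIso.apply_symm_apply]⟩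
    · rintro ⟨o, h1, h2⟩
      exact le_trans (α := X.E) h1 ((θ.le_symm_apply (x := o) (y := ⟨b, h⟩)).2 h2)
  · rw [compR_some θ h]; rfl

theorem compL_eq_compR {a : X.E} {b : Y.E} :
    compL θ a = compR θ b ↔ ∃ h : X.t a = none, (θ ⟨a, h⟩).1 = b := by
  constructor
  · intro h
    by_cases hb : Y.s b = none
    · rw [compR_none θ hb, compL_inj] at h
      subst h
      exact ⟨(θ.symm ⟨b, hb⟩).2, by simp⟩
    · rw [compR_some θ hb] at h
      exact (Sum.inl_ne_inr (congrArg Subtype.val h)).elim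
  · rintro ⟨h, rfl⟩
    exact (compR_apply θ a h).symm

theorem compR_strictMono : StrictMono (compR θ) := by
  intro b b' h
  by_cases hb : Y.s b = none
  · rw [compR_none θ hb]
    refine lt_of_le_of_ne ((compL_le_compR θ).2 ⟨_, le_rfl, ?_⟩) fun he => ?_
    · simpa using h.le
    · obtain ⟨h', rfl⟩ := (compL_eq_compR θ).1 he
      simp at h
  · rw [← not_le]
    intro hle
    by_cases hb' : Y.s b' = none
    · rw [compR_none θ hb', compL_le_compR] at hle
      obtain ⟨o, h1, h2⟩ := hle
      have := (θ.symm_apply_le (x := o) (y := ⟨b', hb'⟩)).1 h1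
      exact lt_irrefl _ (h.trans_le (le_trans (α := Y.E) this h2))
    · rw [compR_some θ hb, compR_some θ hb'] at hle
      exact lt_irrefl _ (h.trans_le hle)

theorem s_compL (a : X.E) : (composite θ).s (compL θ a) = (X.s a).map (compVL θ) := rfl
theorem s_compR {b : Y.E} (h : Y.s b ≠ none) :
    (composite θ).s (compR θ b) = (Y.s b).map (compVR θ) := by rw [compR_some θ h]; rfl

theorem t_compL {a : X.E} (h : X.t a ≠ none) :
    (composite θ).t (compL θ a) = (X.t a).map (compVL θ) := dif_neg h

theorem t_compR (b : Y.E) : (composite θ).t (compR θ b) = (Y.t b).map (compVR θ) := by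
  by_cases h : Y.s b = none
  · rw [compR_none θ h]
    refine (dif_pos (θ.symm ⟨b, h⟩).2).trans ?_
    rw [Subtype.coe_eta, OrderIso.apply_symm_apply]
    rfl
  · rw [compR_some θ h]; rfl

/-- The composite graph is a composite. -/
noncomputable def compositeGluing (hθ : ∀ a, Y.obj (θ a).1 = X.obj a.1) :
    Gluing X Y (composite θ) where
  l :=
    { e := compL θ
      v := compVL θ
      mono := fun _ _ h => (compL_lt_compL θ).2 h
      inj := fun _ _ => (compVL_inj θ).1
      s_iff := fun x c => by
        constructor
        · intro h
          induction c using composite_cases with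
          | hl a => exact ⟨a, by simpa [s_compL] using h, rfl⟩
          | hr b hb => simp [s_compR θ hb] at h
        · rintro ⟨a, ha, rfl⟩
          simp [s_compL, ha]
      t_iff := fun x c => by
        constructor
        · intro h
          induction c using composite_cases with
          | hl a =>
            refine ⟨a, ?_, rfl⟩
            by_cases ha : X.t a = none
            · rw [← compR_apply θ a ha, t_compR] at h
              simp at h
            · simpa [t_compL θ ha] using h
          | hr b hb => simp [t_compR] at h
        · rintro ⟨a, ha, rfl⟩
          rw [t_compL θ (by simp [ha]), ha]
          rfl
      obj := fun _ => rfl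
      mor := fun _ => rfl }
  r :=
    { e := compR θ
      v := compVR θ
      mono := compR_strictMono θ
      inj := fun _ _ => (compVR_inj θ).1
      s_iff := fun x c => by
        constructor
        · intro h
          induction c using composite_cases with
          | hl a => simp [s_compL] at h
          | hr b hb => exact ⟨b, by simpa [s_compR θ hb] using h, rfl⟩
        · rintro ⟨a, ha, rfl⟩
          rw [s_compR θ (by simp [ha]), ha]
          rfl
      t_iff := fun x c => by
        constructor
        · intro h
          induction c using composite_cases with
          | hl a =>
            by_cases ha : X.t a = none
            · rw [← compR_apply θ a ha, t_compR] at h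
              exact ⟨_, by simpa using h, compR_apply θ a ha⟩
            · simp [t_compL θ ha] at h
          | hr b hb => exact ⟨b, by simpa [t_compR] using h, rfl⟩
        · rintro ⟨a, ha, rfl⟩
          rw [t_compR θ, ha]
          rfl
      obj := fun b => by
        by_cases h : Y.s b = none
        · rw [compR_none θ h]
          change X.obj _ = _
          rw [← hθ, OrderIso.apply_symm_apply]
        · rw [compR_some θ h]; rfl
      mor := fun _ => rfl }
  disj _ _ := compVL_ne_compVR θ
  cover := by rintro (x | y); exacts [Or.inl ⟨x, rfl⟩, Or.inr ⟨y, rfl⟩]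
  s_none c := by
    constructor
    · intro h
      induction c using composite_cases with
      | hl a => exact ⟨a, by simpa [s_compL] using h, rfl⟩
      | hr b hb =>
        rw [s_compR θ hb, Option.map_eq_none_iff] at h
        exact (hb h).elim
    · rintro ⟨a, ha, rfl⟩
      change Option.map _ _ = _
      rw [ha]; rfl
  t_none c := by
    constructor
    · intro h
      induction c using composite_cases with
      | hl a =>
        by_cases ha : X.t a = none
        · rw [← compR_apply θ a ha, t_compR] at h
          exact ⟨_, by simpa using h, compR_apply θ a ha⟩
        · simp [t_compL θ ha, ha] at h
      | hr b hb => exact ⟨b, by simpa [t_compR] using h, rfl⟩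
    · rintro ⟨b, hb, rfl⟩
      exact (t_compR θ b).trans (by rw [hb]; rfl)
  cross a b h := by
    obtain ⟨o, h1, h2⟩ := (compL_le_compR θ).1 h
    exact ⟨o.1, (θ o).1, (compR_apply θ o.1 o.2).symm, h1, h2⟩

theorem exists_gluing {X Y : EdgeGraph O M} (h : X.outWord = Y.inWord) :
    ∃ Z, Nonempty (Gluing X Y Z) := by
  obtain ⟨θ, hθ⟩ := exists_orderIso_of_map_sortedList_eq h
  exact ⟨_, ⟨compositeGluing θ hθ⟩⟩

end Existence

end Gluing
end EdgeGraph
end TensorCalculus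

namespace TensorCalculus
namespace EdgeGraph

variable {O M : Type u} {L : Labels.{u}}

/-! ### Elementary graphs -/

/-- The graph of a word, without vertices. -/
def idGraph (w : List O) : EdgeGraph O M where
  E := Fin w.length
  V := Empty
  s _ := none
  t _ := none
  obj := w.get
  mor := Empty.elim

theorem map_get_sortedList (w : List O) (p : Fin w.length → Prop) (hp : ∀ i, p i) :
    (sortedList p).map w.get = w := by
  rw [← eq_sortedList (l := List.finRange w.length) (List.pairwise_lt_finRange _)
    (fun e => by simp [hp]), ← List.ofFn_eq_map, List.ofFn_get]

theorem outWord_idGraph (w : List O) : (idGraph (M := M) w).outWord = w :=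
  map_get_sortedList w _ fun _ => rfl

theorem inWord_idGraph (w : List O) : (idGraph (M := M) w).inWord = w :=
  map_get_sortedList w _ fun _ => rfl

instance (w : List O) : IsEmpty (idGraph (M := M) w).V := inferInstanceAs (IsEmpty Empty)

theorem isDiagram_of_isEmpty {I : EdgeGraph L.Ob L.Mor} (hI : IsEmpty I.V) : I.IsDiagram L where
  exists_in v := hI.elim v
  exists_out v := hI.elim v
  lt_of_step _ _ h := hI.elim h.choose
  between a b _ h := by
    obtain ⟨c, h, -⟩ := Relation.TransGen.head'_iff.1 h
    exact hI.elim h.choose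
  isDom v := hI.elim v
  isCod v := hI.elim v

theorem s_eq_none_of_isEmpty {I : EdgeGraph O M} (hI : IsEmpty I.V) (e : I.E) : I.s e = none :=
  Option.eq_none_iff_forall_not_mem.2 fun v => hI.elim v

theorem t_eq_none_of_isEmpty {I : EdgeGraph O M} (hI : IsEmpty I.V) (e : I.E) : I.t e = none :=
  Option.eq_none_iff_forall_not_mem.2 fun v => hI.elim v

theorem inWord_eq_of_isEmpty {I : EdgeGraph O M} (hI : IsEmpty I.V) :
    I.inWord = I.word fun _ => True :=
  word_congr fun e => iff_true_intro (s_eq_none_of_isEmpty hI e)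

theorem iso_of_isEmpty {I J : EdgeGraph O M} (hI : IsEmpty I.V) (hJ : IsEmpty J.V)
    (h : I.inWord = J.inWord) : I.Iso J := by
  rw [inWord_eq_of_isEmpty hI, inWord_eq_of_isEmpty hJ] at h
  obtain ⟨θ, hθ⟩ := exists_orderIso_of_map_sortedList_eq h
  refine ⟨⟨fun a => (θ ⟨a, trivial⟩).1, fun x => hI.elim x, fun a b hab => θ.strictMono hab,
      fun x => hI.elim x, fun x => hI.elim x, fun x => hI.elim x, fun a => hθ ⟨a, trivial⟩,
      fun x => hI.elim x⟩, fun b => ?_, fun x => hJ.elim x⟩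
  obtain ⟨a, ha⟩ := θ.surjective ⟨b, trivial⟩
  exact ⟨a.1, congrArg Subtype.val ha⟩

theorem isEmpty_E_of_inWord {I : EdgeGraph O M} (hI : IsEmpty I.V) (h : I.inWord = []) :
    IsEmpty I.E :=
  ⟨fun e => word_eq_nil.1 h e (s_eq_none_of_isEmpty hI e)⟩

/-- `e` is incident to `v`. -/
def At (Z : EdgeGraph O M) (v : Z.V) (e : Z.E) : Prop := Z.s e = some v ∨ Z.t e = some v

/-- Exactly one vertex, and no virtual edge. -/
def Prime (Z : EdgeGraph O M) : Prop :=
  (∃ v : Z.V, ∀ w, w = v) ∧ ∀ e, Z.s e = none → Z.t e ≠ none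

/-- There is only one vertex, no edge is virtual, and a loop would be smaller than itself. So every
edge is either an input ending at the vertex or an output starting there. -/
theorem Prime.s_eq_none_iff {Z : EdgeGraph L.Ob L.Mor} (hZ : Z.IsDiagram L) (h : Z.Prime) (v : Z.V)
    (e : Z.E) : Z.s e = none ↔ Z.t e = some v := by
  obtain ⟨⟨w, hw⟩, h⟩ := h
  obtain rfl := hw v
  constructor
  · intro he
    obtain ⟨x, hx⟩ := Option.ne_none_iff_exists'.1 (h e he)
    rw [hx, hw x]
  · intro he
    by_contra hs
    obtain ⟨x, hx⟩ := Option.ne_none_iff_exists'.1 hs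
    exact lt_irrefl _ (hZ.lt_of_step e e ⟨v, he, hw x ▸ hx⟩)

theorem Prime.t_eq_none_iff {Z : EdgeGraph L.Ob L.Mor} (hZ : Z.IsDiagram L) (h : Z.Prime) (v : Z.V)
    (e : Z.E) : Z.t e = none ↔ Z.s e = some v := by
  have h1 := h.s_eq_none_iff hZ v e
  obtain ⟨⟨w, hw⟩, h⟩ := h
  obtain rfl := hw v
  constructor
  · intro he
    have : Z.s e ≠ none := fun hs => h e hs he
    obtain ⟨x, hx⟩ := Option.ne_none_iff_exists'.1 this
    rw [hx, hw x]
  · intro he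
    by_contra hs
    obtain ⟨x, hx⟩ := Option.ne_none_iff_exists'.1 hs
    rw [hw x] at hx
    rw [← h1, he] at hx
    simp at hx

theorem Prime.isDom {Z : EdgeGraph L.Ob L.Mor} (hZ : Z.IsDiagram L) (h : Z.Prime) (v : Z.V) :
    L.IsDom (Z.mor v) Z.inWord := by
  have := hZ.isDom v
  rwa [word_congr fun e => (h.s_eq_none_iff hZ v e).symm] at this

theorem Prime.isCod {Z : EdgeGraph L.Ob L.Mor} (hZ : Z.IsDiagram L) (h : Z.Prime) (v : Z.V) :
    L.IsCod (Z.mor v) Z.outWord := by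
  have := hZ.isCod v
  rwa [word_congr fun e => (h.t_eq_none_iff hZ v e).symm] at this

/-- Every input precedes every output, because there is a step from the one to the other through the
vertex. The ordered set of edges is therefore the inputs followed by the outputs, and the two words
and the decoration determine everything. -/
theorem Prime.iso {Z Z' : EdgeGraph L.Ob L.Mor} (hZ : Z.IsDiagram L) (hZ' : Z'.IsDiagram L)
    (h : Z.Prime) (h' : Z'.Prime) (hm : ∀ v v', Z.mor v = Z'.mor v') (hi : Z.inWord = Z'.inWord)
    (ho : Z.outWord = Z'.outWord) : Z.Iso Z' := by
  obtain ⟨θ, hθ⟩ := exists_orderIso_of_map_sortedList_eq hi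
  obtain ⟨τ, hτ⟩ := exists_orderIso_of_map_sortedList_eq ho
  obtain ⟨v, hv⟩ := h.1
  obtain ⟨v', hv'⟩ := h'.1
  have hs := h.s_eq_none_iff hZ v
  have hs' := h'.s_eq_none_iff hZ' v'
  have ht := h.t_eq_none_iff hZ v
  have ht' := h'.t_eq_none_iff hZ' v'
  have hlt : ∀ a b, Z.s a = none → Z.t b = none → a < b := fun a b ha hb =>
    hZ.lt_of_step _ _ ⟨v, (hs a).1 ha, (ht b).1 hb⟩
  have hlt' : ∀ a b, Z'.s a = none → Z'.t b = none → a < b := fun a b ha hb =>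
    hZ'.lt_of_step _ _ ⟨v', (hs' a).1 ha, (ht' b).1 hb⟩
  have cov : ∀ e, Z.s e = none ∨ Z.t e = none := fun e => by
    rw [ht]
    rcases he : Z.s e with _ | w
    exacts [Or.inl rfl, Or.inr (hv w ▸ rfl)]
  have cov' : ∀ e, Z'.s e = none ∨ Z'.t e = none := fun e => by
    rw [ht']
    rcases he : Z'.s e with _ | w
    exacts [Or.inl rfl, Or.inr (hv' w ▸ rfl)]
  refine Iso.of_rel (fun e e' => (∃ h, (θ ⟨e, h⟩).1 = e') ∨ ∃ h, (τ ⟨e, h⟩).1 = e')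
    (fun _ _ => True) ?_ ?_ ?_ (fun _ => ⟨v', trivial⟩) (fun _ => ⟨v, trivial⟩) ?_ ?_ ?_ ?_ ?_
  · intro e
    rcases cov e with h | h
    exacts [⟨_, Or.inl ⟨h, rfl⟩⟩, ⟨_, Or.inr ⟨h, rfl⟩⟩]
  · intro e
    rcases cov' e with h | h
    · obtain ⟨a, ha⟩ := θ.surjective ⟨e, h⟩
      exact ⟨a.1, Or.inl ⟨a.2, congrArg Subtype.val ha⟩⟩
    · obtain ⟨a, ha⟩ := τ.surjective ⟨e, h⟩
      exact ⟨a.1, Or.inr ⟨a.2, congrArg Subtype.val ha⟩⟩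
  · rintro a _ b _ (⟨h1, rfl⟩ | ⟨h1, rfl⟩) (⟨h2, rfl⟩ | ⟨h2, rfl⟩)
    · exact (θ.le_iff_le (x := ⟨a, h1⟩) (y := ⟨b, h2⟩)).symm
    · exact iff_of_true (hlt _ _ h1 h2).le (hlt' _ _ (θ _).2 (τ _).2).le
    · exact iff_of_false (hlt _ _ h2 h1).not_ge (hlt' _ _ (θ _).2 (τ _).2).not_ge
    · exact (τ.le_iff_le (x := ⟨a, h1⟩) (y := ⟨b, h2⟩)).symm
  · intro a a' b b' _ _
    exact iff_of_true ((hv a).trans (hv b).symm) ((hv' a').trans (hv' b').symm)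
  · rintro e _ w w' (⟨h1, rfl⟩ | ⟨h1, rfl⟩) -
    · exact iff_of_false (by simp [h1]) (by simp [(θ ⟨e, h1⟩).2])
    · rw [hv w, hv' w']
      exact iff_of_true ((ht e).1 h1) ((ht' _).1 (τ ⟨e, h1⟩).2)
  · rintro e _ w w' (⟨h1, rfl⟩ | ⟨h1, rfl⟩) -
    · rw [hv w, hv' w']
      exact iff_of_true ((hs e).1 h1) ((hs' _).1 (θ ⟨e, h1⟩).2)
    · exact iff_of_false (by simp [h1]) (by simp [(τ ⟨e, h1⟩).2])
  · rintro e _ (⟨h1, rfl⟩ | ⟨h1, rfl⟩)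
    exacts [(hθ ⟨e, h1⟩).symm, (hτ ⟨e, h1⟩).symm]
  · exact fun _ _ _ => hm _ _

/-- The prime graph with given words of inputs and outputs and given decoration of its vertex. -/
def primeGraph (w : List O) (f : M) (w' : List O) : EdgeGraph O M where
  E := Fin w.length ⊕ₗ Fin w'.length
  V := Unit
  finE := inferInstanceAs (Finite (Fin w.length ⊕ Fin w'.length))
  s c := Sum.elim (fun _ => none) (fun _ => some ()) (ofLex c)
  t c := Sum.elim (fun _ => some ()) (fun _ => none) (ofLex c)
  obj c := Sum.elim w.get w'.get (ofLex c)
  mor _ := f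

/-- An input of a prime graph. -/
def primeIn (w : List O) (f : M) (w' : List O) (i : Fin w.length) : (primeGraph w f w').E :=
  toLex (Sum.inl i)

/-- An output of a prime graph. -/
def primeOut (w : List O) (f : M) (w' : List O) (i : Fin w'.length) : (primeGraph w f w').E :=
  toLex (Sum.inr i)

theorem word_primeGraph_in (w : List O) (f : M) (w' : List O)
    (p : (primeGraph w f w').E → Prop) (hp : ∀ i, p (primeIn w f w' i))
    (hp' : ∀ i, ¬ p (primeOut w f w' i)) : (primeGraph w f w').word p = w := by
  rw [word, ← map_sortedList (E := Fin w.length) (p := fun _ => True)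
    (j := primeIn w f w'), List.map_map]
  · exact map_get_sortedList w _ fun _ => trivial
  · exact fun a b h => Sum.Lex.inl_lt_inl_iff.2 h
  · intro e
    constructor
    · intro h
      rcases e with i | i
      exacts [⟨i, trivial, rfl⟩, (hp' i h).elim]
    · rintro ⟨i, -, rfl⟩
      exact hp i

theorem word_primeGraph_out (w : List O) (f : M) (w' : List O)
    (p : (primeGraph w f w').E → Prop) (hp : ∀ i, p (primeOut w f w' i))
    (hp' : ∀ i, ¬ p (primeIn w f w' i)) : (primeGraph w f w').word p = w' := by
  rw [word, ← map_sortedList (E := Fin w'.length) (p := fun _ => True)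
    (j := primeOut w f w'), List.map_map]
  · exact map_get_sortedList w' _ fun _ => trivial
  · exact fun a b h => Sum.Lex.inr_lt_inr_iff.2 h
  · intro e
    constructor
    · intro h
      rcases e with i | i
      exacts [(hp' i h).elim, ⟨i, trivial, rfl⟩]
    · rintro ⟨i, -, rfl⟩
      exact hp i

theorem inWord_primeGraph (w : List O) (f : M) (w' : List O) :
    (primeGraph w f w').inWord = w :=
  word_primeGraph_in _ _ _ _ (fun _ => rfl) fun _ h => Option.some_ne_none _ h

theorem outWord_primeGraph (w : List O) (f : M) (w' : List O) :
    (primeGraph w f w').outWord = w' :=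
  word_primeGraph_out _ _ _ _ (fun _ => rfl) fun _ h => Option.some_ne_none _ h

theorem prime_primeGraph (w : List O) (f : M) (w' : List O) : (primeGraph w f w').Prime :=
  ⟨⟨(), fun _ => rfl⟩, fun e h => by
    rcases e with i | i
    exacts [Option.some_ne_none _, (Option.some_ne_none _ h).elim]⟩

theorem isDiagram_primeGraph {w w' : List L.Ob} {f : L.Mor} (hw : w ≠ []) (hw' : w' ≠ [])
    (hd : L.IsDom f w) (hc : L.IsCod f w') : (primeGraph w f w').IsDiagram L where
  exists_in v := ⟨toLex (Sum.inl ⟨0, List.length_pos_iff.2 hw⟩), rfl⟩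
  exists_out v := ⟨toLex (Sum.inr ⟨0, List.length_pos_iff.2 hw'⟩), rfl⟩
  lt_of_step := by
    rintro (i | i) (j | j) ⟨v, h, h'⟩
    · exact (Option.some_ne_none _ h'.symm).elim
    · exact Sum.Lex.inl_lt_inr _ _
    · exact (Option.some_ne_none _ h'.symm).elim
    · exact (Option.some_ne_none _ h.symm).elim
  between a b c h _ _ := by
    obtain ⟨-, ⟨v, h1, -⟩, -⟩ := Relation.TransGen.head'_iff.1 h
    obtain ⟨-, -, ⟨v', -, h2⟩⟩ := Relation.TransGen.tail'_iff.1 h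
    rcases c with i | i
    · exact Or.inr (.single ⟨(), rfl, h2⟩)
    · exact Or.inl (.single ⟨(), h1, rfl⟩)
  isDom v := by
    rw [word_primeGraph_in]
    exacts [hd, fun _ => rfl, fun _ h => Option.some_ne_none _ h.symm]
  isCod v := by
    rw [word_primeGraph_out]
    exacts [hc, fun _ => rfl, fun _ h => Option.some_ne_none _ h.symm]

/-! ### Decompositions -/

/-- As long as an edge from some vertex ends at `v`, pass to its source; the chosen outgoing edge
decreases, so this stops. The vertex found has no predecessor and forms a cut by itself. -/
theorem IsDiagram.exists_cut {Z : EdgeGraph L.Ob L.Mor} (hZ : Z.IsDiagram L) (hne : Nonempty Z.V) :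
    ∃ v, Z.IsCut fun w => w = v := by
  obtain ⟨v⟩ := hne
  obtain ⟨e, he⟩ := hZ.exists_out v
  induction e using WellFoundedLT.induction generalizing v with
  | ind e ih =>
    by_cases h : ∃ a w, Z.s a = some w ∧ Z.t a = some v
    · obtain ⟨a, w, ha, ha'⟩ := h
      exact ih a (hZ.lt_of_step _ _ ⟨v, ha', he⟩) w ha
    · exact ⟨v, fun a w x hw hx hxv => (h ⟨a, w, hw, hxv ▸ hx⟩).elim⟩

theorem IsDiagram.of_tensor {X Y : EdgeGraph L.Ob L.Mor} (h : (X.tensor Y).IsDiagram L) :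
    X.IsDiagram L ∧ Y.IsDiagram L := by
  constructor
  · refine h.of_sub (tensorLeft X Y) fun a b hab => ?_
    obtain ⟨c, hc, h'⟩ := reach_inl.1 hab
    exact inl_inj.1 h' ▸ hc
  · refine h.of_sub (tensorRight X Y) fun a b hab => ?_
    obtain ⟨c, hc, h'⟩ := reach_inr.1 hab
    exact inr_inj.1 h' ▸ hc

/-- A graph is the tensor product of the restrictions to an initial segment and to its complement,
if no vertex is incident to both. -/
theorem exists_split {Z : EdgeGraph L.Ob L.Mor} (P : Z.E → Prop)
    (hP : ∀ a b, a ≤ b → P b → P a) (hv : ∀ a b v, Z.At v a → Z.At v b → P a → P b) :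
    ∃ (X Y : EdgeGraph L.Ob L.Mor) (j : Sub (X.tensor Y) Z), Function.Surjective j.e ∧
      Function.Surjective j.v ∧ (∀ a, P (j.e (inl X Y a))) ∧ (∀ b, ¬ P (j.e (inr X Y b))) := by
  let A : Z.V → Prop := fun v => ∃ e, P e ∧ Z.At v e
  have hA : ∀ v e, Z.At v e → (A v ↔ P e) := fun v e he =>
    ⟨fun ⟨e', he', h⟩ => hv _ _ v h he he', fun h => ⟨e, h, he⟩⟩
  let l : Sub (Z.restrict P A) Z := restrictSub (fun e v h he => (hA v e (Or.inl he)).1 h)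
    (fun e v h he => (hA v e (Or.inr he)).1 h)
  let r : Sub (Z.restrict (fun e => ¬ P e) fun v => ¬ A v) Z :=
    restrictSub (fun e v h he => (not_congr (hA v e (Or.inl he))).1 h)
    (fun e v h he => (not_congr (hA v e (Or.inr he))).1 h)
  have hlt : ∀ a b, l.e a < r.e b := fun a b => by
    rw [← not_le]
    exact fun h => b.2 (hP _ _ h a.2)
  have hd : ∀ x y, l.v x ≠ r.v y := fun x y h => y.2 ((show x.1 = y.1 from h) ▸ x.2)
  refine ⟨_, _, tensorSub l r hlt hd, fun e => ?_, fun z => ?_, fun a => a.2, fun a => a.2⟩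
  · by_cases he : P e
    exacts [⟨inl _ _ ⟨e, he⟩, rfl⟩, ⟨inr _ _ ⟨e, he⟩, rfl⟩]
  · by_cases he : A z
    exacts [⟨vl _ _ ⟨z, he⟩, rfl⟩, ⟨vr _ _ ⟨z, he⟩, rfl⟩]

/-- No edge joins two vertices. -/
def Flat (Z : EdgeGraph O M) : Prop := ∀ e, Z.s e = none ∨ Z.t e = none

theorem IsDiagram.exists_at {Z : EdgeGraph L.Ob L.Mor} (hZ : Z.IsDiagram L) (v : Z.V) :
    ∃ e, Z.At v e := (hZ.exists_in v).imp fun _ h => Or.inr h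

/-- The edges at a vertex form an interval. Enlarge `a` and `b` to an input `i` and an output `o` of
`v`, with `i → o`. Planarity gives `i → e` or `e → o`. In a flat graph all paths consist of one
step, and the step from `i` or into `o` passes through `v`. -/
theorem Flat.at_of_between {Z : EdgeGraph L.Ob L.Mor} (hZ : Z.IsDiagram L) (hf : Z.Flat) {v : Z.V}
    {a b e : Z.E} (ha : Z.At v a) (hb : Z.At v b) (hae : a ≤ e) (heb : e ≤ b) : Z.At v e := by
  obtain ⟨i, hi, hia⟩ : ∃ i, Z.t i = some v ∧ i ≤ a := by
    rcases ha with ha | ha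
    · obtain ⟨i, hi⟩ := hZ.exists_in v
      exact ⟨i, hi, (hZ.lt_of_step _ _ ⟨v, hi, ha⟩).le⟩
    · exact ⟨a, ha, le_rfl⟩
  obtain ⟨o, ho, hbo⟩ : ∃ o, Z.s o = some v ∧ b ≤ o := by
    rcases hb with hb | hb
    · exact ⟨b, hb, le_rfl⟩
    · obtain ⟨o, ho⟩ := hZ.exists_out v
      exact ⟨o, ho, (hZ.lt_of_step _ _ ⟨v, hb, ho⟩).le⟩
  have single : ∀ {a b}, Z.Reach a b → Z.Step a b := by
    intro a b h
    induction h with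
    | single h => exact h
    | @tail b c _ h ih =>
      obtain ⟨u, -, h1⟩ := ih
      obtain ⟨w, h2, -⟩ := h
      rcases hf b with h' | h'
      · simp [h'] at h1
      · simp [h'] at h2
  rcases (hia.trans hae).eq_or_lt with rfl | h1
  · exact Or.inr hi
  rcases (heb.trans hbo).eq_or_lt with rfl | h2
  · exact Or.inl ho
  rcases hZ.between i o e (.single ⟨v, hi, ho⟩) h1 h2 with h | h
  · obtain ⟨w, hw, hw'⟩ := single h
    rw [hi, Option.some.injEq] at hw
    exact Or.inl (hw ▸ hw')
  · obtain ⟨w, hw, hw'⟩ := single h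
    rw [ho, Option.some.injEq] at hw'
    exact Or.inr (hw' ▸ hw)

theorem Flat.at_unique {Z : EdgeGraph O M} (hf : Z.Flat) {v w : Z.V} {e : Z.E} (hv : Z.At v e)
    (hw : Z.At w e) : v = w := by
  unfold At at hv hw
  rcases hf e with h | h <;> simp [h] at hv hw <;> simpa [hv] using hw

/-- A graph with one vertex is a prime graph between two graphs without vertices. -/
theorem exists_atom {Z : EdgeGraph L.Ob L.Mor} (hZ : Z.IsDiagram L) {v : Z.V} (hv : ∀ w, w = v) :
    ∃ I K J : EdgeGraph L.Ob L.Mor, I.IsDiagram L ∧ K.IsDiagram L ∧ J.IsDiagram L ∧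
      IsEmpty I.V ∧ K.Prime ∧ IsEmpty J.V ∧ (I.tensor (K.tensor J)).Iso Z := by
  have flat : ∀ {Z : EdgeGraph L.Ob L.Mor}, Z.IsDiagram L → ∀ {v : Z.V}, (∀ w, w = v) → Z.Flat := by
    intro Z hZ v hv e
    by_contra h
    obtain ⟨h1, h2⟩ := not_or.1 h
    obtain ⟨x, hx⟩ := Option.ne_none_iff_exists'.1 h1
    obtain ⟨y, hy⟩ := Option.ne_none_iff_exists'.1 h2
    exact lt_irrefl _ (hZ.lt_of_step e e ⟨y, hy, (hv x).trans (hv y).symm ▸ hx⟩)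
  -- The edges strictly below all edges at `v` form `I`.
  obtain ⟨I, Y, j, h1, h2, h3, h4⟩ := exists_split (fun e => ∀ e', Z.At v e' → e < e')
    (fun a b hab hb e' he' => hab.trans_lt (hb e' he'))
    (fun a b w ha hb h => (lt_irrefl _ (h a (hv w ▸ ha))).elim)
  have hIY := hZ.of_iso ⟨j, h1, h2⟩
  obtain ⟨hI, hY⟩ := hIY.of_tensor
  have hIV : IsEmpty I.V := ⟨fun x => by
    obtain ⟨e, he⟩ := hI.exists_in x
    have := ((tensorLeft I Y).trans j).t_e e x |>.2 he
    exact lt_irrefl _ (h3 e _ (Or.inr (this.trans (congrArg some (hv _)))))⟩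
  obtain ⟨y, hy⟩ : ∃ y, j.v (vr I Y y) = v := by
    obtain ⟨x, hx⟩ := h2 v
    induction x using vertex_cases with
    | hl x => exact hIV.elim x
    | hr y => exact ⟨y, hx⟩
  have hYv : ∀ w, w = y := fun w =>
    ((tensorRight I Y).trans j).inj ((hv _).trans hy.symm)
  have hfY := flat hY hYv
  -- Of the remaining edges, those that lie weakly below some edge at the vertex form `K`; those
  -- above all of them form `J`.
  obtain ⟨K, J, k, h5, h6, h7, h8⟩ := exists_split (fun e => ∃ e', Y.At y e' ∧ e ≤ e')
    (fun a b hab ⟨e', he', h⟩ => ⟨e', he', hab.trans h⟩)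
    (fun a b w ha hb _ => ⟨b, hYv w ▸ hb, le_rfl⟩)
  obtain ⟨hK, hJ⟩ := (hY.of_iso ⟨k, h5, h6⟩).of_tensor
  have hJV : IsEmpty J.V := ⟨fun x => by
    obtain ⟨e, he⟩ := hJ.exists_in x
    have := ((tensorRight K J).trans k).t_e e x |>.2 he
    exact h8 e ⟨_, Or.inr (this.trans (congrArg some (hYv _))), le_rfl⟩⟩
  obtain ⟨x, hx⟩ : ∃ x, k.v (vl K J x) = y := by
    obtain ⟨x, hx⟩ := h6 y
    induction x using vertex_cases with
    | hl x => exact ⟨x, hx⟩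
    | hr y => exact hJV.elim y
  refine ⟨I, K, J, hI, hK, hJ, hIV, ⟨⟨x, fun w => ?_⟩, fun e hs ht => ?_⟩, hJV,
    ((Iso.refl I).tensor ⟨k, h5, h6⟩).trans ⟨j, h1, h2⟩⟩
  · exact ((tensorLeft K J).trans k).inj ((hYv _).trans hx.symm)
  -- An edge of `K` lies weakly between two edges at the vertex, hence is incident to it by
  -- `Flat.at_of_between` and cannot be virtual.
  · obtain ⟨e', he', hle⟩ := h7 e
    have hlow := h4 (k.e (inl K J e))
    push Not at hlow
    obtain ⟨z, hz, hle'⟩ := hlow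
    have hz' : ∃ z', Y.At y z' ∧ z' ≤ k.e (inl K J e) := by
      rw [← hy] at hz
      rcases hz with hz | hz
      · obtain ⟨z', hz', rfl⟩ := (((tensorRight I Y).trans j).s_iff y z).1 hz
        exact ⟨z', Or.inl hz', ((tensorRight I Y).trans j).mono.le_iff_le.1 hle'⟩
      · obtain ⟨z', hz', rfl⟩ := (((tensorRight I Y).trans j).t_iff y z).1 hz
        exact ⟨z', Or.inr hz', ((tensorRight I Y).trans j).mono.le_iff_le.1 hle'⟩
    obtain ⟨z', hz', hz''⟩ := hz'
    have hat := hfY.at_of_between hY hz' he' hz'' hle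
    rw [← hx] at hat
    rcases hat with h | h
    · simp [(((tensorLeft K J).trans k).s_e e x).1 h] at hs
    · simp [(((tensorLeft K J).trans k).t_e e x).1 h] at ht

/-- The parts of the decomposition of a graph with one vertex are unique. -/
theorem atom_unique {I K J I' K' J' : EdgeGraph L.Ob L.Mor} (hK : K.IsDiagram L)
    (hK' : K'.IsDiagram L) (hI : IsEmpty I.V) (pK : K.Prime) (hJ : IsEmpty J.V)
    (hI' : IsEmpty I'.V) (pK' : K'.Prime) (hJ' : IsEmpty J'.V)
    (h : (I.tensor (K.tensor J)).Iso (I'.tensor (K'.tensor J'))) :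
    I.Iso I' ∧ K.Iso K' ∧ J.Iso J' := by
  -- The three factors are recovered from the tensor product in an invariant way: the word of `I`
  -- from the edges below all edges with a vertex, the word of `J` from the edges above all of them,
  -- and the words of `K` from the edges with a target and from those with a source.
  let Lo : ∀ Z : EdgeGraph L.Ob L.Mor, Z.E → Prop := fun Z e =>
    ∀ e', (Z.s e' ≠ none ∨ Z.t e' ≠ none) → e < e'
  let Hi : ∀ Z : EdgeGraph L.Ob L.Mor, Z.E → Prop := fun Z e =>
    ∀ e', (Z.s e' ≠ none ∨ Z.t e' ≠ none) → e' < e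
  have loc : ∀ {K : EdgeGraph L.Ob L.Mor}, K.Prime → ∀ e, K.s e ≠ none ∨ K.t e ≠ none :=
    fun pK e => by
      have := pK.2 e
      tauto
  have words : ∀ {I K J : EdgeGraph L.Ob L.Mor}, K.IsDiagram L → IsEmpty I.V → K.Prime →
      IsEmpty J.V → (I.tensor (K.tensor J)).word (Lo _) = I.inWord ∧
        (I.tensor (K.tensor J)).word (Hi _) = J.inWord ∧
        (I.tensor (K.tensor J)).word (fun e => (I.tensor (K.tensor J)).t e ≠ none) = K.inWord ∧
        (I.tensor (K.tensor J)).word (fun e => (I.tensor (K.tensor J)).s e ≠ none) = K.outWord := by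
    intro I K J hK hI pK hJ
    obtain ⟨v, -⟩ := pK.1
    obtain ⟨e₀, he₀⟩ := hK.exists_at v
    simp only [word_tensor, inWord_eq_of_isEmpty hI, inWord_eq_of_isEmpty hJ, s_inl, s_inr, t_inl,
      t_inr]
    have nil : ∀ {Z : EdgeGraph L.Ob L.Mor} {p : Z.E → Prop}, (∀ e, ¬ p e) → Z.word p = [] :=
      fun h => word_eq_nil.2 h
    have noI := s_eq_none_of_isEmpty hI
    have noI' := t_eq_none_of_isEmpty hI
    have noJ := s_eq_none_of_isEmpty hJ
    have noJ' := t_eq_none_of_isEmpty hJ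
    refine ⟨?_, ?_, ?_, ?_⟩
    · rw [nil (Z := K), nil (Z := J)]
      · rw [List.append_nil, List.append_nil]
        refine word_congr fun e => iff_true_intro fun e' he' => ?_
        induction e' using tensor_cases with
        | hl a => simp [noI, noI'] at he'
        | hr b => simp
      · intro e he
        have := he (inr I _ (inl K J e₀)) (by simpa using loc pK e₀)
        simp at this
      · intro e he
        have := he (inr I _ (inl K J e)) (by simpa using loc pK e)
        simp at this
    · rw [nil (Z := K), nil (Z := I)]
      · rw [List.nil_append, List.nil_append]
        refine word_congr fun e => iff_true_intro fun e' he' => ?_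
        induction e' using tensor_cases with
        | hl a => simp
        | hr b =>
          induction b using tensor_cases with
          | hl a => simp
          | hr b => simp [noJ, noJ'] at he'
      · intro e he
        have := he (inr I _ (inl K J e₀)) (by simpa using loc pK e₀)
        simp at this
      · intro e he
        have := he (inr I _ (inl K J e)) (by simpa using loc pK e)
        simp at this
    · rw [nil (Z := I), nil (Z := J)]
      · rw [List.nil_append, List.append_nil]
        refine word_congr fun e => ?_
        simp only [ne_eq, Option.map_eq_none_iff]
        rw [pK.t_eq_none_iff hK v]
        rcases h : K.s e with _ | w
        · simp
        · simp [pK.1.choose_spec w, pK.1.choose_spec v]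
      · intro e; simp [noJ']
      · intro e; simp [noI']
    · rw [nil (Z := I), nil (Z := J)]
      · rw [List.nil_append, List.append_nil]
        refine word_congr fun e => ?_
        simp only [ne_eq, Option.map_eq_none_iff]
        rw [pK.t_eq_none_iff hK v]
        rcases h : K.s e with _ | w
        · simp
        · simp [pK.1.choose_spec w, pK.1.choose_spec v]
      · intro e; simp [noJ]
      · intro e; simp [noI]
  obtain ⟨a1, a2, a3, a4⟩ := words hK hI pK hJ
  obtain ⟨b1, b2, b3, b4⟩ := words hK' hI' pK' hJ'
  obtain ⟨j, hj, hj'⟩ := h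
  have wj : ∀ (p : (I.tensor (K.tensor J)).E → Prop) (p' : (I'.tensor (K'.tensor J')).E → Prop),
      (∀ a, p' (j.e a) ↔ p a) → (I.tensor (K.tensor J)).word p = (I'.tensor (K'.tensor J')).word p' :=
    fun p p' h => j.word_eq fun b => by
      obtain ⟨b, rfl⟩ := hj b
      rw [h]
      exact ⟨fun hb => ⟨b, hb, rfl⟩, fun ⟨a, ha, hab⟩ => j.mono.injective hab ▸ ha⟩
  have hs := fun a => (j.s_e_eq_none hj' a).not
  have ht := fun a => (j.t_e_eq_none hj' a).not
  have c1 : I.inWord = I'.inWord := by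
    rw [← a1, ← b1]
    refine wj _ _ fun a => ?_
    change (∀ e', _ → _) ↔ ∀ e', _ → _
    rw [hj.forall]
    simp only [ne_eq, hs, ht, j.mono.lt_iff_lt]
  have c2 : J.inWord = J'.inWord := by
    rw [← a2, ← b2]
    refine wj _ _ fun a => ?_
    change (∀ e', _ → _) ↔ ∀ e', _ → _
    rw [hj.forall]
    simp only [ne_eq, hs, ht, j.mono.lt_iff_lt]
  have c3 : K.inWord = K'.inWord := by
    rw [← a3, ← b3]
    exact wj _ _ ht
  have c4 : K.outWord = K'.outWord := by
    rw [← a4, ← b4]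
    exact wj _ _ hs
  refine ⟨iso_of_isEmpty hI hI' c1, Prime.iso hK hK' pK pK' (fun v v' => ?_) c3 c4,
    iso_of_isEmpty hJ hJ' c2⟩
  have := j.mor (vr I _ (vl K J v))
  generalize j.v (vr I _ (vl K J v)) = z at this
  induction z using vertex_cases with
  | hl x => exact hI'.elim x
  | hr y =>
    induction y using vertex_cases with
    | hl y =>
      obtain ⟨w, hw⟩ := pK'.1
      rw [hw v', ← hw y]
      exact this.symm
    | hr x => exact hJ'.elim x

end EdgeGraph
end TensorCalculus

namespace TensorCalculus
namespace EdgeGraph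

variable {O M : Type u} {L : Labels.{u}}

/-! ### Number of vertices -/

/-- The number of vertices. -/
noncomputable def size (Z : EdgeGraph O M) : ℕ := Nat.card Z.V

theorem Iso.size_eq {X Z : EdgeGraph O M} (h : X.Iso Z) : X.size = Z.size := by
  obtain ⟨j, -, hj⟩ := h
  exact Nat.card_eq_of_bijective j.v ⟨j.inj, hj⟩

theorem size_tensor {X Y : EdgeGraph L.Ob L.Mor} (hX : X.IsDiagram L) (hY : Y.IsDiagram L) :
    (X.tensor Y).size = X.size + Y.size := by
  have := hX.finite
  have := hY.finite
  exact Nat.card_sum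

theorem Gluing.size_eq {X Y Z : EdgeGraph L.Ob L.Mor} (g : Gluing X Y Z) (hX : X.IsDiagram L)
    (hY : Y.IsDiagram L) : Z.size = X.size + Y.size := by
  have := hX.finite
  have := hY.finite
  rw [size, size, size, ← Nat.card_sum]
  symm
  refine Nat.card_eq_of_bijective (Sum.elim g.l.v g.r.v) ⟨?_, fun z => ?_⟩
  · exact g.l.inj.sumElim g.r.inj g.disj
  · rcases g.cover z with ⟨x, hx⟩ | ⟨y, hy⟩
    exacts [⟨Sum.inl x, hx⟩, ⟨Sum.inr y, hy⟩]

theorem size_eq_zero {Z : EdgeGraph L.Ob L.Mor} (hZ : Z.IsDiagram L) : Z.size = 0 ↔ IsEmpty Z.V := by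
  have := hZ.finite
  exact Finite.card_eq_zero_iff

theorem size_eq_one {Z : EdgeGraph O M} : Z.size = 1 ↔ ∃ v : Z.V, ∀ w, w = v := by
  rw [size, Nat.card_eq_one_iff_exists]

theorem Prime.size_eq {Z : EdgeGraph O M} (hZ : Z.Prime) : Z.size = 1 := size_eq_one.2 hZ.1

/-! ### Exchange of independent vertices -/

theorem IsCut.or {Z : EdgeGraph O M} {A B : Z.V → Prop} (hA : Z.IsCut A) (hB : Z.IsCut B) :
    Z.IsCut fun v => A v ∨ B v :=
  fun e v w h h' => Or.imp (hA e v w h h') (hB e v w h h')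

/-- The source in `Z` of an edge of the first part is a vertex of the first part, so no edge leads
back into it. -/
theorem Gluing.isCut {X Y Z : EdgeGraph O M} (g : Gluing X Y Z) :
    Z.IsCut fun z => ∃ x, g.l.v x = z := by
  rintro e v w hv hw ⟨x, rfl⟩
  obtain ⟨a, -, rfl⟩ := (g.l.t_iff _ _).1 hw
  rw [g.s_l, Option.map_eq_some_iff] at hv
  exact hv.imp fun _ h => h.2

-- `X ⊗ Y` is `X ⊗ id` followed by `id ⊗ Y`, and also `id ⊗ Y` followed by `X ⊗ id`. By
-- associativity both factorizations extend to `Z`, with the second factor absorbed into `T`. Their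
-- lower vertices are those of `g` and of `g'`, so `iso_of_vertices_eq` identifies the parts.
open Gluing in
theorem Gluing.exists_diamond {A A' Q Q' X Y T Z : EdgeGraph L.Ob L.Mor} (hX : X.IsDiagram L)
    (g : Gluing A Q Z) (g' : Gluing A' Q' Z) (k : Gluing (X.tensor Y) T Z)
    (h : ∀ z, (∃ x, g.l.v x = z) ↔ ∃ x, k.l.v (vl X Y x) = z)
    (h' : ∀ z, (∃ x, g'.l.v x = z) ↔ ∃ y, k.l.v (vr X Y y) = z) :
    A.Iso (X.tensor (idGraph Y.inWord)) ∧ A'.Iso ((idGraph X.inWord).tensor Y) ∧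
      Nonempty (Gluing ((idGraph X.outWord).tensor Y) T Q) ∧
      Nonempty (Gluing (X.tensor (idGraph Y.outWord)) T Q') := by
  have out : ∀ {X : EdgeGraph L.Ob L.Mor}, X.IsDiagram L → ∀ a : X.E, ∃ o, X.t o = none ∧ a ≤ o :=
    fun hX a => by
      obtain ⟨o, ho, h⟩ := hX.exists_output a
      exact ⟨o, ho, h.elim (fun h => h.le) fun h => (hX.lt_of_reach h).le⟩
  have hi : ∀ w : List L.Ob, (idGraph (M := L.Mor) w).IsDiagram L := fun w =>
    isDiagram_of_isEmpty inferInstance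
  obtain ⟨x₁⟩ := exists_of_isEmpty_right (X := X) (I := idGraph X.outWord) inferInstance
    (inWord_idGraph _).symm
  obtain ⟨x₂⟩ := exists_of_isEmpty_left (X := X) (I := idGraph X.inWord) inferInstance
    (outWord_idGraph _)
  obtain ⟨y₁⟩ := exists_of_isEmpty_left (X := Y) (I := idGraph Y.inWord) inferInstance
    (outWord_idGraph _)
  obtain ⟨y₂⟩ := exists_of_isEmpty_right (X := Y) (I := idGraph Y.outWord) inferInstance
    (inWord_idGraph _).symm
  have e : ∀ {w : List L.Ob}, (idGraph (M := L.Mor) w).V → False := fun v => Empty.elim v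
  let gA := x₁.tensor y₁ (out hX)
  let gB := x₂.tensor y₂ (out (hi _))
  obtain ⟨hA, hQ⟩ := g.iso_of_vertices_eq (assocLower gA k) fun z => by
    rw [h]
    constructor
    · rintro ⟨x, rfl⟩
      rcases x₁.cover x with ⟨x, rfl⟩ | ⟨y, -⟩
      · exact ⟨vl _ _ x, rfl⟩
      · exact (e y).elim
    · rintro ⟨x, rfl⟩
      induction x using vertex_cases with
      | hl x => exact ⟨x₁.l.v x, rfl⟩
      | hr y => exact (e y).elim
  obtain ⟨hA', hQ'⟩ := g'.iso_of_vertices_eq (assocLower gB k) fun z => by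
    rw [h']
    constructor
    · rintro ⟨x, rfl⟩
      rcases y₂.cover x with ⟨x, rfl⟩ | ⟨y, -⟩
      · exact ⟨vr _ _ x, rfl⟩
      · exact (e y).elim
    · rintro ⟨x, rfl⟩
      induction x using vertex_cases with
      | hl x => exact (e x).elim
      | hr y => exact ⟨y₂.l.v y, rfl⟩
  exact ⟨hA, hA', (assocUpper gA k).of_iso (Iso.refl _) (Iso.refl _) hQ.symm,
    (assocUpper gB k).of_iso (Iso.refl _) (Iso.refl _) hQ'.symm⟩

/-- Two different minimal vertices span a tensor product of two graphs with one vertex each. -/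
theorem exists_split_of_flat {R : EdgeGraph L.Ob L.Mor} (hR : R.IsDiagram L) (hf : R.Flat)
    {v v' : R.V} (hne : v ≠ v') (hv : ∀ w, w = v ∨ w = v') :
    ∃ (X Y : EdgeGraph L.Ob L.Mor) (j : Sub (X.tensor Y) R) (x : X.V) (y : Y.V),
      Function.Surjective j.e ∧ Function.Surjective j.v ∧ (∀ w, w = x) ∧ (∀ w, w = y) ∧
      ((j.v (vl X Y x) = v ∧ j.v (vr X Y y) = v') ∨
        (j.v (vl X Y x) = v' ∧ j.v (vr X Y y) = v)) := by
  obtain ⟨a, ha⟩ := hR.exists_at v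
  obtain ⟨a', ha'⟩ := hR.exists_at v'
  wlog hlt : a < a' generalizing v v' a a'
  · have hlt' : a' < a := lt_of_le_of_ne (not_lt.1 hlt) fun h => hne (hf.at_unique ha (h ▸ ha'))
    obtain ⟨X, Y, j, x, y, h1, h2, h3, h4, h5⟩ :=
      this hne.symm (fun w => (hv w).symm) a' ha' a ha hlt'
    exact ⟨X, Y, j, x, y, h1, h2, h3, h4, h5.symm⟩
  -- The edges at each of the two vertices form an interval by `Flat.at_of_between`, and the two
  -- intervals are disjoint since no edge is incident to both vertices.
  have hall : ∀ e e', R.At v e → R.At v' e' → e < e' := by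
    intro e e' he he'
    by_contra hle
    rw [not_lt] at hle
    rcases le_or_gt e' a with h | h
    · exact hne (hf.at_unique ha (hf.at_of_between hR he' ha' h hlt.le))
    · exact hne (hf.at_unique (hf.at_of_between hR ha he h.le hle) he')
  obtain ⟨X, Y, j, h1, h2, h3, h4⟩ := exists_split (fun e => ∃ a, R.At v a ∧ e ≤ a)
    (fun e e' hle ⟨a, ha, h⟩ => ⟨a, ha, hle.trans h⟩)
    (fun e e' w he he' ⟨a, ha, h⟩ => by
      rcases hv w with rfl | rfl
      · exact ⟨e', he', le_rfl⟩
      · exact ((hall _ _ ha he).not_ge h).elim)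
  obtain ⟨hX, hY⟩ := (hR.of_iso ⟨j, h1, h2⟩).of_tensor
  have hXv : ∀ x, j.v (vl X Y x) = v := fun x => by
    obtain ⟨e, he⟩ := hX.exists_in x
    have hat : R.t (j.e (inl X Y e)) = _ := (((tensorLeft X Y).trans j).t_e e x).2 he
    obtain ⟨a, ha, hle⟩ := h3 e
    refine (hv _).resolve_right fun h => ?_
    exact (hall _ _ ha (Or.inr (hat.trans (congrArg some h)))).not_ge hle
  have hYv : ∀ x, j.v (vr X Y x) = v' := fun x => by
    obtain ⟨e, he⟩ := hY.exists_in x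
    have hat : R.t (j.e (inr X Y e)) = _ := (((tensorRight X Y).trans j).t_e e x).2 he
    refine (hv _).resolve_left fun h => ?_
    exact h4 e ⟨_, Or.inr (hat.trans (congrArg some h)), le_rfl⟩
  obtain ⟨x, hx⟩ : ∃ x, j.v (vl X Y x) = v := by
    obtain ⟨x, hx⟩ := h2 v
    induction x using vertex_cases with
    | hl x => exact ⟨x, hx⟩
    | hr y => exact (hne (hx.symm.trans (hYv y))).elim
  obtain ⟨y, hy⟩ : ∃ y, j.v (vr X Y y) = v' := by
    obtain ⟨x, hx⟩ := h2 v'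
    induction x using vertex_cases with
    | hl x => exact (hne ((hXv x).symm.trans hx)).elim
    | hr y => exact ⟨y, hx⟩
  exact ⟨X, Y, j, x, y, h1, h2, fun w => vl_inj.1 (j.inj ((hXv w).trans hx.symm)),
    fun w => vr_inj.1 (j.inj ((hYv w).trans hy.symm)), Or.inl ⟨hx, hy⟩⟩

/-- Two ways of splitting off one minimal vertex. -/
theorem Gluing.eq_or_diamond {A A' Q Q' Z : EdgeGraph L.Ob L.Mor} (hZ : Z.IsDiagram L)
    (g : Gluing A Q Z) (g' : Gluing A' Q' Z) (hA : A.size = 1) (hA' : A'.size = 1) :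
    (A.Iso A' ∧ Q.Iso Q') ∨ ∃ X Y T : EdgeGraph L.Ob L.Mor, X.IsDiagram L ∧ Y.IsDiagram L ∧
      T.IsDiagram L ∧ X.size = 1 ∧ Y.size = 1 ∧
      ((A.Iso (X.tensor (idGraph Y.inWord)) ∧ A'.Iso ((idGraph X.inWord).tensor Y) ∧
        Nonempty (Gluing ((idGraph X.outWord).tensor Y) T Q) ∧
        Nonempty (Gluing (X.tensor (idGraph Y.outWord)) T Q')) ∨
      (A'.Iso (X.tensor (idGraph Y.inWord)) ∧ A.Iso ((idGraph X.inWord).tensor Y) ∧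
        Nonempty (Gluing ((idGraph X.outWord).tensor Y) T Q') ∧
        Nonempty (Gluing (X.tensor (idGraph Y.outWord)) T Q))) := by
  obtain ⟨a, ha⟩ := size_eq_one.1 hA
  obtain ⟨a', ha'⟩ := size_eq_one.1 hA'
  have im : ∀ z, (∃ x, g.l.v x = z) ↔ g.l.v a = z := fun z =>
    ⟨fun ⟨x, hx⟩ => ha x ▸ hx, fun h => ⟨a, h⟩⟩
  have im' : ∀ z, (∃ x, g'.l.v x = z) ↔ g'.l.v a' = z := fun z =>
    ⟨fun ⟨x, hx⟩ => ha' x ▸ hx, fun h => ⟨a', h⟩⟩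
  by_cases heq : g.l.v a = g'.l.v a'
  · exact Or.inl (g.iso_of_vertices_eq g' fun z => by rw [im, im', heq])
  right
  -- The two minimal vertices together form a cut; its lower part is the graph to be split as a
  -- tensor product.
  let B : Z.V → Prop := fun z => (∃ x, g.l.v x = z) ∨ ∃ x, g'.l.v x = z
  have hB : Z.IsCut B := g.isCut.or g'.isCut
  have hR := (hB.gluing hZ).isDiagram_left hZ
  have hT := (hB.gluing hZ).isDiagram_right hZ
  let v : (Z.bot B).V := ⟨g.l.v a, Or.inl ⟨a, rfl⟩⟩
  let v' : (Z.bot B).V := ⟨g'.l.v a', Or.inr ⟨a', rfl⟩⟩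
  have hv : ∀ w : (Z.bot B).V, w = v ∨ w = v' := by
    rintro ⟨_, ⟨x, rfl⟩ | ⟨x, rfl⟩⟩
    · exact Or.inl (Subtype.ext (by rw [ha x]))
    · exact Or.inr (Subtype.ext (by rw [ha' x]))
  -- Each of the two vertices is a cut by itself, so the source of an edge ending at one of them
  -- could only be that same vertex, which would make the edge a loop.
  have hf : (Z.bot B).Flat := by
    intro e
    by_contra hn
    obtain ⟨h1, h2⟩ := not_or.1 hn
    obtain ⟨x, hx⟩ := Option.ne_none_iff_exists'.1 h1
    obtain ⟨y, hy⟩ := Option.ne_none_iff_exists'.1 h2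
    have hxy : x ≠ y := fun h => lt_irrefl _ (hR.lt_of_step e e ⟨y, hy, h ▸ hx⟩)
    have hx' := restrictVertex_eq_some.1 hx
    have hy' := restrictVertex_eq_some.1 hy
    apply hxy
    rcases hv y with rfl | rfl
    · obtain ⟨b, hb⟩ := g.isCut _ _ _ hx' hy' ⟨a, rfl⟩
      exact Subtype.ext (hb.symm.trans (by rw [ha b]))
    · obtain ⟨b, hb⟩ := g'.isCut _ _ _ hx' hy' ⟨a', rfl⟩
      exact Subtype.ext (hb.symm.trans (by rw [ha' b]))
  obtain ⟨X, Y, j, x, y, h1, h2, h3, h4, h5⟩ :=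
    exists_split_of_flat hR hf (v := v) (v' := v') (fun h => heq (congrArg Subtype.val h)) hv
  obtain ⟨hX, hY⟩ := (hR.of_iso ⟨j, h1, h2⟩).of_tensor
  let k := (hB.gluing hZ).transport j h1 h2 (Sub.refl _) Function.surjective_id
    Function.surjective_id (Sub.refl _) Function.surjective_id Function.surjective_id
  refine ⟨X, Y, _, hX, hY, hT, size_eq_one.2 ⟨x, h3⟩, size_eq_one.2 ⟨y, h4⟩, ?_⟩
  have imX : ∀ z, (∃ x, k.l.v (vl X Y x) = z) ↔ (j.v (vl X Y x)).1 = z := fun z =>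
    ⟨fun ⟨w, hw⟩ => h3 w ▸ hw, fun h => ⟨x, h⟩⟩
  have imY : ∀ z, (∃ x, k.l.v (vr X Y x) = z) ↔ (j.v (vr X Y y)).1 = z := fun z =>
    ⟨fun ⟨w, hw⟩ => h4 w ▸ hw, fun h => ⟨y, h⟩⟩
  rcases h5 with ⟨h5, h6⟩ | ⟨h5, h6⟩
  · exact Or.inl (exists_diamond hX g g' k (fun z => by rw [im, imX, h5])
      fun z => by rw [im', imY, h6])
  · exact Or.inr (exists_diamond hX g' g k (fun z => by rw [im', imX, h5])
      fun z => by rw [im, imY, h6])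

/-- Every graph with a vertex is the composite of a graph with one vertex, followed by a smaller
graph. -/
theorem IsDiagram.exists_gluing {Z : EdgeGraph L.Ob L.Mor} (hZ : Z.IsDiagram L) {n : ℕ}
    (hn : Z.size = n + 1) : ∃ A Q : EdgeGraph L.Ob L.Mor, A.IsDiagram L ∧ Q.IsDiagram L ∧
      A.size = 1 ∧ Q.size = n ∧ Nonempty (Gluing A Q Z) := by
  have hne : Nonempty Z.V := by
    by_contra h
    rw [not_nonempty_iff, ← size_eq_zero hZ] at h
    omega
  obtain ⟨v, hv⟩ := hZ.exists_cut hne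
  have g := hv.gluing hZ
  have hA := g.isDiagram_left hZ
  have hQ := g.isDiagram_right hZ
  have h1 : (Z.bot fun w => w = v).size = 1 := size_eq_one.2 ⟨⟨v, rfl⟩, fun w => Subtype.ext w.2⟩
  have := g.size_eq hA hQ
  exact ⟨_, _, hA, hQ, h1, by omega, ⟨g⟩⟩

end EdgeGraph
end TensorCalculus

namespace TensorCalculus

/-! ### Edge graphs and planar diagrams -/

open Classical in
/-- The vertex, if any, at the half-edge `h`. -/
noncomputable def RawDiagram.vertexAt {O M : Type u} {H : Type} (X : RawDiagram O M H)
    (Z : EdgeGraph O M) (ed : H → Z.E) (h : H) : Option Z.V :=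
  if X.pos h then Z.t (ed h) else Z.s (ed h)

/-- The edge graph `Z` presents the diagram `X`, where `ed h` is the edge of `h`. -/
structure RawDiagram.Presents {O M : Type u} {H : Type} (X : RawDiagram O M H) (Z : EdgeGraph O M)
    (ed : H → Z.E) : Prop where
  inj : ∀ h k, ed h = ed k → (X.pos h ↔ X.pos k) → h = k
  -- The half-edge of sign `+` is missing only for real outputs, the edges with a source and without
  -- target. In particular a virtual edge has both half-edges. The next condition is dual.
  pos_iff : ∀ e, (∃ h, ed h = e ∧ X.pos h) ↔ (Z.s e = none ∨ Z.t e ≠ none)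
  neg_iff : ∀ e, (∃ h, ed h = e ∧ ¬ X.pos h) ↔ (Z.t e = none ∨ Z.s e ≠ none)
  same : ∀ h k, X.SameEdge h k ↔ ed h = ed k
  vert : ∀ h k, X.vert h k ↔ X.vertexAt Z ed h = X.vertexAt Z ed k ∧
    (X.vertexAt Z ed h = none → ed h = ed k)
  lt : ∀ h k, X.lt h k ↔ ed h < ed k
  obj : ∀ h, X.obj h = Z.obj (ed h)
  mor : ∀ h, X.mor h = (X.vertexAt Z ed h).map Z.mor
  loopless : ∀ e v, Z.s e = some v → Z.t e ≠ some v
  surj : ∀ v, ∃ h, X.vertexAt Z ed h = some v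

namespace RawDiagram

variable {O M : Type u} {H H' : Type} {X : RawDiagram O M H} {Z : EdgeGraph O M} {ed : H → Z.E}

theorem vertexAt_pos {h : H} (hp : X.pos h) : X.vertexAt Z ed h = Z.t (ed h) := if_pos hp

theorem vertexAt_neg {h : H} (hp : ¬ X.pos h) : X.vertexAt Z ed h = Z.s (ed h) := if_neg hp

theorem vertexAt_congr {X' : RawDiagram O M H'} {ed' : H' → Z.E} {h : H} {k : H'}
    (hp : X'.pos k ↔ X.pos h) (he : ed' k = ed h) : X'.vertexAt Z ed' k = X.vertexAt Z ed h := by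
  by_cases hh : X.pos h
  · rw [vertexAt_pos hh, vertexAt_pos (hp.2 hh), he]
  · rw [vertexAt_neg hh, vertexAt_neg (mt hp.1 hh), he]

namespace Presents

theorem ed_inv (r : X.Presents Z ed) (h : H) : ed (X.inv h) = ed h :=
  ((r.same h (X.inv h)).1 (Or.inr rfl)).symm

theorem inv_eq_or (r : X.Presents Z ed) {h k : H} (he : ed h = ed k) : k = h ∨ k = X.inv h :=
  (r.same h k).2 he

theorem pos_inv (r : X.Presents Z ed) {h : H} (hne : X.inv h ≠ h) : X.pos (X.inv h) ↔ ¬ X.pos h := by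
  have := fun hp => hne (r.inj _ _ (r.ed_inv h) hp)
  tauto

theorem ed_surjective (r : X.Presents Z ed) : Function.Surjective ed := fun e => by
  by_cases h : Z.s e = none
  · exact ((r.pos_iff e).2 (Or.inl h)).imp fun _ h => h.1
  · exact ((r.neg_iff e).2 (Or.inr h)).imp fun _ h => h.1

/-- A positive half-edge looks at the target of its edge, and if the target is missing, the
half-edge exists only because the source is missing too; dually for negative ones. So a half-edge of
a real leg always sees its real vertex. -/
theorem vertexAt_eq_none (r : X.Presents Z ed) (h : H) :
    X.vertexAt Z ed h = none ↔ Z.s (ed h) = none ∧ Z.t (ed h) = none := by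
  by_cases hp : X.pos h
  · have := (r.pos_iff (ed h)).1 ⟨h, rfl, hp⟩
    rw [vertexAt_pos hp]
    tauto
  · have := (r.neg_iff (ed h)).1 ⟨h, rfl, hp⟩
    rw [vertexAt_neg hp]
    tauto

theorem inv_ne_of_virtual (r : X.Presents Z ed) {h : H}
    (hv : Z.s (ed h) = none ∧ Z.t (ed h) = none) : X.inv h ≠ h := by
  obtain ⟨k, hk, hp⟩ := (r.pos_iff (ed h)).2 (Or.inl hv.1)
  obtain ⟨l, hl, hn⟩ := (r.neg_iff (ed h)).2 (Or.inl hv.2)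
  intro he
  have h1 := r.inv_eq_or hk.symm
  have h2 := r.inv_eq_or hl.symm
  rw [he, or_self] at h1 h2
  subst h1
  exact hn (h2 ▸ hp)

theorem virtual_iff (r : X.Presents Z ed) (h : H) :
    X.Virtual h ↔ Z.s (ed h) = none ∧ Z.t (ed h) = none := by
  constructor
  · rintro ⟨hne, hv⟩
    have hp := r.pos_inv hne
    rw [r.vert] at hv
    rw [← r.vertexAt_eq_none]
    by_contra hn
    obtain ⟨v, h1⟩ := Option.ne_none_iff_exists'.1 hn
    have h2 := hv.1.symm.trans h1
    by_cases hp' : X.pos h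
    · have hn : ¬ X.pos (X.inv h) := fun h => (hp.1 h) hp'
      rw [vertexAt_pos hp'] at h1
      rw [vertexAt_neg hn, r.ed_inv] at h2
      exact r.loopless _ _ h2 h1
    · rw [vertexAt_neg hp'] at h1
      rw [vertexAt_pos (hp.2 hp'), r.ed_inv] at h2
      exact r.loopless _ _ h1 h2
  · intro h0
    refine ⟨r.inv_ne_of_virtual h0, ?_⟩
    rw [r.vert, (r.vertexAt_eq_none h).2 h0,
      (r.vertexAt_eq_none (X.inv h)).2 (by rwa [r.ed_inv])]
    exact ⟨rfl, fun _ => (r.ed_inv h).symm⟩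

theorem onVirtualVertex_iff (r : X.Presents Z ed) (h : H) :
    X.OnVirtualVertex h ↔ X.vertexAt Z ed h = none := by
  constructor
  · rintro ⟨k, hk, hv⟩
    rw [r.virtual_iff, ← r.vertexAt_eq_none] at hv
    rw [((r.vert h k).1 hk).1, hv]
  · intro h0
    exact ⟨h, (r.vert h h).2 ⟨rfl, fun _ => rfl⟩, (r.virtual_iff h).2 ((r.vertexAt_eq_none h).1 h0)⟩

theorem inv_eq_iff (r : X.Presents Z ed) (h : H) :
    X.inv h = h ↔ ∀ k, ed k = ed h → k = h := by
  constructor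
  · intro hi k hk
    have := r.inv_eq_or hk.symm
    rwa [hi, or_self] at this
  · intro hk
    exact hk _ (r.ed_inv h)

theorem leg_pos_iff (r : X.Presents Z ed) (h : H) :
    X.Leg h ∧ X.pos h ↔ X.pos h ∧ Z.s (ed h) = none := by
  constructor
  · rintro ⟨hl | hv, hp⟩
    · refine ⟨hp, ?_⟩
      by_contra hs
      obtain ⟨k, hk, hk'⟩ := (r.neg_iff (ed h)).2 (Or.inr hs)
      exact hk' ((r.inv_eq_iff h).1 hl k hk ▸ hp)
    · exact ⟨hp, ((r.virtual_iff h).1 hv).1⟩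
  · rintro ⟨hp, hs⟩
    refine ⟨?_, hp⟩
    by_cases ht : Z.t (ed h) = none
    · exact Or.inr ((r.virtual_iff h).2 ⟨hs, ht⟩)
    · refine Or.inl ((r.inv_eq_iff h).2 fun k hk => r.inj _ _ hk (iff_of_true ?_ hp))
      by_contra hn
      have := (r.neg_iff (ed h)).1 ⟨k, hk, hn⟩
      tauto

theorem leg_neg_iff (r : X.Presents Z ed) (h : H) :
    X.Leg h ∧ ¬ X.pos h ↔ ¬ X.pos h ∧ Z.t (ed h) = none := by
  constructor
  · rintro ⟨hl | hv, hp⟩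
    · refine ⟨hp, ?_⟩
      by_contra hs
      obtain ⟨k, hk, hk'⟩ := (r.pos_iff (ed h)).2 (Or.inr hs)
      exact hp ((r.inv_eq_iff h).1 hl k hk ▸ hk')
    · exact ⟨hp, ((r.virtual_iff h).1 hv).2⟩
  · rintro ⟨hp, ht⟩
    refine ⟨?_, hp⟩
    by_cases hs : Z.s (ed h) = none
    · exact Or.inr ((r.virtual_iff h).2 ⟨hs, ht⟩)
    · refine Or.inl ((r.inv_eq_iff h).2 fun k hk => r.inj _ _ hk (iff_of_false ?_ hp))
      intro hn
      have := (r.pos_iff (ed h)).1 ⟨k, hk, hn⟩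
      tauto

/-- The only difference between the two notions of step is that a virtual edge enters and leaves its
own virtual vertex. These extra steps are loops and play no role in paths between different edges.
-/
theorem step_iff (r : X.Presents Z ed) (a b : H) :
    X.Step a b ↔ Z.Step (ed a) (ed b) ∨ (X.Virtual a ∧ ed a = ed b) := by
  constructor
  · rintro ⟨h, k, h1, h2, h3, h4, h5⟩
    rw [r.same] at h1 h2
    rw [r.vert, vertexAt_pos h3, vertexAt_neg h4, ← h1, ← h2] at h5
    rcases h6 : Z.t (ed a) with _ | v
    · have := h5.2 h6
      refine Or.inr ⟨(r.virtual_iff a).2 ⟨?_, h6⟩, this⟩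
      rw [this, ← h5.1, h6]
    · exact Or.inl ⟨v, h6, h5.1.symm.trans h6⟩
  · rintro (⟨v, h1, h2⟩ | ⟨h1, h2⟩)
    · obtain ⟨h, hh, hp⟩ := (r.pos_iff (ed a)).2 (Or.inr (by simp [h1]))
      obtain ⟨k, hk, hn⟩ := (r.neg_iff (ed b)).2 (Or.inr (by simp [h2]))
      refine ⟨h, k, (r.same _ _).2 hh.symm, (r.same _ _).2 hk.symm, hp, hn, ?_⟩
      rw [r.vert, vertexAt_pos hp, vertexAt_neg hn, hh, hk, h1, h2]
      simp
    · rw [r.virtual_iff] at h1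
      obtain ⟨h, hh, hp⟩ := (r.pos_iff (ed a)).2 (Or.inl h1.1)
      obtain ⟨k, hk, hn⟩ := (r.neg_iff (ed a)).2 (Or.inl h1.2)
      refine ⟨h, k, (r.same _ _).2 hh.symm, (r.same _ _).2 (h2.symm.trans hk.symm), hp, hn, ?_⟩
      rw [r.vert, vertexAt_pos hp, vertexAt_neg hn, hh, hk, h1.1, h1.2]
      simp

theorem reach_iff (r : X.Presents Z ed) (a b : H) :
    X.Reach a b ↔ Z.Reach (ed a) (ed b) ∨ (X.Virtual a ∧ ed a = ed b) := by
  constructor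
  · intro h
    induction h with
    | single h => exact ((r.step_iff _ _).1 h).imp .single id
    | tail _ h ih =>
      rcases ih with ih | ⟨ih, ih'⟩ <;> rcases (r.step_iff _ _).1 h with h | ⟨h, h'⟩
      · exact Or.inl (.tail ih h)
      · exact Or.inl (h' ▸ ih)
      · exact Or.inl (ih' ▸ .single h)
      · exact Or.inr ⟨ih, ih'.trans h'⟩
  · rintro (h | h)
    · have key : ∀ e e', Z.Reach e e' → ∀ a b, ed a = e → ed b = e' → X.Reach a b := by
        intro e e' h
        induction h with
        | single h =>
          rintro a b rfl rfl
          exact .single ((r.step_iff _ _).2 (Or.inl h))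
        | @tail d d' _ h ih =>
          rintro a b rfl rfl
          obtain ⟨c, rfl⟩ := r.ed_surjective d
          exact .tail (ih _ _ rfl rfl) ((r.step_iff _ _).2 (Or.inl h))
      exact key _ _ h _ _ rfl rfl
    · exact .single ((r.step_iff _ _).2 (Or.inr h))

theorem map_eq_sortedList (r : X.Presents Z ed) {p : H → Prop} {p' : Z.E → Prop}
    (h : ∀ e, p' e ↔ ∃ h, p h ∧ ed h = e) {l : List H} (hl : X.IsOrderedList p l) :
    l.map ed = sortedList p' := by
  refine eq_sortedList ?_ fun e => ?_
  · rw [List.pairwise_map]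
    exact hl.2.imp fun {a b} hab => (r.lt a b).1 hab
  · simp only [List.mem_map, hl.1, h]

theorem map_obj_eq_word (r : X.Presents Z ed) {p : H → Prop} {p' : Z.E → Prop}
    (h : ∀ e, p' e ↔ ∃ h, p h ∧ ed h = e) {l : List H} (hl : X.IsOrderedList p l) :
    l.map X.obj = Z.word p' := by
  rw [EdgeGraph.word, ← r.map_eq_sortedList h hl, List.map_map]
  exact List.map_congr_left fun a _ => r.obj a

theorem isPlanar {L : Labels.{u}} {X : RawDiagram L.Ob L.Mor H} {Z : EdgeGraph L.Ob L.Mor}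
    {ed : H → Z.E} (r : X.Presents Z ed) (hZ : Z.IsDiagram L) : X.IsPlanar where
  vert_equiv := by
    refine ⟨fun h => ?_, fun {h k} => ?_, fun {h k l} => ?_⟩ <;> simp only [r.vert] <;> grind
  inv_inv h := by
    have : ed (X.inv h) = ed h := r.ed_inv h
    rcases r.inv_eq_or this with h' | h'
    · rw [← h', ← h']
    · exact h'.symm
  virtual_degree h k hv hk := by
    rw [r.same]
    exact ((r.vert h k).1 hk).2 ((r.vertexAt_eq_none h).2 ((r.virtual_iff h).1 hv))
  oriented h := r.pos_inv
  exists_in h := by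
    rcases hv : X.vertexAt Z ed h with _ | v
    · obtain ⟨k, hk, hp⟩ := (r.pos_iff (ed h)).2 (Or.inl ((r.vertexAt_eq_none h).1 hv).1)
      refine ⟨k, (r.vert h k).2 ⟨?_, fun _ => hk.symm⟩, hp⟩
      rw [hv, eq_comm, r.vertexAt_eq_none, hk, ← r.vertexAt_eq_none, hv]
    · obtain ⟨e, he⟩ := hZ.exists_in v
      obtain ⟨k, rfl, hp⟩ := (r.pos_iff e).2 (Or.inr (by simp [he]))
      refine ⟨k, (r.vert h k).2 ?_, hp⟩
      rw [hv, vertexAt_pos hp, he]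
      simp
  exists_out h := by
    rcases hv : X.vertexAt Z ed h with _ | v
    · obtain ⟨k, hk, hp⟩ := (r.neg_iff (ed h)).2 (Or.inl ((r.vertexAt_eq_none h).1 hv).2)
      refine ⟨k, (r.vert h k).2 ⟨?_, fun _ => hk.symm⟩, hp⟩
      rw [hv, eq_comm, r.vertexAt_eq_none, hk, ← r.vertexAt_eq_none, hv]
    · obtain ⟨e, he⟩ := hZ.exists_out v
      obtain ⟨k, rfl, hp⟩ := (r.neg_iff e).2 (Or.inr (by simp [he]))
      refine ⟨k, (r.vert h k).2 ?_, hp⟩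
      rw [hv, vertexAt_neg hp, he]
      simp
  lt_irrefl h k := by rw [r.lt, r.same]; exact fun h => h.ne
  lt_trans h k l := by simp only [r.lt]; exact lt_trans
  lt_total h k := by simp only [r.lt, r.same]; exact lt_or_gt_of_ne
  lt_of_reach a b := by
    rw [r.same, r.lt, r.reach_iff]
    rintro hne (h | h)
    exacts [hZ.lt_of_reach h, (hne h.2).elim]
  reach_of_between a b c := by
    simp only [r.same, r.lt, r.reach_iff]
    rintro hne (h | h) hac hcb
    · exact (hZ.between _ _ _ h hac hcb).symm.imp Or.inl Or.inl
    · exact (hne h.2).elim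

theorem isOrderedList_orderedList [Finite H] (hX : X.IsPlanar) {p : H → Prop}
    (hp : (∀ h, p h → X.pos h) ∨ ∀ h, p h → ¬ X.pos h) : X.IsOrderedList p (X.orderedList p) :=
  Classical.epsilon_spec (exists_isOrderedList hX _ fun h k hh hk he =>
    eq_of_sameEdge_of_pos_iff hX (by
      rcases hp with hp | hp
      exacts [iff_of_true (hp h hh) (hp k hk), iff_of_false (hp h hh) (hp k hk)]) he)

theorem inAt_map_obj [Finite H] (r : X.Presents Z ed) (hX : X.IsPlanar) {h : H} {v : Z.V}
    (hv : X.vertexAt Z ed h = some v) :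
    (X.inAt h).map X.obj = Z.word fun e => Z.t e = some v := by
  refine r.map_obj_eq_word (fun e => ?_) (isOrderedList_orderedList hX (Or.inl fun _ h => h.2))
  simp only [r.vert, hv]
  constructor
  · intro he
    obtain ⟨k, rfl, hp⟩ := (r.pos_iff e).2 (Or.inr (by simp [he]))
    exact ⟨k, ⟨⟨by rw [vertexAt_pos hp, he], by simp⟩, hp⟩, rfl⟩
  · rintro ⟨k, ⟨⟨h1, -⟩, hp⟩, rfl⟩
    rw [vertexAt_pos hp] at h1
    exact h1.symm

theorem outAt_map_obj [Finite H] (r : X.Presents Z ed) (hX : X.IsPlanar) {h : H} {v : Z.V}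
    (hv : X.vertexAt Z ed h = some v) :
    (X.outAt h).map X.obj = Z.word fun e => Z.s e = some v := by
  refine r.map_obj_eq_word (fun e => ?_) (isOrderedList_orderedList hX (Or.inr fun _ h => h.2))
  simp only [r.vert, hv]
  constructor
  · intro he
    obtain ⟨k, rfl, hp⟩ := (r.neg_iff e).2 (Or.inr (by simp [he]))
    exact ⟨k, ⟨⟨by rw [vertexAt_neg hp, he], by simp⟩, hp⟩, rfl⟩
  · rintro ⟨k, ⟨⟨h1, -⟩, hp⟩, rfl⟩
    rw [vertexAt_neg hp] at h1
    exact h1.symm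

theorem map_inputs [Finite H] (r : X.Presents Z ed) (hX : X.IsPlanar) :
    X.inputs.map ed = sortedList fun e => Z.s e = none := by
  refine r.map_eq_sortedList (fun e => ?_) (isOrderedList_inputs hX)
  simp only [r.leg_pos_iff]
  constructor
  · intro he
    obtain ⟨k, rfl, hp⟩ := (r.pos_iff e).2 (Or.inl he)
    exact ⟨k, ⟨hp, he⟩, rfl⟩
  · rintro ⟨k, h, rfl⟩
    exact h.2

theorem map_outputs [Finite H] (r : X.Presents Z ed) (hX : X.IsPlanar) :
    X.outputs.map ed = sortedList fun e => Z.t e = none := by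
  refine r.map_eq_sortedList (fun e => ?_) (isOrderedList_outputs hX)
  simp only [r.leg_neg_iff]
  constructor
  · intro he
    obtain ⟨k, rfl, hp⟩ := (r.neg_iff e).2 (Or.inl he)
    exact ⟨k, ⟨hp, he⟩, rfl⟩
  · rintro ⟨k, h, rfl⟩
    exact h.2

theorem dom_eq [Finite H] (r : X.Presents Z ed) (hX : X.IsPlanar) : X.dom = Z.inWord := by
  rw [dom, EdgeGraph.inWord, EdgeGraph.word, ← r.map_inputs hX, List.map_map]
  exact List.map_congr_left fun a _ => r.obj a

theorem cod_eq [Finite H] (r : X.Presents Z ed) (hX : X.IsPlanar) : X.cod = Z.outWord := by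
  rw [cod, EdgeGraph.outWord, EdgeGraph.word, ← r.map_outputs hX, List.map_map]
  exact List.map_congr_left fun a _ => r.obj a

section Labels

variable {L : Labels.{u}} {X : RawDiagram L.Ob L.Mor H} {Z : EdgeGraph L.Ob L.Mor} {ed : H → Z.E}

theorem isValuation [Finite H] (r : X.Presents Z ed) (hZ : Z.IsDiagram L) : X.IsValuation L where
  obj_inv h := by rw [r.obj, r.obj, r.ed_inv]
  mor_congr h k hk := by rw [r.mor, r.mor, ((r.vert h k).1 hk).1]
  mor_virtual h hh := by rw [r.mor, (r.onVirtualVertex_iff h).1 hh]; rfl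
  mor_real h hh := by
    rw [r.onVirtualVertex_iff] at hh
    obtain ⟨v, hv⟩ := Option.ne_none_iff_exists'.1 hh
    refine ⟨Z.mor v, by rw [r.mor, hv]; rfl, ?_, ?_⟩
    · rw [r.inAt_map_obj (r.isPlanar hZ) hv]
      exact hZ.isDom v
    · rw [r.outAt_map_obj (r.isPlanar hZ) hv]
      exact hZ.isCod v

theorem isDiagram [Finite H] (r : X.Presents Z ed) (hX : X.IsPlanar) (hX' : X.IsValuation L) :
    Z.IsDiagram L where
  exists_in v := by
    obtain ⟨h, hv⟩ := r.surj v
    obtain ⟨k, hk, hp⟩ := hX.exists_in h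
    rw [r.vert, hv, vertexAt_pos hp] at hk
    exact ⟨_, hk.1.symm⟩
  exists_out v := by
    obtain ⟨h, hv⟩ := r.surj v
    obtain ⟨k, hk, hp⟩ := hX.exists_out h
    rw [r.vert, hv, vertexAt_neg hp] at hk
    exact ⟨_, hk.1.symm⟩
  lt_of_step a b h := by
    obtain ⟨a, rfl⟩ := r.ed_surjective a
    obtain ⟨b, rfl⟩ := r.ed_surjective b
    rw [← r.lt]
    refine hX.lt_of_reach _ _ (fun he => ?_) ((r.reach_iff _ _).2 (Or.inl (.single h)))
    rw [r.same] at he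
    obtain ⟨v, h1, h2⟩ := h
    exact r.loopless _ _ (he ▸ h2) h1
  between a b c h hac hcb := by
    obtain ⟨a, rfl⟩ := r.ed_surjective a
    obtain ⟨b, rfl⟩ := r.ed_surjective b
    obtain ⟨c, rfl⟩ := r.ed_surjective c
    rcases hX.reach_of_between a b c (fun he => (hac.trans hcb).ne ((r.same _ _).1 he))
      ((r.reach_iff _ _).2 (Or.inl h)) ((r.lt _ _).2 hac) ((r.lt _ _).2 hcb) with h' | h'
    · exact Or.inr (((r.reach_iff _ _).1 h').resolve_right fun h => hcb.ne h.2)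
    · exact Or.inl (((r.reach_iff _ _).1 h').resolve_right fun h => hac.ne h.2)
  isDom v := by
    obtain ⟨h, hv⟩ := r.surj v
    obtain ⟨f, hf, h1, h2⟩ := hX'.mor_real h (by rw [r.onVirtualVertex_iff, hv]; simp)
    rw [r.mor, hv, Option.map_some, Option.some.injEq] at hf
    rw [r.inAt_map_obj hX hv] at h1
    exact hf ▸ h1
  isCod v := by
    obtain ⟨h, hv⟩ := r.surj v
    obtain ⟨f, hf, h1, h2⟩ := hX'.mor_real h (by rw [r.onVirtualVertex_iff, hv]; simp)
    rw [r.mor, hv, Option.map_some, Option.some.injEq] at hf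
    rw [r.outAt_map_obj hX hv] at h2
    exact hf ▸ h2

end Labels

/-- A half-edge is determined by its edge and its sign, and the graph tells which pairs of edge and
sign occur. Pairing half-edges with equal edge and sign gives the isomorphism. -/
theorem iso {X' : RawDiagram O M H'} {ed' : H' → Z.E} (r : X.Presents Z ed)
    (r' : X'.Presents Z ed') : X.Iso X' := by
  have ex : ∀ h, ∃ h', ed' h' = ed h ∧ (X'.pos h' ↔ X.pos h) := by
    intro h
    by_cases hp : X.pos h
    · obtain ⟨k, hk, hk'⟩ := (r'.pos_iff (ed h)).2 ((r.pos_iff (ed h)).1 ⟨h, rfl, hp⟩)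
      exact ⟨k, hk, iff_of_true hk' hp⟩
    · obtain ⟨k, hk, hk'⟩ := (r'.neg_iff (ed h)).2 ((r.neg_iff (ed h)).1 ⟨h, rfl, hp⟩)
      exact ⟨k, hk, iff_of_false hk' hp⟩
  have ex' : ∀ h, ∃ h', ed h' = ed' h ∧ (X.pos h' ↔ X'.pos h) := by
    intro h
    by_cases hp : X'.pos h
    · obtain ⟨k, hk, hk'⟩ := (r.pos_iff (ed' h)).2 ((r'.pos_iff (ed' h)).1 ⟨h, rfl, hp⟩)
      exact ⟨k, hk, iff_of_true hk' hp⟩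
    · obtain ⟨k, hk, hk'⟩ := (r.neg_iff (ed' h)).2 ((r'.neg_iff (ed' h)).1 ⟨h, rfl, hp⟩)
      exact ⟨k, hk, iff_of_false hk' hp⟩
  choose f hf hf' using ex
  choose g hg hg' using ex'
  let e : H ≃ H' := ⟨f, g,
    fun h => r.inj _ _ (by rw [hg, hf]) (by rw [hg', hf']),
    fun h => r'.inj _ _ (by rw [hf, hg]) (by rw [hf', hg'])⟩
  have he : ∀ h, ed' (e h) = ed h := hf
  have he' : ∀ h, X'.pos (e h) ↔ X.pos h := hf'
  have hv : ∀ h, X'.vertexAt Z ed' (e h) = X.vertexAt Z ed h := fun h =>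
    vertexAt_congr (he' h) (he h)
  refine ⟨e, fun h k => ?_, fun h => ?_, he', fun h k => ?_, fun h => ?_, fun h => ?_⟩
  · rw [r.vert, r'.vert, hv, hv, he, he]
  · have h1 : ed' (e (X.inv h)) = ed' (e h) := by rw [he, he, r.ed_inv]
    rcases r'.inv_eq_or h1.symm with h2 | h2
    · have h3 := e.injective h2
      rw [h3]
      refine (r'.inv_eq_iff _).2 fun k hk => ?_
      obtain ⟨k, rfl⟩ := e.surjective k
      rw [he, he] at hk
      rw [(r.inv_eq_iff h).1 h3 k hk]
    · exact h2.symm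
  · rw [r.lt, r'.lt, he, he]
  · rw [r.obj, r'.obj, he]
  · rw [r.mor, r'.mor, hv]

theorem congr_left {X' : RawDiagram O M H'} (r : X.Presents Z ed) {e : H' ≃ H}
    (he : X'.IsIso X e) : X'.Presents Z (ed ∘ e) := by
  have hv : ∀ h, X'.vertexAt Z (ed ∘ e) h = X.vertexAt Z ed (e h) := fun h =>
    vertexAt_congr (he.pos h).symm rfl
  refine ⟨fun h k h1 h2 => ?_, fun c => ?_, fun c => ?_, fun h k => ?_, fun h k => ?_, fun h k => ?_,
    fun h => ?_, fun h => ?_, r.loopless, fun v => ?_⟩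
  · exact e.injective (r.inj _ _ h1 (by rwa [he.pos, he.pos]))
  · rw [← r.pos_iff, e.surjective.exists]
    simp only [he.pos, Function.comp]
  · rw [← r.neg_iff, e.surjective.exists]
    simp only [he.pos, Function.comp]
  · rw [Function.comp, Function.comp, ← r.same, SameEdge, SameEdge, he.inv, e.injective.eq_iff,
      e.injective.eq_iff]
  · rw [hv, hv, ← he.vert, r.vert]; rfl
  · rw [← he.lt, r.lt]; rfl
  · rw [← he.obj, r.obj]; rfl
  · rw [← he.mor, r.mor, hv]
  · obtain ⟨h, hh⟩ := r.surj v
    obtain ⟨h, rfl⟩ := e.surjective h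
    exact ⟨h, by rw [hv, hh]⟩

theorem congr_right {Z' : EdgeGraph O M} (r : X.Presents Z ed) {j : EdgeGraph.Sub Z Z'}
    (hj : Function.Surjective j.e) (hj' : Function.Surjective j.v) :
    X.Presents Z' (j.e ∘ ed) := by
  have hs : ∀ a, Z'.s (j.e a) = (Z.s a).map j.v := fun a => by
    rcases h : Z.s a with _ | v
    exacts [(j.s_e_eq_none hj' a).2 h, (j.s_e a v).2 h]
  have ht : ∀ a, Z'.t (j.e a) = (Z.t a).map j.v := fun a => by
    rcases h : Z.t a with _ | v
    exacts [(j.t_e_eq_none hj' a).2 h, (j.t_e a v).2 h]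
  have hv : ∀ h, X.vertexAt Z' (j.e ∘ ed) h = (X.vertexAt Z ed h).map j.v := fun h => by
    by_cases hp : X.pos h
    · rw [vertexAt_pos hp, vertexAt_pos hp]; exact ht _
    · rw [vertexAt_neg hp, vertexAt_neg hp]; exact hs _
  have inj := j.mono.injective
  refine ⟨fun h k h1 h2 => r.inj _ _ (inj h1) h2, fun c => ?_, fun c => ?_, fun h k => ?_,
    fun h k => ?_, fun h k => ?_, fun h => ?_, fun h => ?_, fun c v => ?_, fun v => ?_⟩
  · obtain ⟨c, rfl⟩ := hj c
    rw [hs, ht, Option.map_eq_none_iff, ne_eq, Option.map_eq_none_iff, ← ne_eq, ← r.pos_iff]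
    simp only [Function.comp, inj.eq_iff]
  · obtain ⟨c, rfl⟩ := hj c
    rw [hs, ht, Option.map_eq_none_iff, ne_eq, Option.map_eq_none_iff, ← ne_eq, ← r.neg_iff]
    simp only [Function.comp, inj.eq_iff]
  · rw [r.same]; exact inj.eq_iff.symm
  · rw [hv, hv, r.vert, (Option.map_injective j.inj).eq_iff, Option.map_eq_none_iff]
    exact and_congr_right fun _ => imp_congr_right fun _ => inj.eq_iff.symm
  · rw [r.lt]; exact j.mono.lt_iff_lt.symm
  · rw [r.obj]; exact (j.obj _).symm
  · rw [r.mor, hv, Option.map_map]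
    exact congrArg (fun f => Option.map f _) (funext fun x => (j.mor x).symm)
  · obtain ⟨c, rfl⟩ := hj c
    obtain ⟨v, rfl⟩ := hj' v
    rw [j.s_e, ne_eq, j.t_e]
    exact r.loopless c v
  · obtain ⟨v, rfl⟩ := hj' v
    obtain ⟨h, hh⟩ := r.surj v
    exact ⟨h, by rw [hv, hh]; rfl⟩

/-- Edges and real vertices are related if some half-edge of the diagram belongs to both. At
half-edges on real vertices, being incident to the same vertex means equality of the vertices in
either graph, so these relations are bijective. -/
theorem graph_iso {Z' : EdgeGraph O M} {ed' : H → Z'.E} (r : X.Presents Z ed)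
    (r' : X.Presents Z' ed') : Z.Iso Z' := by
  have hsame : ∀ h k, ed h = ed k ↔ ed' h = ed' k := fun h k => by rw [← r.same, r'.same]
  have hlt : ∀ h k, ed h < ed k ↔ ed' h < ed' k := fun h k => by rw [← r.lt, r'.lt]
  have hnone : ∀ h, X.vertexAt Z ed h = none ↔ X.vertexAt Z' ed' h = none := fun h => by
    rw [← r.onVirtualVertex_iff, r'.onVirtualVertex_iff]
  have hveq : ∀ h k, (X.vertexAt Z ed h = X.vertexAt Z ed k ∧ X.vertexAt Z ed h ≠ none) ↔
      (X.vertexAt Z' ed' h = X.vertexAt Z' ed' k ∧ X.vertexAt Z' ed' h ≠ none) := fun h k => by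
    have h1 := r.vert h k
    have h2 := r'.vert h k
    have h3 := hnone h
    tauto
  have hvv : ∀ h k v v', X.vertexAt Z ed k = some v → X.vertexAt Z' ed' k = some v' →
      (X.vertexAt Z ed h = some v ↔ X.vertexAt Z' ed' h = some v') := by
    intro h k v v' hk hk'
    have := hveq k h
    rw [hk, hk'] at this
    simp only [ne_eq, reduceCtorEq, not_false_eq_true, and_true] at this
    rw [eq_comm, this, eq_comm]
  refine EdgeGraph.Iso.of_rel (fun e e' => ∃ h, ed h = e ∧ ed' h = e')
    (fun v v' => ∃ h, X.vertexAt Z ed h = some v ∧ X.vertexAt Z' ed' h = some v')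
    ?_ ?_ ?_ ?_ ?_ ?_ ?_ ?_ ?_ ?_
  · intro e
    obtain ⟨h, rfl⟩ := r.ed_surjective e
    exact ⟨_, h, rfl, rfl⟩
  · intro e
    obtain ⟨h, rfl⟩ := r'.ed_surjective e
    exact ⟨_, h, rfl, rfl⟩
  · rintro _ _ _ _ ⟨h, rfl, rfl⟩ ⟨k, rfl, rfl⟩
    rw [← not_lt, ← not_lt, hlt]
  · intro v
    obtain ⟨h, hh⟩ := r.surj v
    obtain ⟨v', hv'⟩ := Option.ne_none_iff_exists'.1
      (fun h0 => by rw [← hnone, hh] at h0; simp at h0 : X.vertexAt Z' ed' h ≠ none)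
    exact ⟨v', h, hh, hv'⟩
  · intro v
    obtain ⟨h, hh⟩ := r'.surj v
    obtain ⟨v', hv'⟩ := Option.ne_none_iff_exists'.1
      (fun h0 => by rw [hnone, hh] at h0; simp at h0 : X.vertexAt Z ed h ≠ none)
    exact ⟨v', h, hv', hh⟩
  · rintro v v' w w' ⟨h, h1, h2⟩ ⟨k, h3, h4⟩
    have := hvv h k w w' h3 h4
    rwa [h1, h2, Option.some.injEq, Option.some.injEq] at this
  · rintro _ _ v v' ⟨h, rfl, rfl⟩ ⟨k, h3, h4⟩
    constructor
    · intro he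
      obtain ⟨l, hl, hp⟩ := (r.neg_iff (ed h)).2 (Or.inr (by simp [he]))
      rw [← hl, ← vertexAt_neg (X := X) (Z := Z) (ed := ed) hp, hvv l k v v' h3 h4, vertexAt_neg hp,
        (hsame _ _).1 hl] at he
      exact he
    · intro he
      obtain ⟨l, hl, hp⟩ := (r'.neg_iff (ed' h)).2 (Or.inr (by simp [he]))
      rw [← hl, ← vertexAt_neg (X := X) (Z := Z') (ed := ed') hp, ← hvv l k v v' h3 h4,
        vertexAt_neg hp, (hsame _ _).2 hl] at he
      exact he
  · rintro _ _ v v' ⟨h, rfl, rfl⟩ ⟨k, h3, h4⟩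
    constructor
    · intro he
      obtain ⟨l, hl, hp⟩ := (r.pos_iff (ed h)).2 (Or.inr (by simp [he]))
      rw [← hl, ← vertexAt_pos (X := X) (Z := Z) (ed := ed) hp, hvv l k v v' h3 h4, vertexAt_pos hp,
        (hsame _ _).1 hl] at he
      exact he
    · intro he
      obtain ⟨l, hl, hp⟩ := (r'.pos_iff (ed' h)).2 (Or.inr (by simp [he]))
      rw [← hl, ← vertexAt_pos (X := X) (Z := Z') (ed := ed') hp, ← hvv l k v v' h3 h4,
        vertexAt_pos hp, (hsame _ _).2 hl] at he
      exact he
  · rintro _ _ ⟨h, rfl, rfl⟩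
    rw [← r.obj, r'.obj]
  · rintro v v' ⟨h, h1, h2⟩
    have h3 := r.mor h
    rw [r'.mor, h1, h2] at h3
    exact (Option.some.inj h3).symm

end Presents
end RawDiagram
end TensorCalculus

namespace TensorCalculus

/-! ### From edge graphs to planar diagrams -/

namespace EdgeGraph

variable {O M : Type u} (Z : EdgeGraph O M)

/-- `(e, b)` is a half-edge: the half-edge of sign `b` of `e`. -/
abbrev HalfEdge : Type :=
  {c : Z.E × Bool // (c.2 = true → (Z.s c.1 = none ∨ Z.t c.1 ≠ none)) ∧
    (c.2 = false → (Z.t c.1 = none ∨ Z.s c.1 ≠ none))}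

open Classical in
/-- The diagram on a set of half-edges presented by an edge graph. -/
noncomputable def toRaw {H : Type} (f : H ≃ Z.HalfEdge) : RawDiagram O M H where
  vert h k :=
    let v := fun h => if (f h).1.2 then Z.t (f h).1.1 else Z.s (f h).1.1
    v h = v k ∧ (v h = none → (f h).1.1 = (f k).1.1)
  inv h := if hk : ∃ k, (f k).1.1 = (f h).1.1 ∧ k ≠ h then hk.choose else h
  pos h := (f h).1.2 = true
  lt h k := (f h).1.1 < (f k).1.1
  obj h := Z.obj (f h).1.1
  mor h := (if (f h).1.2 then Z.t (f h).1.1 else Z.s (f h).1.1).map Z.mor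

theorem toRaw_presents {L : Labels.{u}} {Z : EdgeGraph L.Ob L.Mor} (hZ : Z.IsDiagram L) {H : Type}
    (f : H ≃ Z.HalfEdge) : (Z.toRaw f).Presents Z fun h => (f h).1.1 := by
  have hv : ∀ h, (Z.toRaw f).vertexAt Z (fun h => (f h).1.1) h =
      if (f h).1.2 then Z.t (f h).1.1 else Z.s (f h).1.1 := fun h => by
    by_cases hp : (f h).1.2 = true
    · rw [RawDiagram.vertexAt_pos (X := Z.toRaw f) hp, if_pos hp]
    · rw [RawDiagram.vertexAt_neg (X := Z.toRaw f) hp, if_neg hp]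
  have inj : ∀ h k, (f h).1.1 = (f k).1.1 → ((f h).1.2 = true ↔ (f k).1.2 = true) → h = k := by
    intro h k h1 h2
    exact f.injective (Subtype.ext (Prod.ext h1 (Bool.eq_iff_iff.2 h2)))
  have pos_iff : ∀ e, (∃ h, (f h).1.1 = e ∧ (f h).1.2 = true) ↔ (Z.s e = none ∨ Z.t e ≠ none) := by
    intro e
    constructor
    · rintro ⟨h, rfl, hp⟩
      exact (f h).2.1 hp
    · intro h
      refine ⟨f.symm ⟨(e, true), fun _ => h, by simp⟩, ?_⟩
      rw [Equiv.apply_symm_apply]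
      exact ⟨rfl, rfl⟩
  have neg_iff : ∀ e, (∃ h, (f h).1.1 = e ∧ ¬ (f h).1.2 = true) ↔
      (Z.t e = none ∨ Z.s e ≠ none) := by
    intro e
    constructor
    · rintro ⟨h, rfl, hp⟩
      exact (f h).2.2 (by simpa using hp)
    · intro h
      refine ⟨f.symm ⟨(e, false), by simp, fun _ => h⟩, ?_⟩
      rw [Equiv.apply_symm_apply]
      exact ⟨rfl, Bool.false_ne_true⟩
  refine ⟨inj, pos_iff, neg_iff, fun h k => ?_, fun h k => ?_, fun _ _ => Iff.rfl, fun _ => rfl,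
    fun h => ?_, fun e v h1 h2 => lt_irrefl _ (hZ.lt_of_step e e ⟨v, h2, h1⟩), fun v => ?_⟩
  · by_cases hk : ∃ k, (f k).1.1 = (f h).1.1 ∧ k ≠ h
    · have hi : (Z.toRaw f).inv h = hk.choose := dif_pos hk
      have hc := hk.choose_spec
      rw [RawDiagram.SameEdge, hi]
      constructor
      · rintro (rfl | h')
        exacts [rfl, h' ▸ hc.1.symm]
      · intro he
        by_contra hn
        obtain ⟨h1, h2⟩ := not_or.1 hn
        -- Of the three half-edges `h`, its partner and `k` on one edge, two have the same sign and
        -- therefore coincide.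
        have a1 := fun hp => hc.2 (inj _ _ hc.1 hp)
        have a2 := fun hp => h1 (inj _ _ he.symm hp)
        have a3 := fun hp => h2 (inj _ _ (he.symm.trans hc.1.symm) hp)
        tauto
    · have hi : (Z.toRaw f).inv h = h := dif_neg hk
      rw [RawDiagram.SameEdge, hi, or_self]
      constructor
      · rintro rfl; rfl
      · intro he
        by_contra hn
        exact hk ⟨k, he.symm, hn⟩
  · rw [hv, hv]; rfl
  · rw [hv]; rfl
  · obtain ⟨e, he⟩ := hZ.exists_in v
    obtain ⟨h, rfl, hp⟩ := (pos_iff e).2 (Or.inr (by simp [he]))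
    exact ⟨h, by rw [hv, if_pos hp, he]⟩

end EdgeGraph

/-! ### From planar diagrams to edge graphs -/

namespace RawDiagram

variable {L : Labels.{u}} {H : Type} {X : RawDiagram L.Ob L.Mor H}

/-- Representatives of the edges: the positive half-edges, and the negative ones that form
one-element edges. -/
def Rep (X : RawDiagram L.Ob L.Mor H) : Type := {h : H // X.pos h ∨ X.inv h = h}

theorem IsPlanar.rep_eq (hX : X.IsPlanar) {a b : X.Rep} (h : X.SameEdge a.1 b.1) : a = b := by
  refine Subtype.ext ?_
  rcases h with h | h
  · exact h.symm
  · by_cases hi : X.inv a.1 = a.1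
    · exact (h.trans hi).symm
    · have hp := hX.oriented _ hi
      have ha := a.2.resolve_right hi
      rw [← h] at hp hi
      rcases b.2 with hb | hb
      · exact (hp.1 hb ha).elim
      · rw [h, hX.inv_inv, ← h] at hb
        exact (hi hb.symm).elim

open Classical in
/-- The linear order on the set of edges. -/
noncomputable abbrev IsPlanar.linearOrder (hX : X.IsPlanar) : LinearOrder X.Rep :=
  letI : IsStrictTotalOrder X.Rep fun a b => X.lt a.1 b.1 :=
    { trichotomous := fun a b h h' => by
        by_contra hne
        exact (hX.lt_total a.1 b.1 fun hs => hne (hX.rep_eq hs)).elim h h'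
      irrefl := fun _ h => hX.lt_irrefl _ _ h (Or.inl rfl)
      trans := fun _ _ _ => hX.lt_trans _ _ _ }
  linearOrderOfSTO fun a b => X.lt a.1 b.1

/-- A virtual vertex has degree two, so it contains nothing but the two halves of its virtual edge.
-/
theorem IsPlanar.onVirtualVertex (hX : X.IsPlanar) {h : H} :
    X.OnVirtualVertex h ↔ X.Virtual h := by
  constructor
  · rintro ⟨k, hk, hv⟩
    rcases hX.virtual_degree k h hv (hX.vert_equiv.symm hk) with rfl | rfl
    · exact hv
    · refine ⟨by rw [hX.inv_inv]; exact hv.1.symm, ?_⟩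
      rw [hX.inv_inv]
      exact hX.vert_equiv.symm hv.2
  · exact fun hv => ⟨h, hX.vert_equiv.refl h, hv⟩

theorem IsPlanar.onVirtualVertex_congr (hX : X.IsPlanar) {h k : H} (hk : X.vert h k) :
    X.OnVirtualVertex h ↔ X.OnVirtualVertex k :=
  ⟨fun ⟨l, hl, hv⟩ => ⟨l, hX.vert_equiv.trans (hX.vert_equiv.symm hk) hl, hv⟩,
    fun ⟨l, hl, hv⟩ => ⟨l, hX.vert_equiv.trans hk hl, hv⟩⟩

/-- The equivalence relation on half-edges whose classes are the real vertices. -/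
def IsPlanar.vertexSetoid (hX : X.IsPlanar) : Setoid {h : H // ¬ X.OnVirtualVertex h} where
  r a b := X.vert a.1 b.1
  iseqv := ⟨fun _ => hX.vert_equiv.refl _, fun h => hX.vert_equiv.symm h,
    fun h h' => hX.vert_equiv.trans h h'⟩

open Classical in
/-- The real vertex of a half-edge. -/
noncomputable def IsPlanar.vertex (hX : X.IsPlanar) (h : H) : Option (Quotient hX.vertexSetoid) :=
  if hv : X.OnVirtualVertex h then none else some (Quotient.mk _ ⟨h, hv⟩)

theorem IsPlanar.vertex_eq_none (hX : X.IsPlanar) {h : H} :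
    hX.vertex h = none ↔ X.OnVirtualVertex h := by
  unfold vertex
  split_ifs with hv <;> simp [hv]

theorem IsPlanar.vertex_eq (hX : X.IsPlanar) {h k : H} (hk : X.vert h k) :
    hX.vertex h = hX.vertex k := by
  unfold vertex
  have := hX.onVirtualVertex_congr hk
  split_ifs with h1 h2 h2
  · rfl
  · exact (h2 (this.1 h1)).elim
  · exact (h1 (this.2 h2)).elim
  · exact congrArg some (Quotient.sound hk)

theorem IsPlanar.vert_of_vertex_eq (hX : X.IsPlanar) {h k : H} (hk : hX.vertex h = hX.vertex k)
    (hn : hX.vertex h ≠ none) : X.vert h k := by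
  have h1 := mt hX.vertex_eq_none.2 hn
  rw [hk] at hn
  have h2 := mt hX.vertex_eq_none.2 hn
  unfold vertex at hk
  rw [dif_neg h1, dif_neg h2, Option.some.injEq] at hk
  exact Quotient.exact hk

open Classical in
/-- The edge graph of a planar diagram. -/
noncomputable def IsPlanar.toEdgeGraph [Finite H] (hX : X.IsPlanar) (hV : X.IsValuation L) :
    EdgeGraph L.Ob L.Mor where
  E := X.Rep
  V := Quotient hX.vertexSetoid
  linE := hX.linearOrder
  finE := inferInstanceAs (Finite {_h : H // _})
  -- The source is found at the negative half-edge, which is the partner of a positive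
  -- representative; a positive half-edge without partner is an input. `vertex` is `none` at virtual
  -- vertices, so virtual edges get neither source nor target.
  s e := if X.pos e.1 then if X.inv e.1 = e.1 then none else hX.vertex (X.inv e.1)
    else hX.vertex e.1
  t e := if X.pos e.1 then hX.vertex e.1 else none
  obj e := X.obj e.1
  mor v := (hV.mor_real v.out.1 v.out.2).choose

open Classical in
/-- The edge of a half-edge. -/
noncomputable def IsPlanar.toRep (hX : X.IsPlanar) (h : H) : X.Rep :=
  if hp : X.pos h ∨ X.inv h = h then ⟨h, hp⟩ else ⟨X.inv h, Or.inl (by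
    rw [not_or] at hp
    exact (hX.oriented h hp.2).2 hp.1)⟩

theorem IsPlanar.toRep_val (hX : X.IsPlanar) (e : X.Rep) : hX.toRep e.1 = e := dif_pos e.2

theorem IsPlanar.sameEdge_toRep (hX : X.IsPlanar) (h : H) : X.SameEdge h (hX.toRep h).1 := by
  by_cases hp : X.pos h ∨ X.inv h = h
  · exact Or.inl (congrArg Subtype.val (dif_pos hp : hX.toRep h = _))
  · exact Or.inr (congrArg Subtype.val (dif_neg hp : hX.toRep h = _))

theorem IsPlanar.sameEdge_symm (hX : X.IsPlanar) {h k : H} (hs : X.SameEdge h k) :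
    X.SameEdge k h := by
  rcases hs with rfl | rfl
  exacts [Or.inl rfl, Or.inr (hX.inv_inv h).symm]

theorem IsPlanar.sameEdge_trans (hX : X.IsPlanar) {h k l : H} (hs : X.SameEdge h k)
    (hs' : X.SameEdge k l) : X.SameEdge h l := by
  rcases hs with rfl | rfl
  · exact hs'
  · rcases hs' with rfl | rfl
    exacts [Or.inr rfl, Or.inl (hX.inv_inv h)]

theorem IsPlanar.toRep_eq_iff (hX : X.IsPlanar) {h k : H} :
    hX.toRep h = hX.toRep k ↔ X.SameEdge h k := by
  constructor
  · intro he
    have := hX.sameEdge_toRep h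
    rw [he] at this
    exact hX.sameEdge_trans this (hX.sameEdge_symm (hX.sameEdge_toRep k))
  · intro hs
    exact hX.rep_eq (hX.sameEdge_trans (hX.sameEdge_symm (hX.sameEdge_toRep h))
      (hX.sameEdge_trans hs (hX.sameEdge_toRep k)))

/-- That `lt` depends only on the edges of its arguments is no axiom of `IsPlanar`; it follows from
totality between different edges, transitivity, and irreflexivity within an edge. -/
theorem IsPlanar.lt_congr (hX : X.IsPlanar) {h h' k k' : H} (hh : X.SameEdge h h')
    (hk : X.SameEdge k k') (hl : X.lt h k) : X.lt h' k' := by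
  have key : ∀ {a b c}, X.lt a b → X.SameEdge b c → X.lt a c := fun {a b c} hab hbc => by
    by_contra hn
    by_cases hac : X.SameEdge a c
    · exact hX.lt_irrefl _ _ hab (hX.sameEdge_trans hac (hX.sameEdge_symm hbc))
    · exact hX.lt_irrefl _ _ (hX.lt_trans _ _ _ ((hX.lt_total _ _ hac).resolve_left hn) hab)
        (hX.sameEdge_symm hbc)
  by_contra hn
  have h1 := key hl hk
  by_cases hac : X.SameEdge h' k'
  · exact hX.lt_irrefl _ _ h1 (hX.sameEdge_trans hh hac)
  · exact hX.lt_irrefl _ _ (hX.lt_trans _ _ _ h1 ((hX.lt_total _ _ hac).resolve_left hn)) hh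

/-- The edge of a half-edge, in the edge graph of the diagram. -/
noncomputable def IsPlanar.toEdge [Finite H] (hX : X.IsPlanar) (hV : X.IsValuation L) (h : H) :
    (hX.toEdgeGraph hV).E := hX.toRep h

theorem IsPlanar.toEdge_eq_iff [Finite H] (hX : X.IsPlanar) (hV : X.IsValuation L) {h k : H} :
    hX.toEdge hV h = hX.toEdge hV k ↔ X.SameEdge h k := hX.toRep_eq_iff

theorem IsPlanar.vertexAt_toRep [Finite H] (hX : X.IsPlanar) (hV : X.IsValuation L) (h : H) :
    X.vertexAt (hX.toEdgeGraph hV) (hX.toEdge hV) h = hX.vertex h := by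
  by_cases hp : X.pos h
  · rw [vertexAt_pos hp, show hX.toEdge hV h = (⟨h, Or.inl hp⟩ : X.Rep) from dif_pos (Or.inl hp)]
    exact if_pos hp
  · rw [vertexAt_neg hp]
    by_cases hi : X.inv h = h
    · rw [show hX.toEdge hV h = (⟨h, Or.inr hi⟩ : X.Rep) from dif_pos (Or.inr hi)]
      exact if_neg hp
    · have hp' := (hX.oriented h hi).2 hp
      rw [show hX.toEdge hV h = (⟨X.inv h, Or.inl hp'⟩ : X.Rep) from dif_neg (not_or.2 ⟨hp, hi⟩)]
      have hii := hX.inv_inv h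
      exact (if_pos hp').trans ((if_neg fun h' => hi (h'.symm.trans hii)).trans
        (congrArg hX.vertex hii))

-- Every planar diagram has an edge graph, so statements on classes of diagrams can be proved for
-- edge graphs.
open Classical in
theorem IsPlanar.presents [Finite H] (hX : X.IsPlanar) (hV : X.IsValuation L) :
    X.Presents (hX.toEdgeGraph hV) (hX.toEdge hV) where
  inj h k he hp := by
    rcases hX.toRep_eq_iff.1 he with h' | h'
    · exact h'.symm
    · by_contra hn
      rw [h'] at hp hn
      have := hX.oriented h (Ne.symm hn)
      tauto
  pos_iff e := by
    change (∃ h, hX.toRep h = e ∧ X.pos h) ↔ ((if X.pos e.1 then if X.inv e.1 = e.1 then none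
      else hX.vertex (X.inv e.1) else hX.vertex e.1) = none ∨
      (if X.pos e.1 then hX.vertex e.1 else none) ≠ none)
    constructor
    · rintro ⟨h, rfl, hp⟩
      rw [show hX.toRep h = ⟨h, Or.inl hp⟩ from dif_pos (Or.inl hp)]
      rw [if_pos hp, if_pos hp]
      by_cases hi : X.inv h = h
      · exact Or.inl (if_pos hi)
      rw [if_neg hi]
      by_cases hv : X.OnVirtualVertex h
      · refine Or.inl (hX.vertex_eq_none.2 ?_)
        rw [hX.onVirtualVertex] at hv
        exact (hX.onVirtualVertex_congr hv.2).1 (hX.onVirtualVertex.2 hv)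
      · exact Or.inr (mt hX.vertex_eq_none.1 hv)
    · intro h
      by_cases hp : X.pos e.1
      · exact ⟨e.1, hX.toRep_val e, hp⟩
      · rw [if_neg hp, if_neg hp] at h
        have := h.resolve_right (by simp)
        rw [hX.vertex_eq_none, hX.onVirtualVertex] at this
        exact (this.1 (e.2.resolve_left hp)).elim
  neg_iff e := by
    change (∃ h, hX.toRep h = e ∧ ¬ X.pos h) ↔ ((if X.pos e.1 then hX.vertex e.1 else none) = none ∨
      (if X.pos e.1 then if X.inv e.1 = e.1 then none
      else hX.vertex (X.inv e.1) else hX.vertex e.1) ≠ none)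
    by_cases hp : X.pos e.1
    · rw [if_pos hp, if_pos hp]
      by_cases hi : X.inv e.1 = e.1
      · rw [if_pos hi]
        constructor
        · rintro ⟨h, he, hn⟩
          rw [← hX.toRep_val e, hX.toRep_eq_iff] at he
          rcases hX.sameEdge_symm he with h' | h'
          · exact (hn (h' ▸ hp)).elim
          · exact (hn (by rw [h', hi]; exact hp)).elim
        · intro h
          have := h.resolve_right (by simp)
          rw [hX.vertex_eq_none, hX.onVirtualVertex] at this
          exact (this.1 hi).elim
      · rw [if_neg hi]
        refine iff_of_true ⟨X.inv e.1, ?_, ?_⟩ ?_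
        · exact (hX.toRep_eq_iff.2 (Or.inr rfl : X.SameEdge e.1 (X.inv e.1))).symm.trans
            (hX.toRep_val e)
        · rw [hX.oriented _ hi, not_not]
          exact hp
        · by_cases hv : X.OnVirtualVertex (X.inv e.1)
          · refine Or.inl (hX.vertex_eq_none.2 ?_)
            have hv' := hX.onVirtualVertex.1 hv
            have := hv'.2
            rw [hX.inv_inv] at this
            exact (hX.onVirtualVertex_congr this).1 hv
          · exact Or.inr (mt hX.vertex_eq_none.1 hv)
    · rw [if_neg hp]
      exact iff_of_true ⟨e.1, hX.toRep_val e, hp⟩ (Or.inl rfl)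
  same h k := hX.toRep_eq_iff.symm
  vert h k := by
    rw [hX.vertexAt_toRep, hX.vertexAt_toRep, hX.toEdge_eq_iff]
    constructor
    · intro hv
      refine ⟨hX.vertex_eq hv, fun h0 => ?_⟩
      exact hX.virtual_degree h k (hX.onVirtualVertex.1 (hX.vertex_eq_none.1 h0)) hv
    · rintro ⟨h1, h2⟩
      by_cases h0 : hX.vertex h = none
      · rcases h2 h0 with h' | h'
        · rw [h']
          exact hX.vert_equiv.refl h
        · rw [hX.vertex_eq_none, hX.onVirtualVertex] at h0
          rw [h']
          exact h0.2
      · exact hX.vert_of_vertex_eq h1 h0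
  lt h k := ⟨hX.lt_congr (hX.sameEdge_toRep h) (hX.sameEdge_toRep k),
    hX.lt_congr (hX.sameEdge_symm (hX.sameEdge_toRep h)) (hX.sameEdge_symm (hX.sameEdge_toRep k))⟩
  obj h := by
    change X.obj h = X.obj (hX.toRep h).1
    rcases hX.sameEdge_toRep h with h' | h'
    · rw [h']
    · rw [h', hV.obj_inv]
  mor h := by
    rw [hX.vertexAt_toRep]
    by_cases hv : X.OnVirtualVertex h
    · rw [hX.vertex_eq_none.2 hv, hV.mor_virtual h hv]
      rfl
    · have h1 : hX.vertex h = some (Quotient.mk _ ⟨h, hv⟩) := dif_neg hv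
      rw [h1]
      let v : Quotient hX.vertexSetoid := Quotient.mk _ ⟨h, hv⟩
      have h2 : X.vert v.out.1 h := Quotient.exact (Quotient.out_eq v)
      exact (hV.mor_congr _ _ h2).symm.trans (hV.mor_real v.out.1 v.out.2).choose_spec.1
  loopless e v := by
    change (if X.pos e.1 then if X.inv e.1 = e.1 then none
      else hX.vertex (X.inv e.1) else hX.vertex e.1) = some v →
      (if X.pos e.1 then hX.vertex e.1 else none) ≠ some v
    by_cases hp : X.pos e.1
    · rw [if_pos hp, if_pos hp]
      by_cases hi : X.inv e.1 = e.1
      · simp [hi]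
      · rw [if_neg hi]
        intro h1 h2
        have := hX.vert_of_vertex_eq (h2.trans h1.symm)
          fun h0 => Option.some_ne_none v (h2.symm.trans h0)
        have := hX.vertex_eq_none.2 (hX.onVirtualVertex.2 ⟨hi, this⟩)
        exact Option.some_ne_none v (h2.symm.trans this)
    · rw [if_neg hp, if_neg hp]
      exact fun _ => (Option.some_ne_none v).symm
  surj v := by
    induction v using Quotient.inductionOn with
    | _ a => exact ⟨a.1, (hX.vertexAt_toRep hV a.1).trans (dif_neg a.2)⟩

end RawDiagram
end TensorCalculus

namespace TensorCalculus

variable {O M : Type u} {H H' : Type}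

/-! ### Presentations of the operations on diagrams -/

theorem RawDiagram.Presents.identity (w : List O) :
    (RawDiagram.identity (M := M) w).Presents (EdgeGraph.idGraph w) Prod.fst := by
  have hv : ∀ h, (RawDiagram.identity (M := M) w).vertexAt (EdgeGraph.idGraph w) Prod.fst h =
    none := fun h => by unfold RawDiagram.vertexAt; split_ifs <;> rfl
  refine ⟨fun h k h1 h2 => Prod.ext h1 (Bool.eq_iff_iff.2 h2),
    fun e => iff_of_true ⟨(e, true), rfl, rfl⟩ (Or.inl rfl),
    fun e => iff_of_true ⟨(e, false), rfl, Bool.false_ne_true⟩ (Or.inl rfl), fun h k => ?_,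
    fun h k => ?_, fun _ _ => Iff.rfl, fun _ => rfl, fun h => ?_, fun _ v => v.elim,
    fun v => v.elim⟩
  · obtain ⟨h, b⟩ := h
    obtain ⟨k, c⟩ := k
    change ((k, c) = (h, b) ∨ (k, c) = (h, !b)) ↔ h = k
    simp only [Prod.mk.injEq]
    cases b <;> cases c <;> simp [eq_comm]
  · rw [hv, hv]
    exact ⟨fun h => ⟨rfl, fun _ => h⟩, fun h => h.2 rfl⟩
  · rw [hv]; rfl

/-- Change of decorations. -/
def EdgeGraph.map {O' M' : Type u} (a : O → O') (b : M → M') (Z : EdgeGraph O M) :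
    EdgeGraph O' M' where
  E := Z.E
  V := Z.V
  s := Z.s
  t := Z.t
  obj e := a (Z.obj e)
  mor v := b (Z.mor v)

theorem RawDiagram.Presents.map {O' M' : Type u} {X : RawDiagram O M H} {Z : EdgeGraph O M}
    {ed : H → Z.E} (r : X.Presents Z ed) (a : O → O') (b : M → M') :
    (X.map a b).Presents (Z.map a b) ed :=
  ⟨r.inj, r.pos_iff, r.neg_iff, r.same, r.vert, r.lt, fun h => congrArg a (r.obj h), fun h =>
    (congrArg (Option.map b) (r.mor h)).trans (Option.map_map _ _ _), r.loopless, r.surj⟩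

/-- Change of decorations of a composite. -/
def EdgeGraph.Gluing.map {O' M' : Type u} {X Y Z : EdgeGraph O M} (g : Gluing X Y Z) (a : O → O')
    (b : M → M') : Gluing (X.map a b) (Y.map a b) (Z.map a b) where
  l := ⟨g.l.e, g.l.v, g.l.mono, g.l.inj, g.l.s_iff, g.l.t_iff, fun c => congrArg a (g.l.obj c),
    fun c => congrArg b (g.l.mor c)⟩
  r := ⟨g.r.e, g.r.v, g.r.mono, g.r.inj, g.r.s_iff, g.r.t_iff, fun c => congrArg a (g.r.obj c),
    fun c => congrArg b (g.r.mor c)⟩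
  disj := g.disj
  cover := g.cover
  s_none := g.s_none
  t_none := g.t_none
  cross := g.cross

theorem EdgeGraph.map_tensor {O' M' : Type u} (X Y : EdgeGraph O M) (a : O → O') (b : M → M') :
    ((X.tensor Y).map a b).Iso ((X.map a b).tensor (Y.map a b)) :=
  ⟨⟨fun e => e, fun v => v, fun _ _ h => h, fun _ _ h => h,
    fun x e => ⟨fun h => ⟨e, h, rfl⟩, fun ⟨_, h, h'⟩ => h' ▸ h⟩,
    fun x e => ⟨fun h => ⟨e, h, rfl⟩, fun ⟨_, h, h'⟩ => h' ▸ h⟩,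
    fun c => by induction c using tensor_cases <;> rfl,
    fun c => by induction c using vertex_cases <;> rfl⟩, fun e => ⟨e, rfl⟩, fun v => ⟨v, rfl⟩⟩

open EdgeGraph in
theorem RawDiagram.Presents.tensor {X : RawDiagram O M H} {Y : RawDiagram O M H'}
    {Z W : EdgeGraph O M} {ex : H → Z.E} {ey : H' → W.E} (r : X.Presents Z ex)
    (r' : Y.Presents W ey) : (X.tensor Y).Presents (Z.tensor W)
      (Sum.elim (fun h => inl Z W (ex h)) fun h => inr Z W (ey h)) := by
  have hl : ∀ h, (X.tensor Y).vertexAt (Z.tensor W)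
      (Sum.elim (fun h => inl Z W (ex h)) fun h => inr Z W (ey h)) (.inl h) =
        (X.vertexAt Z ex h).map (vl Z W) := fun h => by
    by_cases hp : X.pos h
    · rw [vertexAt_pos hp, vertexAt_pos (show (X.tensor Y).pos (.inl h) from hp)]; rfl
    · rw [vertexAt_neg hp, vertexAt_neg (show ¬ (X.tensor Y).pos (.inl h) from hp)]; rfl
  have hr : ∀ h, (X.tensor Y).vertexAt (Z.tensor W)
      (Sum.elim (fun h => inl Z W (ex h)) fun h => inr Z W (ey h)) (.inr h) =
        (Y.vertexAt W ey h).map (vr Z W) := fun h => by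
    by_cases hp : Y.pos h
    · rw [vertexAt_pos hp, vertexAt_pos (show (X.tensor Y).pos (.inr h) from hp)]; rfl
    · rw [vertexAt_neg hp, vertexAt_neg (show ¬ (X.tensor Y).pos (.inr h) from hp)]; rfl
  have vl_inj : Function.Injective (vl Z W) := Sum.inl_injective
  have vr_inj : Function.Injective (vr Z W) := Sum.inr_injective
  refine ⟨?_, fun e => ?_, fun e => ?_, ?_, ?_, ?_, ?_, ?_, fun e => ?_, fun v => ?_⟩
  · rintro (h | h) (k | k) h1 h2
    · exact congrArg _ (r.inj _ _ (inl_inj.1 h1) h2)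
    · exact (inl_ne_inr h1).elim
    · exact (inr_ne_inl h1).elim
    · exact congrArg _ (r'.inj _ _ (inr_inj.1 h1) h2)
  · induction e using tensor_cases with
    | hl a =>
      simp only [Sum.exists, Sum.elim_inl, Sum.elim_inr, inl_inj, inr_ne_inl, false_and,
        exists_false, or_false, s_inl, t_inl, Option.map_eq_none_iff, ne_eq]
      exact r.pos_iff a
    | hr b =>
      simp only [Sum.exists, Sum.elim_inl, Sum.elim_inr, inr_inj, inl_ne_inr, false_and,
        exists_false, false_or, s_inr, t_inr, Option.map_eq_none_iff, ne_eq]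
      exact r'.pos_iff b
  · induction e using tensor_cases with
    | hl a =>
      simp only [Sum.exists, Sum.elim_inl, Sum.elim_inr, inl_inj, inr_ne_inl, false_and,
        exists_false, or_false, s_inl, t_inl, Option.map_eq_none_iff, ne_eq]
      exact r.neg_iff a
    | hr b =>
      simp only [Sum.exists, Sum.elim_inl, Sum.elim_inr, inr_inj, inl_ne_inr, false_and,
        exists_false, false_or, s_inr, t_inr, Option.map_eq_none_iff, ne_eq]
      exact r'.neg_iff b
  · rintro (h | h) (k | k)
    · rw [Sum.elim_inl, Sum.elim_inl, inl_inj, ← r.same]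
      exact or_congr Sum.inl_injective.eq_iff Sum.inl_injective.eq_iff
    · exact iff_of_false (by rintro (h | h) <;> cases h) inl_ne_inr
    · exact iff_of_false (by rintro (h | h) <;> cases h) inr_ne_inl
    · rw [Sum.elim_inr, Sum.elim_inr, inr_inj, ← r'.same]
      exact or_congr Sum.inr_injective.eq_iff Sum.inr_injective.eq_iff
  · rintro (h | h) (k | k)
    · rw [hl, hl, (Option.map_injective vl_inj).eq_iff, Option.map_eq_none_iff, Sum.elim_inl,
        Sum.elim_inl, inl_inj, ← r.vert]
      rfl
    · rw [hl, hr]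
      refine iff_of_false id ?_
      rintro ⟨h1, h2⟩
      rcases h3 : X.vertexAt Z ex h with _ | v
      · exact inl_ne_inr (h2 (by rw [h3]; rfl))
      · rw [h3, eq_comm, Option.map_some, Option.map_eq_some_iff] at h1
        obtain ⟨v, -, hv⟩ := h1
        exact vr_ne_vl hv
    · rw [hl, hr]
      refine iff_of_false id ?_
      rintro ⟨h1, h2⟩
      rcases h3 : Y.vertexAt W ey h with _ | v
      · exact inr_ne_inl (h2 (by rw [h3]; rfl))
      · rw [h3, eq_comm, Option.map_some, Option.map_eq_some_iff] at h1
        obtain ⟨v, -, hv⟩ := h1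
        exact vl_ne_vr hv
    · rw [hr, hr, (Option.map_injective vr_inj).eq_iff, Option.map_eq_none_iff, Sum.elim_inr,
        Sum.elim_inr, inr_inj, ← r'.vert]
      rfl
  · rintro (h | h) (k | k)
    · exact (r.lt h k).trans inl_lt_inl.symm
    · exact iff_of_true trivial inl_lt_inr
    · exact iff_of_false id not_inr_lt_inl
    · exact (r'.lt h k).trans inr_lt_inr.symm
  · rintro (h | h)
    exacts [r.obj h, r'.obj h]
  · rintro (h | h)
    · rw [hl, Option.map_map]; exact r.mor h
    · rw [hr, Option.map_map]; exact r'.mor h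
  · induction e using tensor_cases with
    | hl a =>
      intro v h1 h2
      rw [s_inl, Option.map_eq_some_iff] at h1
      obtain ⟨x, hx, rfl⟩ := h1
      rw [t_inl, Option.map_eq_some_iff] at h2
      obtain ⟨y, hy, hxy⟩ := h2
      exact r.loopless a x hx (vl_inj hxy ▸ hy)
    | hr a =>
      intro v h1 h2
      rw [s_inr, Option.map_eq_some_iff] at h1
      obtain ⟨x, hx, rfl⟩ := h1
      rw [t_inr, Option.map_eq_some_iff] at h2
      obtain ⟨y, hy, hxy⟩ := h2
      exact r'.loopless a x hx (vr_inj hxy ▸ hy)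
  · induction v using vertex_cases with
    | hl x =>
      obtain ⟨h, hh⟩ := r.surj x
      exact ⟨.inl h, by rw [hl, hh]; rfl⟩
    | hr x =>
      obtain ⟨h, hh⟩ := r'.surj x
      exact ⟨.inr h, by rw [hr, hh]; rfl⟩

end TensorCalculus

namespace TensorCalculus

/-! ### The presentation of a composite -/

namespace RawDiagram

variable {O M : Type u} {H H' : Type}

/-- Edge graphs presenting two planar diagrams, and a composite of these edge graphs. -/
structure CompPresentation (X : RawDiagram O M H) (Y : RawDiagram O M H') where
  A : EdgeGraph O M
  B : EdgeGraph O M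
  Z : EdgeGraph O M
  ex : H → A.E
  ey : H' → B.E
  left : X.Presents A ex
  right : Y.Presents B ey
  gluing : EdgeGraph.Gluing A B Z
  planar_left : X.IsPlanar
  planar_right : Y.IsPlanar

namespace CompPresentation

variable {X : RawDiagram O M H} {Y : RawDiagram O M H'} (c : CompPresentation X Y)

/-- The edge of a half-edge of `X`. -/
def l (h : H) : c.Z.E := c.gluing.l.e (c.ex h)

/-- The edge of a half-edge of `Y`. -/
def r (h : H') : c.Z.E := c.gluing.r.e (c.ey h)

theorem l_inj {a b : H} : c.l a = c.l b ↔ c.ex a = c.ex b := c.gluing.l.mono.injective.eq_iff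

theorem r_inj {a b : H'} : c.r a = c.r b ↔ c.ey a = c.ey b := c.gluing.r.mono.injective.eq_iff

theorem l_inv (a : H) : c.l (X.inv a) = c.l a := c.l_inj.2 (c.left.ed_inv a)

theorem r_inv (a : H') : c.r (Y.inv a) = c.r a := c.r_inj.2 (c.right.ed_inv a)

theorem t_ex {a : H} {b : H'} (h : c.l a = c.r b) : c.A.t (c.ex a) = none := c.gluing.t_eq_none h

theorem s_ey {a : H} {b : H'} (h : c.l a = c.r b) : c.B.s (c.ey b) = none := c.gluing.s_eq_none h

theorem exists_neg {a : c.A.E} {b : c.B.E} (h : c.gluing.l.e a = c.gluing.r.e b) :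
    ∃ o, c.ex o = a ∧ ¬ X.pos o := (c.left.neg_iff a).2 (Or.inl (c.gluing.t_eq_none h))

theorem exists_pos {a : c.A.E} {b : c.B.E} (h : c.gluing.l.e a = c.gluing.r.e b) :
    ∃ i, c.ey i = b ∧ Y.pos i := (c.right.pos_iff b).2 (Or.inl (c.gluing.s_eq_none h))

theorem map_outputs [Finite H] :
    X.outputs.map c.l = sortedList fun e => ∃ a b, c.gluing.l.e a = e ∧ c.gluing.r.e b = e := by
  have h := c.left.map_outputs c.planar_left
  have h' := congrArg (List.map c.gluing.l.e) h
  rw [List.map_map] at h'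
  refine h'.trans (map_sortedList c.gluing.l.mono fun e => ?_)
  constructor
  · rintro ⟨a, b, ha, hb⟩
    exact ⟨a, c.gluing.t_eq_none (ha.trans hb.symm), ha⟩
  · rintro ⟨a, ha, rfl⟩
    obtain ⟨b, hb⟩ := c.gluing.exists_r ha
    exact ⟨a, b, rfl, hb⟩

theorem map_inputs [Finite H'] :
    Y.inputs.map c.r = sortedList fun e => ∃ a b, c.gluing.l.e a = e ∧ c.gluing.r.e b = e := by
  have h := c.right.map_inputs c.planar_right
  have h' := congrArg (List.map c.gluing.r.e) h
  rw [List.map_map] at h'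
  refine h'.trans (map_sortedList c.gluing.r.mono fun e => ?_)
  constructor
  · rintro ⟨a, b, ha, hb⟩
    exact ⟨b, c.gluing.s_eq_none (ha.trans hb.symm), hb⟩
  · rintro ⟨b, hb, rfl⟩
    obtain ⟨a, ha⟩ := c.gluing.exists_l hb
    exact ⟨a, b, ha, rfl⟩

/-- The ordered outputs of `X` and the ordered inputs of `Y` have the same image in `Z`, namely the
increasing list of shared edges. Hence equal position means equal edge of `Z`, provided that the
signs are right. -/
theorem matched_iff [Finite H] [Finite H'] {o : H} {i : H'} :
    X.Matched Y o i ↔ ¬ X.pos o ∧ Y.pos i ∧ c.l o = c.r i := by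
  have h : X.outputs.map c.l = Y.inputs.map c.r := c.map_outputs.trans c.map_inputs.symm
  have ho := (isOrderedList_outputs c.planar_left).1
  have hi := (isOrderedList_inputs c.planar_right).1
  have key : ∀ k, (X.outputs[k]?).map c.l = (Y.inputs[k]?).map c.r := fun k => by
    rw [← List.getElem?_map, h, List.getElem?_map]
  constructor
  · rintro ⟨k, h1, h2⟩
    have := key k
    rw [h1, h2, Option.map_some, Option.map_some, Option.some.injEq] at this
    exact ⟨((ho o).1 (List.mem_of_getElem? h1)).2, ((hi i).1 (List.mem_of_getElem? h2)).2, this⟩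
  · rintro ⟨h1, h2, h3⟩
    have h4 := (ho o).2 ((c.left.leg_neg_iff o).2 ⟨h1, c.t_ex h3⟩)
    obtain ⟨k, hk⟩ := List.mem_iff_getElem?.1 h4
    have h5 := key k
    rw [hk, Option.map_some, eq_comm, Option.map_eq_some_iff] at h5
    obtain ⟨i', h5, h6⟩ := h5
    have h7 := ((hi i').1 (List.mem_of_getElem? h5)).2
    have h8 := c.right.inj i' i (c.r_inj.1 (h6.trans h3)) (iff_of_true h7 h2)
    exact ⟨k, hk, h8 ▸ h5⟩

/-- Only halves of virtual edges of `X` can be removed. The negative half always is; the positive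
half survives exactly if the matching input of `Y` is virtual as well, that is, if the merged edge
has no target in `Z`. -/
theorem keep_inl [Finite H] [Finite H'] {a : H} :
    X.Keep Y (.inl a) ↔ (X.Virtual a → X.pos a ∧ c.Z.t (c.l a) = none) := by
  change (¬ (X.Virtual a ∧ ¬ X.pos a) ∧
    ¬ (X.Virtual a ∧ ∃ i, X.Matched Y (X.inv a) i ∧ ¬ Y.Virtual i)) ↔ _
  by_cases hv : X.Virtual a
  swap
  · tauto
  have hv' := (c.left.virtual_iff a).1 hv
  obtain ⟨b, hb⟩ := c.gluing.exists_r hv'.2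
  have ht : c.Z.t (c.l a) = none ↔ c.B.t b = none := by
    rw [l, c.gluing.t_l hb.symm, Option.map_eq_none_iff]
  have hs := c.gluing.s_eq_none hb.symm
  simp only [hv, true_and, true_imp_iff, not_not]
  refine and_congr_right fun hp => ?_
  rw [ht]
  constructor
  · intro h
    obtain ⟨i, rfl, hi⟩ := c.exists_pos hb.symm
    by_contra hn
    refine h ⟨i, c.matched_iff.2 ⟨fun h' => (c.left.pos_inv hv.1).1 h' hp, hi, ?_⟩, fun h' => ?_⟩
    · rw [c.l_inv]; exact hb.symm
    · exact hn ((c.right.virtual_iff i).1 h').2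
  · rintro h ⟨i, hm, hi⟩
    have h1 := (c.matched_iff.1 hm).2.2
    rw [c.l_inv] at h1
    have h2 : c.ey i = b := c.gluing.r.mono.injective (h1.symm.trans hb.symm)
    exact hi ((c.right.virtual_iff i).2 (by rw [h2]; exact ⟨hs, h⟩))

theorem keep_inr [Finite H] [Finite H'] {b : H'} :
    X.Keep Y (.inr b) ↔ (Y.Virtual b → ¬ Y.pos b ∧ c.Z.s (c.r b) = none) := by
  change (¬ (Y.Virtual b ∧ Y.pos b) ∧
    ¬ (Y.Virtual b ∧ ∃ o, X.Matched Y o (Y.inv b) ∧ ¬ X.Virtual o)) ↔ _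
  by_cases hv : Y.Virtual b
  swap
  · tauto
  have hv' := (c.right.virtual_iff b).1 hv
  obtain ⟨a, ha⟩ := c.gluing.exists_l hv'.1
  have hs : c.Z.s (c.r b) = none ↔ c.A.s a = none := by
    rw [r, c.gluing.s_r ha, Option.map_eq_none_iff]
  have ht := c.gluing.t_eq_none ha
  simp only [hv, true_and, true_imp_iff]
  refine and_congr_right fun hp => ?_
  rw [hs]
  constructor
  · intro h
    obtain ⟨o, rfl, ho⟩ := c.exists_neg ha
    by_contra hn
    refine h ⟨o, c.matched_iff.2 ⟨ho, (c.right.pos_inv hv.1).2 hp, ?_⟩, fun h' => ?_⟩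
    · rw [c.r_inv]; exact ha
    · exact hn ((c.left.virtual_iff o).1 h').1
  · rintro h ⟨o, hm, ho⟩
    have h1 := (c.matched_iff.1 hm).2.2
    rw [c.r_inv] at h1
    have h2 : c.ex o = a := c.gluing.l.mono.injective (h1.trans ha.symm)
    exact ho ((c.left.virtual_iff o).2 (by rw [h2]; exact ⟨h, ht⟩))

/-- The edge of a half-edge of the composite. -/
def ed (d : {d : H ⊕ H' // X.Keep Y d}) : c.Z.E := Sum.elim c.l c.r d.1

theorem vertexAt_inl [Finite H] [Finite H'] {a : H} (h : X.Keep Y (.inl a)) :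
    (Y.comp X).vertexAt c.Z c.ed ⟨.inl a, h⟩ = (X.vertexAt c.A c.ex a).map c.gluing.l.v := by
  by_cases hp : X.pos a
  · rw [vertexAt_pos hp, vertexAt_pos (X := Y.comp X) (h := ⟨.inl a, h⟩) hp]
    rcases ht : c.A.t (c.ex a) with _ | x
    · have hs := ((c.left.pos_iff (c.ex a)).1 ⟨a, rfl, hp⟩).resolve_right (by simp [ht])
      exact (c.keep_inl.1 h ((c.left.virtual_iff a).2 ⟨hs, ht⟩)).2
    · exact (c.gluing.l.t_e _ x).2 ht
  · rw [vertexAt_neg hp, vertexAt_neg (X := Y.comp X) (h := ⟨.inl a, h⟩) hp]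
    exact c.gluing.s_l _

theorem vertexAt_inr [Finite H] [Finite H'] {b : H'} (h : X.Keep Y (.inr b)) :
    (Y.comp X).vertexAt c.Z c.ed ⟨.inr b, h⟩ = (Y.vertexAt c.B c.ey b).map c.gluing.r.v := by
  by_cases hp : Y.pos b
  · rw [vertexAt_pos hp, vertexAt_pos (X := Y.comp X) (h := ⟨.inr b, h⟩) hp]
    exact c.gluing.t_r _
  · rw [vertexAt_neg hp, vertexAt_neg (X := Y.comp X) (h := ⟨.inr b, h⟩) hp]
    rcases hs : c.B.s (c.ey b) with _ | x
    · have ht := ((c.right.neg_iff (c.ey b)).1 ⟨b, rfl, hp⟩).resolve_right (by simp [hs])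
      exact (c.keep_inr.1 h ((c.right.virtual_iff b).2 ⟨hs, ht⟩)).2
    · exact (c.gluing.r.s_e _ x).2 hs

/-- The two cases are the two ways of forming a new two-element edge: from the remaining partners of
two virtual legs, or from two real legs. In both the signs are opposite, which makes a half-edge of
the composite determined by its edge and sign. -/
theorem pos_iff_not_pos [Finite H] [Finite H'] {a : H} {b : H'} (ha : X.Keep Y (.inl a))
    (hb : X.Keep Y (.inr b)) (h : c.l a = c.r b) :
    (X.pos a ∧ ¬ Y.pos b ∧ X.Virtual a ∧ Y.Virtual b) ∨
      (¬ X.pos a ∧ Y.pos b ∧ ¬ X.Virtual a ∧ ¬ Y.Virtual b) := by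
  rw [c.keep_inl] at ha
  rw [c.keep_inr] at hb
  have ht := c.t_ex h
  have hs := c.s_ey h
  have h1 : c.Z.t (c.l a) = none ↔ c.B.t (c.ey b) = none := by
    rw [l, c.gluing.t_l h, Option.map_eq_none_iff]
  have h2 : c.Z.s (c.r b) = none ↔ c.A.s (c.ex a) = none := by
    rw [r, c.gluing.s_r h, Option.map_eq_none_iff]
  have h3 := fun hp => (c.left.pos_iff (c.ex a)).1 ⟨a, rfl, hp⟩
  have h4 := fun hp => (c.right.neg_iff (c.ey b)).1 ⟨b, rfl, hp⟩
  rw [c.left.virtual_iff] at ha ⊢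
  rw [c.right.virtual_iff] at hb ⊢
  tauto

/-- The case distinction between real and virtual legs disappears: two surviving half-edges from
different sides are joined as soon as they lie on the same edge of `Z`. -/
theorem joined_iff [Finite H] [Finite H'] {a : H} {b : H'} :
    X.Joined Y a b ↔ X.Keep Y (.inl a) ∧ X.Keep Y (.inr b) ∧ c.l a = c.r b := by
  constructor
  · rintro (⟨h1, h2, h3⟩ | ⟨h1, h2, h3⟩)
    · exact ⟨c.keep_inl.2 fun h => (h2 h).elim, c.keep_inr.2 fun h => (h3 h).elim,
        (c.matched_iff.1 h1).2.2⟩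
    · rw [c.matched_iff, c.l_inv, c.r_inv, c.left.pos_inv h1.1, c.right.pos_inv h2.1] at h3
      have h4 := (c.left.virtual_iff a).1 h1
      have h5 := (c.right.virtual_iff b).1 h2
      refine ⟨c.keep_inl.2 fun _ => ⟨not_not.1 h3.1, ?_⟩, c.keep_inr.2 fun _ => ⟨h3.2.1, ?_⟩,
        h3.2.2⟩
      · rw [l, c.gluing.t_l h3.2.2, h5.2]; rfl
      · rw [r, c.gluing.s_r h3.2.2, h4.1]; rfl
  · rintro ⟨h1, h2, h3⟩
    rcases c.pos_iff_not_pos h1 h2 h3 with ⟨h4, h5, h6, h7⟩ | ⟨h4, h5, h6, h7⟩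
    · refine Or.inr ⟨h6, h7, c.matched_iff.2 ?_⟩
      rw [c.l_inv, c.r_inv, c.left.pos_inv h6.1, c.right.pos_inv h7.1]
      exact ⟨not_not.2 h4, h5, h3⟩
    · exact Or.inl ⟨c.matched_iff.2 ⟨h4, h5, h3⟩, h6, h7⟩

theorem ed_eq_of_compInv [Finite H] [Finite H'] {d e : {d : H ⊕ H' // X.Keep Y d}}
    (h : X.CompInv Y d.1 e.1) : c.ed d = c.ed e ∧ (e = d → ∀ k, c.ed k = c.ed d → k = d) := by
  obtain ⟨a | a, ha⟩ := d <;> obtain ⟨b | b, hb⟩ := e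
  · obtain ⟨h1, rfl⟩ := h
    refine ⟨(c.l_inv a).symm, ?_⟩
    rintro h2 ⟨k | k, hk⟩ h3
    · have h4 : X.inv a = a := Sum.inl_injective (congrArg Subtype.val h2)
      have h5 := (c.left.inv_eq_iff a).1 h4 k (c.l_inj.1 h3)
      subst h5
      rfl
    · exact (h1 k (c.joined_iff.2 ⟨ha, hk, h3.symm⟩)).elim
  · exact ⟨(c.joined_iff.1 h).2.2, fun h => by cases congrArg Subtype.val h⟩
  · exact ⟨(c.joined_iff.1 h).2.2.symm, fun h => by cases congrArg Subtype.val h⟩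
  · obtain ⟨h1, rfl⟩ := h
    refine ⟨(c.r_inv a).symm, ?_⟩
    rintro h2 ⟨k | k, hk⟩ h3
    · exact (h1 k (c.joined_iff.2 ⟨hk, ha, h3⟩)).elim
    · have h4 : Y.inv a = a := Sum.inr_injective (congrArg Subtype.val h2)
      have h5 := (c.right.inv_eq_iff a).1 h4 k (c.r_inj.1 h3)
      subst h5
      rfl

/-- `comp` picks its involution by `epsilon`, so a value must exist among the surviving half-edges.
If nothing is joined to `a`, the value is its old partner. That partner survives because a surviving
half of a virtual edge always has something joined to it. -/
theorem exists_compInv [Finite H] [Finite H'] (c : CompPresentation X Y)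
    (d : {d : H ⊕ H' // X.Keep Y d}) : ∃ e : {d : H ⊕ H' // X.Keep Y d}, X.CompInv Y d.1 e.1 := by
  obtain ⟨a | b, hd⟩ := d
  · by_cases h : ∃ i, X.Joined Y a i
    · obtain ⟨i, hi⟩ := h
      exact ⟨⟨.inr i, (c.joined_iff.1 hi).2.1⟩, hi⟩
    · rw [not_exists] at h
      refine ⟨⟨.inl (X.inv a), c.keep_inl.2 fun hv => (?_ : False).elim⟩, h, rfl⟩
      rw [c.left.virtual_iff, c.left.ed_inv, ← c.left.virtual_iff] at hv
      have h1 := (c.keep_inl.1 hd hv).2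
      rw [c.left.virtual_iff] at hv
      obtain ⟨b, hb⟩ := c.gluing.exists_r hv.2
      rw [l, c.gluing.t_l hb.symm, Option.map_eq_none_iff] at h1
      obtain ⟨i, rfl, hi⟩ := (c.right.neg_iff b).2 (Or.inl h1)
      refine h i (c.joined_iff.2 ⟨hd, c.keep_inr.2 fun _ => ⟨hi, ?_⟩, hb.symm⟩)
      rw [r, c.gluing.s_r hb.symm, hv.1]; rfl
  · by_cases h : ∃ o, X.Joined Y o b
    · obtain ⟨o, ho⟩ := h
      exact ⟨⟨.inl o, (c.joined_iff.1 ho).1⟩, ho⟩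
    · rw [not_exists] at h
      refine ⟨⟨.inr (Y.inv b), c.keep_inr.2 fun hv => (?_ : False).elim⟩, h, rfl⟩
      rw [c.right.virtual_iff, c.right.ed_inv, ← c.right.virtual_iff] at hv
      have h1 := (c.keep_inr.1 hd hv).2
      rw [c.right.virtual_iff] at hv
      obtain ⟨a, ha⟩ := c.gluing.exists_l hv.1
      rw [r, c.gluing.s_r ha, Option.map_eq_none_iff] at h1
      obtain ⟨o, rfl, ho⟩ := (c.left.pos_iff a).2 (Or.inl h1)
      refine h o (c.joined_iff.2 ⟨c.keep_inl.2 fun _ => ⟨ho, ?_⟩, hd, ha⟩)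
      rw [l, c.gluing.t_l ha, hv.2]; rfl

/-- The shuffle prescribed by `CompLt` is the order of `Z`, by `Gluing.cross` in one direction and
monotonicity in the other. -/
theorem before_iff [Finite H] [Finite H'] {a : H} {b : H'} :
    X.Before Y a b ↔ c.l a ≤ c.r b := by
  constructor
  · rintro ⟨o, i, h1, h2, h3⟩
    rw [c.matched_iff] at h1
    rw [c.left.lt, c.left.same, ← le_iff_lt_or_eq] at h2
    rw [c.right.lt, c.right.same, ← le_iff_lt_or_eq] at h3
    exact (c.gluing.l.mono.monotone h2).trans (h1.2.2.le.trans (c.gluing.r.mono.monotone h3))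
  · intro h
    obtain ⟨o, i, h1, h2, h3⟩ := c.gluing.cross _ _ h
    obtain ⟨o, rfl, ho⟩ := c.exists_neg h1
    obtain ⟨i, rfl, hi⟩ := c.exists_pos h1
    refine ⟨o, i, c.matched_iff.2 ⟨ho, hi, h1⟩, ?_, ?_⟩
    · rwa [c.left.lt, c.left.same, ← le_iff_lt_or_eq]
    · rwa [c.right.lt, c.right.same, ← le_iff_lt_or_eq]

theorem sameNewEdge_iff [Finite H] [Finite H'] {a : H} {b : H'} :
    X.SameNewEdge Y a b ↔ c.l a = c.r b := by
  constructor
  · rintro ⟨o, i, h1, h2, h3⟩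
    rw [c.matched_iff] at h1
    rw [c.left.same, ← c.l_inj] at h2
    rw [c.right.same, ← c.r_inj] at h3
    exact h2.trans (h1.2.2.trans h3)
  · intro h
    obtain ⟨o, ho', ho⟩ := c.exists_neg h
    obtain ⟨i, hi', hi⟩ := c.exists_pos h
    refine ⟨o, i, c.matched_iff.2 ⟨ho, hi, ?_⟩, (c.left.same _ _).2 ho'.symm,
      (c.right.same _ _).2 hi'⟩
    rw [c.l_inj.2 ho', h, c.r_inj.2 hi']

/-- The grafting of half-edges and the gluing of edge graphs agree, so all properties of composites
proved for graphs hold for the literal composition of diagrams. -/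
theorem presents [Finite H] [Finite H'] : (Y.comp X).Presents c.Z c.ed := by
  have inj : ∀ h k, c.ed h = c.ed k → ((Y.comp X).pos h ↔ (Y.comp X).pos k) → h = k := by
    rintro ⟨a | a, ha⟩ ⟨b | b, hb⟩ h1 h2
    · exact Subtype.ext (congrArg Sum.inl (c.left.inj _ _ (c.l_inj.1 h1) h2))
    · change X.pos a ↔ Y.pos b at h2
      have := c.pos_iff_not_pos ha hb h1
      tauto
    · change Y.pos a ↔ X.pos b at h2
      have := c.pos_iff_not_pos hb ha h1.symm
      tauto
    · exact Subtype.ext (congrArg Sum.inr (c.right.inj _ _ (c.r_inj.1 h1) h2))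
  refine ⟨inj, fun e => ?_, fun e => ?_, fun h k => ?_, ?_, ?_, ?_, ?_, fun e v => ?_, fun v => ?_⟩
  · constructor
    · rintro ⟨⟨a | b, h⟩, rfl, hp⟩
      · have h1 := (c.left.pos_iff (c.ex a)).1 ⟨a, rfl, hp⟩
        rcases ht : c.A.t (c.ex a) with _ | x
        · refine Or.inl ((c.gluing.s_l (c.ex a)).trans ?_)
          rw [h1.resolve_right (by simp [ht])]; rfl
        · exact Or.inr (((c.gluing.l.t_e _ x).2 ht).trans_ne (by simp))
      · have h1 := (c.right.pos_iff (c.ey b)).1 ⟨b, rfl, hp⟩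
        refine Or.inr ((c.gluing.t_r (c.ey b)).trans_ne ?_)
        rw [ne_eq, Option.map_eq_none_iff]
        intro ht
        exact (c.keep_inr.1 h ((c.right.virtual_iff b).2
          ⟨h1.resolve_right (not_not.2 ht), ht⟩)).1 hp
    · intro h
      rcases ht : c.Z.t e with _ | z
      · obtain ⟨a, ha, rfl⟩ := (c.gluing.s_none e).1 (h.resolve_right (by simp [ht]))
        obtain ⟨a, rfl, hp⟩ := (c.left.pos_iff a).2 (Or.inl ha)
        exact ⟨⟨.inl a, c.keep_inl.2 fun _ => ⟨hp, ht⟩⟩, rfl, hp⟩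
      · rcases c.gluing.cover z with ⟨x, rfl⟩ | ⟨y, rfl⟩
        · obtain ⟨a, ha, rfl⟩ := (c.gluing.l.t_iff _ _).1 ht
          obtain ⟨a, rfl, hp⟩ := (c.left.pos_iff a).2 (Or.inr (by simp [ha]))
          refine ⟨⟨.inl a, c.keep_inl.2 fun hv => ?_⟩, rfl, hp⟩
          simp [((c.left.virtual_iff a).1 hv).2] at ha
        · obtain ⟨b, hb, rfl⟩ := (c.gluing.r.t_iff _ _).1 ht
          obtain ⟨b, rfl, hp⟩ := (c.right.pos_iff b).2 (Or.inr (by simp [hb]))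
          refine ⟨⟨.inr b, c.keep_inr.2 fun hv => ?_⟩, rfl, hp⟩
          simp [((c.right.virtual_iff b).1 hv).2] at hb
  · constructor
    · rintro ⟨⟨a | b, h⟩, rfl, hp⟩
      · have h1 := (c.left.neg_iff (c.ex a)).1 ⟨a, rfl, hp⟩
        refine Or.inr ((c.gluing.s_l (c.ex a)).trans_ne ?_)
        rw [ne_eq, Option.map_eq_none_iff]
        intro hs
        exact hp (c.keep_inl.1 h ((c.left.virtual_iff a).2
          ⟨hs, h1.resolve_right (not_not.2 hs)⟩)).1
      · have h1 := (c.right.neg_iff (c.ey b)).1 ⟨b, rfl, hp⟩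
        rcases hs : c.B.s (c.ey b) with _ | x
        · refine Or.inl ((c.gluing.t_r (c.ey b)).trans ?_)
          rw [h1.resolve_right (by simp [hs])]; rfl
        · exact Or.inr (((c.gluing.r.s_e _ x).2 hs).trans_ne (by simp))
    · intro h
      rcases hs : c.Z.s e with _ | z
      · obtain ⟨b, hb, rfl⟩ := (c.gluing.t_none e).1 (h.resolve_right (by simp [hs]))
        obtain ⟨b, rfl, hp⟩ := (c.right.neg_iff b).2 (Or.inl hb)
        exact ⟨⟨.inr b, c.keep_inr.2 fun _ => ⟨hp, hs⟩⟩, rfl, hp⟩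
      · rcases c.gluing.cover z with ⟨x, rfl⟩ | ⟨y, rfl⟩
        · obtain ⟨a, ha, rfl⟩ := (c.gluing.l.s_iff _ _).1 hs
          obtain ⟨a, rfl, hp⟩ := (c.left.neg_iff a).2 (Or.inr (by simp [ha]))
          refine ⟨⟨.inl a, c.keep_inl.2 fun hv => ?_⟩, rfl, hp⟩
          simp [((c.left.virtual_iff a).1 hv).1] at ha
        · obtain ⟨b, hb, rfl⟩ := (c.gluing.r.s_iff _ _).1 hs
          obtain ⟨b, rfl, hp⟩ := (c.right.neg_iff b).2 (Or.inr (by simp [hb]))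
          refine ⟨⟨.inr b, c.keep_inr.2 fun hv => ?_⟩, rfl, hp⟩
          simp [((c.right.virtual_iff b).1 hv).1] at hb
  · have hi : X.CompInv Y h.1 ((Y.comp X).inv h).1 := Classical.epsilon_spec (c.exists_compInv h)
    obtain ⟨h1, h2⟩ := c.ed_eq_of_compInv hi
    constructor
    · rintro (rfl | rfl)
      exacts [rfl, h1]
    · intro he
      by_contra hn
      obtain ⟨h3, h4⟩ := not_or.1 hn
      have h5 := fun hp => h3 (inj _ _ he.symm hp)
      have h6 := fun hp => h4 (inj _ _ (he.symm.trans h1) hp)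
      have h7 := fun hp => h3 (h2 (inj _ _ h1.symm hp) k he.symm)
      tauto
  · have key : ∀ {a b} (ha : X.Keep Y (.inl a)) (hb : X.Keep Y (.inr b)), X.Fused Y a b ↔
        (X.vertexAt c.A c.ex a).map c.gluing.l.v = (Y.vertexAt c.B c.ey b).map c.gluing.r.v ∧
          (X.vertexAt c.A c.ex a = none → c.l a = c.r b) := by
      intro a b ha hb
      constructor
      · rintro h
        have h1 := (c.joined_iff.1 (Or.inr h)).2.2
        rw [(c.left.vertexAt_eq_none a).2 ((c.left.virtual_iff a).1 h.1),
          (c.right.vertexAt_eq_none b).2 ((c.right.virtual_iff b).1 h.2.1)]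
        exact ⟨rfl, fun _ => h1⟩
      · rintro ⟨h1, h2⟩
        rcases h3 : X.vertexAt c.A c.ex a with _ | x
        · have h4 := h2 h3
          have h5 := (c.left.virtual_iff a).2 ((c.left.vertexAt_eq_none a).1 h3)
          rcases c.joined_iff.2 ⟨ha, hb, h4⟩ with h6 | h6
          exacts [(h6.2.1 h5).elim, h6]
        · rw [h3, Option.map_some, eq_comm, Option.map_eq_some_iff] at h1
          obtain ⟨y, -, hy⟩ := h1
          exact (c.gluing.disj _ _ hy.symm).elim
    rintro ⟨a | a, ha⟩ ⟨b | b, hb⟩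
    · rw [c.vertexAt_inl ha, c.vertexAt_inl hb, (Option.map_injective c.gluing.l.inj).eq_iff,
        Option.map_eq_none_iff]
      exact (c.left.vert a b).trans (and_congr_right fun _ => imp_congr_right fun _ => c.l_inj.symm)
    · rw [c.vertexAt_inl ha, c.vertexAt_inr hb, Option.map_eq_none_iff]
      exact key ha hb
    · rw [c.vertexAt_inr ha, c.vertexAt_inl hb]
      refine (key hb ha).trans ?_
      rw [eq_comm, eq_comm (a := c.ed _)]
      refine and_congr_right fun h => imp_congr_left ?_
      rw [h, Option.map_eq_none_iff]
    · rw [c.vertexAt_inr ha, c.vertexAt_inr hb, (Option.map_injective c.gluing.r.inj).eq_iff,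
        Option.map_eq_none_iff]
      exact (c.right.vert a b).trans
        (and_congr_right fun _ => imp_congr_right fun _ => c.r_inj.symm)
  · rintro ⟨a | a, ha⟩ ⟨b | b, hb⟩
    · exact (c.left.lt a b).trans c.gluing.l.mono.lt_iff_lt.symm
    · refine (and_congr c.before_iff (not_congr c.sameNewEdge_iff)).trans ?_
      exact lt_iff_le_and_ne.symm
    · exact (not_congr c.before_iff).trans not_le
    · exact (c.right.lt a b).trans c.gluing.r.mono.lt_iff_lt.symm
  · rintro ⟨a | a, ha⟩
    · exact (c.left.obj a).trans (c.gluing.l.obj _).symm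
    · exact (c.right.obj a).trans (c.gluing.r.obj _).symm
  · rintro ⟨a | a, ha⟩
    · rw [c.vertexAt_inl ha, Option.map_map]
      exact (c.left.mor a).trans (congrArg (fun f => Option.map f _)
        (funext fun x => (c.gluing.l.mor x).symm))
    · rw [c.vertexAt_inr ha, Option.map_map]
      exact (c.right.mor a).trans (congrArg (fun f => Option.map f _)
        (funext fun x => (c.gluing.r.mor x).symm))
  · intro h1 h2
    rcases c.gluing.cover v with ⟨x, rfl⟩ | ⟨y, rfl⟩
    · obtain ⟨a, ha, rfl⟩ := (c.gluing.l.s_iff _ _).1 h1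
      exact c.left.loopless a x ha ((c.gluing.l.t_e a x).1 h2)
    · obtain ⟨b, hb, rfl⟩ := (c.gluing.r.s_iff _ _).1 h1
      exact c.right.loopless b y hb ((c.gluing.r.t_e b y).1 h2)
  · rcases c.gluing.cover v with ⟨x, rfl⟩ | ⟨y, rfl⟩
    · obtain ⟨a, ha⟩ := c.left.surj x
      refine ⟨⟨.inl a, c.keep_inl.2 fun hv => ?_⟩, by rw [c.vertexAt_inl, ha]; rfl⟩
      rw [c.left.virtual_iff, ← c.left.vertexAt_eq_none, ha] at hv
      simp at hv
    · obtain ⟨b, hb⟩ := c.right.surj y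
      refine ⟨⟨.inr b, c.keep_inr.2 fun hv => ?_⟩, by rw [c.vertexAt_inr, hb]; rfl⟩
      rw [c.right.virtual_iff, ← c.right.vertexAt_eq_none, hb] at hv
      simp at hv

end CompPresentation
end RawDiagram
end TensorCalculus

namespace TensorCalculus

/-! ### The strict tensor category of diagrams -/

open EdgeGraph

variable {L L' : Labels.{u}}

theorem EdgeGraph.IsDiagram.exists_output_le {Z : EdgeGraph L.Ob L.Mor} (hZ : Z.IsDiagram L)
    (a : Z.E) : ∃ o, Z.t o = none ∧ a ≤ o := by
  obtain ⟨o, h1, h2⟩ := hZ.exists_output a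
  exact ⟨o, h1, h2.elim (fun h => h.le) fun h => (hZ.lt_of_reach h).le⟩

theorem EdgeGraph.isDiagram_idGraph (w : List L.Ob) : (idGraph (M := L.Mor) w).IsDiagram L :=
  isDiagram_of_isEmpty inferInstance

theorem EdgeGraph.inWord_map {O M O' M' : Type u} (a : O → O') (b : M → M') (Z : EdgeGraph O M) :
    (Z.map a b).inWord = Z.inWord.map a := by
  rw [inWord, inWord, word, word, List.map_map]
  rfl

namespace Diag

/-- The edge graph `Z` presents the class `q`. -/
def HasGraph (q : Diag L) (Z : EdgeGraph L.Ob L.Mor) : Prop :=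
  ∃ X : Diagram L, mk X = q ∧ ∃ ed, X.raw.Presents Z ed

theorem exists_graph (q : Diag L) : ∃ Z, q.HasGraph Z := by
  obtain ⟨X, rfl⟩ := Quotient.exists_rep q
  exact ⟨_, X, rfl, _, X.planar.presents X.valuation⟩

namespace HasGraph

variable {p q q' : Diag L} {Z Z' W : EdgeGraph L.Ob L.Mor}

theorem isDiagram (h : q.HasGraph Z) : Z.IsDiagram L := by
  obtain ⟨X, -, ed, r⟩ := h
  exact r.isDiagram X.planar X.valuation

theorem dom_eq (h : q.HasGraph Z) : q.dom = Z.inWord := by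
  obtain ⟨X, rfl, ed, r⟩ := h
  exact r.dom_eq X.planar

theorem cod_eq (h : q.HasGraph Z) : q.cod = Z.outWord := by
  obtain ⟨X, rfl, ed, r⟩ := h
  exact r.cod_eq X.planar

theorem iso (h : q.HasGraph Z) (h' : q.HasGraph Z') : Z.Iso Z' := by
  obtain ⟨X, rfl, ed, r⟩ := h
  obtain ⟨X', hX, ed', r'⟩ := h'
  obtain ⟨e, he⟩ : X.raw.Iso X'.raw := Quotient.exact hX.symm
  exact r.graph_iso (r'.congr_left he)

theorem of_iso (h : q.HasGraph Z) (hZ : Z.Iso Z') : q.HasGraph Z' := by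
  obtain ⟨X, rfl, ed, r⟩ := h
  obtain ⟨j, h1, h2⟩ := hZ
  exact ⟨X, rfl, _, r.congr_right h1 h2⟩

theorem eq (h : q.HasGraph Z) (h' : q'.HasGraph Z) : q = q' := by
  obtain ⟨X, rfl, ed, r⟩ := h
  obtain ⟨X', rfl, ed', r'⟩ := h'
  exact Quotient.sound (r.iso r')

/-- All identities between classes of diagrams are reduced to isomorphisms of edge graphs through
this lemma. -/
theorem eq_of_iso (h : q.HasGraph Z) (h' : q'.HasGraph Z') (hZ : Z.Iso Z') : q = q' :=
  (h.of_iso hZ).eq h'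

theorem map (h : q.HasGraph Z) (φ : L.Hom L') : (q.map φ).HasGraph (Z.map φ.o φ.m) := by
  obtain ⟨X, rfl, ed, r⟩ := h
  exact ⟨X.map φ, rfl, ed, r.map φ.o φ.m⟩

/-- The operations produce diagrams on sums and subtypes of half-edges, whereas a class consists of
diagrams on some `Fin n`. A common presentation bridges the two. -/
theorem exists_diagram {H : Type} {X : RawDiagram L.Ob L.Mor H} {ed : H → Z.E}
    (h : q.HasGraph Z) (r : X.Presents Z ed) : ∃ D : Diagram L, D.raw.Iso X ∧ q = mk D := by
  obtain ⟨D, rfl, ed', r'⟩ := h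
  exact ⟨D, r'.iso r, rfl⟩

end HasGraph

/-- The class of diagrams presented by an edge graph. -/
noncomputable def ofGraph (Z : EdgeGraph L.Ob L.Mor) (hZ : Z.IsDiagram L) : Diag L :=
  have r := toRaw_presents hZ (Finite.equivFin Z.HalfEdge).symm
  mk ⟨_, _, r.isPlanar hZ, r.isValuation hZ⟩

theorem hasGraph_ofGraph {Z : EdgeGraph L.Ob L.Mor} (hZ : Z.IsDiagram L) :
    (ofGraph Z hZ).HasGraph Z :=
  ⟨_, rfl, _, toRaw_presents hZ (Finite.equivFin Z.HalfEdge).symm⟩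

/-- A graph presenting a class of diagrams. -/
noncomputable def graph (q : Diag L) : EdgeGraph L.Ob L.Mor := q.exists_graph.choose

theorem hasGraph (q : Diag L) : q.HasGraph q.graph := q.exists_graph.choose_spec

/-- The identity of a word. -/
noncomputable def id (w : List L.Ob) : Diag L := ofGraph _ (isDiagram_idGraph w)

theorem hasGraph_id (w : List L.Ob) : (id w).HasGraph (idGraph w) :=
  hasGraph_ofGraph (isDiagram_idGraph w)

/-- The tensor product. -/
noncomputable def tensor (p q : Diag L) : Diag L :=
  ofGraph _ (p.hasGraph.isDiagram.tensor q.hasGraph.isDiagram)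

theorem exists_gluing (g f : Diag L) (h : f.cod = g.dom) :
    ∃ Z : {Z : EdgeGraph L.Ob L.Mor // Z.IsDiagram L}, Nonempty (Gluing f.graph g.graph Z.1) := by
  obtain ⟨Z, ⟨k⟩⟩ := Gluing.exists_gluing
    (f.hasGraph.cod_eq.symm.trans (h.trans g.hasGraph.dom_eq))
  exact ⟨⟨Z, k.isDiagram f.hasGraph.isDiagram g.hasGraph.isDiagram⟩, ⟨k⟩⟩

/-- The composite. -/
noncomputable def comp (g f : Diag L) (h : f.cod = g.dom) : Diag L :=
  ofGraph _ (exists_gluing g f h).choose.2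

namespace HasGraph

variable {p q f g : Diag L} {X Y Z W : EdgeGraph L.Ob L.Mor}

theorem tensor (hp : p.HasGraph X) (hq : q.HasGraph Y) : (p.tensor q).HasGraph (X.tensor Y) :=
  (hasGraph_ofGraph _).of_iso ((p.hasGraph.iso hp).tensor (q.hasGraph.iso hq))

theorem comp (hf : f.HasGraph X) (hg : g.HasGraph Y) (k : Gluing X Y Z) (h : f.cod = g.dom) :
    (comp g f h).HasGraph Z := by
  obtain ⟨k'⟩ := (exists_gluing g f h).choose_spec
  obtain ⟨k''⟩ := k'.of_iso (hf.iso f.hasGraph) (hg.iso g.hasGraph) (.refl _)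
  exact (hasGraph_ofGraph _).of_iso (k''.unique k)

theorem cod_eq_dom (hf : f.HasGraph X) (hg : g.HasGraph Y) (k : Gluing X Y Z) : f.cod = g.dom := by
  rw [hf.cod_eq, hg.dom_eq, k.outWord_eq_inWord]

theorem exists_comp (hf : f.HasGraph X) (hg : g.HasGraph Y) (h : f.cod = g.dom) :
    ∃ Z, Nonempty (Gluing X Y Z) ∧ (Diag.comp g f h).HasGraph Z := by
  obtain ⟨Z, ⟨k⟩⟩ := Gluing.exists_gluing (hf.cod_eq.symm.trans (h.trans hg.dom_eq))
  exact ⟨Z, ⟨k⟩, hf.comp hg k h⟩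

theorem eq_id (hq : q.HasGraph Z) (hZ : IsEmpty Z.V) : q = Diag.id Z.inWord :=
  hq.eq_of_iso (hasGraph_id _) (iso_of_isEmpty hZ inferInstance (inWord_idGraph _).symm)

theorem id_of_isEmpty (hZ : IsEmpty Z.V) : (Diag.id Z.inWord).HasGraph Z :=
  (hasGraph_id _).of_iso (iso_of_isEmpty inferInstance hZ (inWord_idGraph _))

end HasGraph

theorem dom_id (w : List L.Ob) : (id w).dom = w :=
  (hasGraph_id w).dom_eq.trans (inWord_idGraph w)

theorem cod_id (w : List L.Ob) : (id w).cod = w :=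
  (hasGraph_id w).cod_eq.trans (outWord_idGraph w)

theorem dom_tensor (p q : Diag L) : (p.tensor q).dom = p.dom ++ q.dom := by
  rw [(p.hasGraph.tensor q.hasGraph).dom_eq, p.hasGraph.dom_eq, q.hasGraph.dom_eq, inWord_tensor]

theorem cod_tensor (p q : Diag L) : (p.tensor q).cod = p.cod ++ q.cod := by
  rw [(p.hasGraph.tensor q.hasGraph).cod_eq, p.hasGraph.cod_eq, q.hasGraph.cod_eq, outWord_tensor]

theorem dom_comp (g f : Diag L) (h : f.cod = g.dom) : (comp g f h).dom = f.dom := by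
  obtain ⟨Z, ⟨k⟩, hZ⟩ := f.hasGraph.exists_comp g.hasGraph h
  rw [hZ.dom_eq, f.hasGraph.dom_eq, k.inWord_eq]

theorem cod_comp (g f : Diag L) (h : f.cod = g.dom) : (comp g f h).cod = g.cod := by
  obtain ⟨Z, ⟨k⟩, hZ⟩ := f.hasGraph.exists_comp g.hasGraph h
  rw [hZ.cod_eq, g.hasGraph.cod_eq, k.outWord_eq]

variable (L) in
/-- The strict tensor category of planar diagrams. -/
noncomputable def str : StrictTensorStructure (List L.Ob) (Diag L) dom cod where
  id := id
  comp := comp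
  unit := []
  tensorOb v w := v ++ w
  tensorMor := tensor
  src_id := dom_id
  tgt_id := cod_id
  src_comp := dom_comp
  tgt_comp := cod_comp
  id_comp f h := by
    obtain ⟨k⟩ := Gluing.exists_of_isEmpty_right (I := idGraph f.cod) (X := f.graph) inferInstance
      (by rw [inWord_idGraph, f.hasGraph.cod_eq])
    exact (f.hasGraph.comp (hasGraph_id _) k h).eq f.hasGraph
  comp_id f h := by
    obtain ⟨k⟩ := Gluing.exists_of_isEmpty_left (I := idGraph f.dom) (X := f.graph) inferInstance
      (by rw [outWord_idGraph, f.hasGraph.dom_eq])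
    exact ((hasGraph_id _).comp f.hasGraph k h).eq f.hasGraph
  comp_assoc k g f hgf hkg := by
    obtain ⟨P, ⟨a⟩, hP⟩ := f.hasGraph.exists_comp g.hasGraph hgf
    obtain ⟨Q, ⟨b⟩, hQ⟩ := g.hasGraph.exists_comp k.hasGraph hkg
    obtain ⟨W, ⟨c⟩, hW⟩ := hP.exists_comp k.hasGraph ((cod_comp g f hgf).trans hkg)
    obtain ⟨W', ⟨d⟩, hW'⟩ := f.hasGraph.exists_comp hQ (hgf.trans (dom_comp k g hkg).symm)
    exact hW.eq_of_iso hW' (a.assoc c b d)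
  src_tensor := dom_tensor
  tgt_tensor := cod_tensor
  tensor_id x y := ((hasGraph_id x).tensor (hasGraph_id y)).eq_of_iso (hasGraph_id _)
    (iso_of_isEmpty (inferInstanceAs (IsEmpty (Empty ⊕ Empty))) inferInstance
      (by simp only [inWord_tensor, inWord_idGraph]))
  interchange g f g' f' h h' := by
    obtain ⟨P, ⟨a⟩, hP⟩ := f.hasGraph.exists_comp g.hasGraph h
    obtain ⟨Q, ⟨b⟩, hQ⟩ := f'.hasGraph.exists_comp g'.hasGraph h'
    exact (hP.tensor hQ).eq ((f.hasGraph.tensor f'.hasGraph).comp (g.hasGraph.tensor g'.hasGraph)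
      (a.tensor b f.hasGraph.isDiagram.exists_output_le) _)
  tensorOb_assoc := List.append_assoc
  unit_tensorOb := List.nil_append
  tensorOb_unit := List.append_nil
  tensorMor_assoc f g k := ((f.hasGraph.tensor g.hasGraph).tensor k.hasGraph).eq_of_iso
    (f.hasGraph.tensor (g.hasGraph.tensor k.hasGraph)) (tensor_assoc _ _ _)
  unit_tensorMor f := ((hasGraph_id []).tensor f.hasGraph).eq_of_iso f.hasGraph
    (tensor_iso_right _ (isEmpty_E_of_inWord inferInstance (inWord_idGraph _)) inferInstance)
  tensorMor_unit f := (f.hasGraph.tensor (hasGraph_id [])).eq_of_iso f.hasGraph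
    (tensor_iso_left _ (isEmpty_E_of_inWord inferInstance (inWord_idGraph _)) inferInstance)

theorem isStrictTensorFunctor_map (φ : L.Hom L') :
    IsStrictTensorFunctor (str L) (str L') (List.map φ.o) (Diag.map φ) where
  src_map f := f.dom_map φ
  tgt_map f := f.cod_map φ
  map_id w := ((hasGraph_id w).map φ).eq_of_iso (hasGraph_id _)
    (iso_of_isEmpty (inferInstanceAs (IsEmpty Empty)) inferInstance
      (by rw [inWord_map, inWord_idGraph, inWord_idGraph]))
  map_comp g f h := by
    obtain ⟨P, ⟨a⟩, hP⟩ := f.hasGraph.exists_comp g.hasGraph h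
    exact (hP.map φ).eq ((f.hasGraph.map φ).comp (g.hasGraph.map φ) (a.map φ.o φ.m)
      ((f.cod_map φ).trans ((congrArg (List.map φ.o) h).trans (g.dom_map φ).symm)))
  map_unit := rfl
  map_tensorOb v w := List.map_append
  map_tensorMor f g := ((f.hasGraph.tensor g.hasGraph).map φ).eq_of_iso
    ((f.hasGraph.map φ).tensor (g.hasGraph.map φ)) (map_tensor _ _ _ _)

end Diag

/-- The operations of `Diag.str` are defined through edge graphs. The literal operations on
half-edges are presented by the corresponding graphs, hence give the same classes. -/
theorem isDiagrammatic (D : TSch.{u}) : IsDiagrammatic D (Diag.str D.labels) where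
  unit_eq := rfl
  tensorOb_eq _ _ := rfl
  id_eq w := (Diag.hasGraph_id (L := D.labels) w).exists_diagram
    (RawDiagram.Presents.identity (M := D.Mor) w)
  tensorMor_eq X Y := by
    have hX : (Diag.mk X).HasGraph _ := ⟨X, rfl, _, X.planar.presents X.valuation⟩
    have hY : (Diag.mk Y).HasGraph _ := ⟨Y, rfl, _, Y.planar.presents Y.valuation⟩
    exact (hX.tensor hY).exists_diagram
      ((X.planar.presents X.valuation).tensor (Y.planar.presents Y.valuation))
  comp_eq Y X h := by
    have hX : (Diag.mk X).HasGraph _ := ⟨X, rfl, _, X.planar.presents X.valuation⟩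
    have hY : (Diag.mk Y).HasGraph _ := ⟨Y, rfl, _, Y.planar.presents Y.valuation⟩
    obtain ⟨Z, ⟨k⟩, hZ⟩ := hX.exists_comp hY h
    let c : RawDiagram.CompPresentation X.raw Y.raw :=
      ⟨_, _, _, _, _, X.planar.presents X.valuation, Y.planar.presents Y.valuation, k, X.planar,
        Y.planar⟩
    exact hZ.exists_diagram c.presents

end TensorCalculus

namespace TensorCalculus

/-! ### Decomposition of classes of diagrams -/

open EdgeGraph

namespace Diag

variable {L L' : Labels.{u}}

theorem id_comp (f : Diag L) (h : f.cod = (id f.cod).dom) : comp (id f.cod) f h = f :=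
  (str L).id_comp f h

theorem comp_id (f : Diag L) (h : (id f.dom).cod = f.dom) : comp f (id f.dom) h = f :=
  (str L).comp_id f h

theorem comp_assoc (k g f : Diag L) (hgf : f.cod = g.dom) (hkg : g.cod = k.dom) :
    comp k (comp g f hgf) ((cod_comp g f hgf).trans hkg) =
      comp (comp k g hkg) f (hgf.trans (dom_comp k g hkg).symm) :=
  (str L).comp_assoc k g f hgf hkg

theorem tensor_comp (g f g' f' : Diag L) (h : f.cod = g.dom) (h' : f'.cod = g'.dom) :
    tensor (comp g f h) (comp g' f' h') = comp (tensor g g') (tensor f f')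
      (by rw [cod_tensor, dom_tensor, h, h']) :=
  (str L).interchange g f g' f' h h'

theorem tensor_id (v w : List L.Ob) : tensor (id v) (id w) = id (v ++ w) :=
  (str L).tensor_id v w

theorem tensor_assoc (f g k : Diag L) : tensor (tensor f g) k = tensor f (tensor g k) :=
  (str L).tensorMor_assoc f g k

theorem id_nil_tensor (f : Diag L) : tensor (id []) f = f := (str L).unit_tensorMor f

theorem tensor_id_nil (f : Diag L) : tensor f (id []) = f := (str L).tensorMor_unit f

/-- The number of real vertices. -/
noncomputable def size (q : Diag L) : ℕ := q.graph.size

theorem HasGraph.size_eq {q : Diag L} {Z : EdgeGraph L.Ob L.Mor} (h : q.HasGraph Z) :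
    q.size = Z.size := (q.hasGraph.iso h).size_eq

theorem size_comp (g f : Diag L) (h : f.cod = g.dom) : (comp g f h).size = f.size + g.size := by
  obtain ⟨Z, ⟨k⟩, hZ⟩ := f.hasGraph.exists_comp g.hasGraph h
  rw [hZ.size_eq, k.size_eq f.hasGraph.isDiagram g.hasGraph.isDiagram, f.hasGraph.size_eq,
    g.hasGraph.size_eq]

theorem size_tensor (f g : Diag L) : (tensor f g).size = f.size + g.size := by
  rw [(f.hasGraph.tensor g.hasGraph).size_eq,
    EdgeGraph.size_tensor f.hasGraph.isDiagram g.hasGraph.isDiagram]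
  rfl

theorem size_id (w : List L.Ob) : (id w).size = 0 := by
  rw [(hasGraph_id w).size_eq, size_eq_zero (isDiagram_idGraph w)]
  infer_instance

theorem eq_id_of_size_eq_zero {q : Diag L} (h : q.size = 0) : q = id q.dom := by
  rw [q.hasGraph.dom_eq]
  exact q.hasGraph.eq_id ((size_eq_zero q.hasGraph.isDiagram).1 h)

theorem HasGraph.isPrime_iff {q : Diag L} {Z : EdgeGraph L.Ob L.Mor} (h : q.HasGraph Z) :
    q.IsPrime ↔ Z.Prime := by
  constructor
  · rintro ⟨X, rfl, ⟨a⟩, hv, hn⟩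
    have hX : (mk X).HasGraph _ := ⟨X, rfl, _, X.planar.presents X.valuation⟩
    obtain ⟨j, h1, h2⟩ := hX.iso h
    have r := (X.planar.presents X.valuation).congr_right h1 h2
    have h3 := fun k => mt (r.onVirtualVertex_iff k).2 (hn k)
    obtain ⟨v, hv'⟩ := Option.ne_none_iff_exists'.1 (h3 a)
    refine ⟨⟨v, fun w => ?_⟩, fun e hs ht => ?_⟩
    · obtain ⟨k, hk⟩ := r.surj w
      have := ((r.vert k a).1 (hv k a)).1
      rw [hk, hv', Option.some.injEq] at this
      exact this
    · obtain ⟨k, rfl⟩ := r.ed_surjective e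
      exact h3 k ((r.vertexAt_eq_none k).2 ⟨hs, ht⟩)
  · rintro ⟨⟨v, hv⟩, hn⟩
    obtain ⟨X, rfl, ed, r⟩ := h
    have h3 : ∀ k, X.raw.vertexAt Z ed k = some v := fun k => by
      rcases hk : X.raw.vertexAt Z ed k with _ | w
      · rw [r.vertexAt_eq_none] at hk
        exact (hn _ hk.1 hk.2).elim
      · rw [hv w]
    refine ⟨X, rfl, ⟨(r.surj v).choose⟩, fun h k => ?_, fun h => ?_⟩
    · rw [r.vert, h3, h3]
      simp
    · rw [r.onVirtualVertex_iff, h3]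
      simp

theorem IsPrime.size_eq {p : Diag L} (hp : p.IsPrime) : p.size = 1 :=
  (p.hasGraph.isPrime_iff.1 hp).size_eq

/-- The tensor product of a diagram with the identities of two words. -/
noncomputable def whisker (v : List L.Ob) (p : Diag L) (w : List L.Ob) : Diag L :=
  tensor (id v) (tensor p (id w))

theorem exists_whisker {q : Diag L} (h : q.size = 1) :
    ∃ v p w, p.IsPrime ∧ q = whisker v p w := by
  obtain ⟨x, hx⟩ := size_eq_one.1 h
  obtain ⟨I, K, J, -, hK, -, hI, hp, hJ, hiso⟩ := exists_atom q.hasGraph.isDiagram hx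
  refine ⟨I.inWord, ofGraph K hK, J.inWord, (hasGraph_ofGraph hK).isPrime_iff.2 hp, ?_⟩
  exact q.hasGraph.eq_of_iso ((HasGraph.id_of_isEmpty hI).tensor
    ((hasGraph_ofGraph hK).tensor (HasGraph.id_of_isEmpty hJ))) hiso.symm

/-- Uniqueness of the prime part and of its position is what makes the value of a diagram with one
vertex well defined. -/
theorem whisker_inj {v v' w w' : List L.Ob} {p p' : Diag L} (hp : p.IsPrime) (hp' : p'.IsPrime)
    (h : whisker v p w = whisker v' p' w') : v = v' ∧ p = p' ∧ w = w' := by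
  have h1 := (hasGraph_id v).tensor (p.hasGraph.tensor (hasGraph_id w))
  have h2 := (hasGraph_id v').tensor (p'.hasGraph.tensor (hasGraph_id w'))
  change (whisker v p w).HasGraph _ at h1
  rw [h] at h1
  obtain ⟨h3, h4, h5⟩ := atom_unique p.hasGraph.isDiagram p'.hasGraph.isDiagram inferInstance
    (p.hasGraph.isPrime_iff.1 hp) inferInstance inferInstance (p'.hasGraph.isPrime_iff.1 hp')
    inferInstance (h1.iso h2)
  refine ⟨?_, p.hasGraph.eq_of_iso p'.hasGraph h4, ?_⟩
  · have := congrArg dom ((hasGraph_id v).eq_of_iso (hasGraph_id v') h3)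
    rwa [dom_id, dom_id] at this
  · have := congrArg dom ((hasGraph_id w).eq_of_iso (hasGraph_id w') h5)
    rwa [dom_id, dom_id] at this

theorem exists_comp_of_size_eq {q : Diag L} {n : ℕ} (h : q.size = n + 1) :
    ∃ (a q' : Diag L) (hc : a.cod = q'.dom), a.size = 1 ∧ q'.size = n ∧ q = comp q' a hc := by
  obtain ⟨A, Q, hA, hQ, h1, h2, ⟨k⟩⟩ := q.hasGraph.isDiagram.exists_gluing h
  have hA' := hasGraph_ofGraph hA
  have hQ' := hasGraph_ofGraph hQ
  exact ⟨_, _, hA'.cod_eq_dom hQ' k, hA'.size_eq.trans h1, hQ'.size_eq.trans h2,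
    q.hasGraph.eq (hA'.comp hQ' k _)⟩

/-- Two factorizations that differ by the interchange of two adjacent vertices. -/
def Diamond (a q a' q' : Diag L) : Prop :=
  ∃ (x y t : Diag L) (h : (tensor (id x.cod) y).cod = t.dom)
    (h' : (tensor x (id y.cod)).cod = t.dom), x.size = 1 ∧ y.size = 1 ∧
    a = tensor x (id y.dom) ∧ a' = tensor (id x.dom) y ∧
    q = comp t (tensor (id x.cod) y) h ∧ q' = comp t (tensor x (id y.cod)) h'

/-- The two factorizations become two gluings of one graph. Either they split off the same minimal
vertex, or two different ones, which span a tensor product in one of the two left-to-right orders.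
-/
theorem eq_or_diamond {a q a' q' : Diag L} (h : a.cod = q.dom) (h' : a'.cod = q'.dom)
    (ha : a.size = 1) (ha' : a'.size = 1) (he : comp q a h = comp q' a' h') :
    (a = a' ∧ q = q') ∨ Diamond a q a' q' ∨ Diamond a' q' a q := by
  obtain ⟨Z, ⟨k⟩, hZ⟩ := a.hasGraph.exists_comp q.hasGraph h
  obtain ⟨Z', ⟨k'⟩, hZ'⟩ := a'.hasGraph.exists_comp q'.hasGraph h'
  rw [← he] at hZ'
  obtain ⟨k'⟩ := k'.of_iso (.refl _) (.refl _) (hZ'.iso hZ)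
  have key : ∀ {a q a' q' : Diag L} {X Y T : EdgeGraph L.Ob L.Mor}, X.IsDiagram L → Y.IsDiagram L → T.IsDiagram L → X.size = 1 →
      Y.size = 1 → a.graph.Iso (X.tensor (idGraph Y.inWord)) →
      a'.graph.Iso ((idGraph X.inWord).tensor Y) →
      Nonempty (((idGraph X.outWord).tensor Y).Gluing T q.graph) →
      Nonempty ((X.tensor (idGraph Y.outWord)).Gluing T q'.graph) → Diamond a q a' q' := by
    rintro a q a' q' X Y T hX hY hT h1 h2 h3 h4 ⟨h5⟩ ⟨h6⟩
    have hX := hasGraph_ofGraph hX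
    have hY := hasGraph_ofGraph hY
    have hT := hasGraph_ofGraph hT
    have h7 := hX.tensor (hasGraph_id Y.outWord)
    have h8 := (hasGraph_id X.outWord).tensor hY
    rw [← hY.cod_eq] at h6 h7
    rw [← hX.cod_eq] at h5 h8
    rw [← hY.dom_eq] at h3
    rw [← hX.dom_eq] at h4
    exact ⟨_, _, _, h8.cod_eq_dom hT h5, h7.cod_eq_dom hT h6, hX.size_eq.trans h1,
      hY.size_eq.trans h2, a.hasGraph.eq_of_iso (hX.tensor (hasGraph_id _)) h3,
      a'.hasGraph.eq_of_iso ((hasGraph_id _).tensor hY) h4, q.hasGraph.eq (h8.comp hT h5 _),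
      q'.hasGraph.eq (h7.comp hT h6 _)⟩
  rcases Gluing.eq_or_diamond hZ.isDiagram k k' ha ha' with
    ⟨h1, h2⟩ | ⟨X, Y, T, hX, hY, hT, h1, h2, ⟨h3, h4, h5, h6⟩ | ⟨h3, h4, h5, h6⟩⟩
  · exact Or.inl ⟨a.hasGraph.eq_of_iso a'.hasGraph h1, q.hasGraph.eq_of_iso q'.hasGraph h2⟩
  · exact Or.inr (Or.inl (key hX hY hT h1 h2 h3 h4 h5 h6))
  · exact Or.inr (Or.inr (key hX hY hT h1 h2 h3 h4 h5 h6))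

end Diag
end TensorCalculus

namespace TensorCalculus

/-! ### Values of diagrams -/

namespace StrT

variable {W : StrT.{u}}

theorem comp_congr {g f g' f' : W.Mor} {h : W.tgt f = W.src g} (hg : g = g') (hf : f = f') :
    W.str.comp g f h = W.str.comp g' f' (hf ▸ hg ▸ h) := by
  subst hg hf
  rfl

/-- Any two ways to apply `f` and `g` side by side agree. -/
theorem id_tensor_comp_tensor_id (f g : W.Mor)
    (h : W.tgt (W.str.tensorMor f (W.str.id (W.src g))) =
      W.src (W.str.tensorMor (W.str.id (W.tgt f)) g)) :
    W.str.comp (W.str.tensorMor (W.str.id (W.tgt f)) g)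
      (W.str.tensorMor f (W.str.id (W.src g))) h = W.str.tensorMor f g := by
  rw [← W.str.interchange _ _ _ _ (W.str.src_id _).symm (W.str.tgt_id _), W.str.id_comp,
    W.str.comp_id]

theorem tensor_id_comp_id_tensor (f g : W.Mor)
    (h : W.tgt (W.str.tensorMor (W.str.id (W.src f)) g) =
      W.src (W.str.tensorMor f (W.str.id (W.tgt g)))) :
    W.str.comp (W.str.tensorMor f (W.str.id (W.tgt g)))
      (W.str.tensorMor (W.str.id (W.src f)) g) h = W.str.tensorMor f g := by
  rw [← W.str.interchange _ _ _ _ (W.str.tgt_id _) (W.str.src_id _).symm, W.str.id_comp,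
    W.str.comp_id]

end StrT

/-- Values in `W` of words and of prime diagrams. -/
structure PrimeValues (L : Labels.{u}) (W : StrT.{u}) where
  o : List L.Ob → W.Ob
  o_nil : o [] = W.str.unit
  o_append : ∀ v w, o (v ++ w) = W.str.tensorOb (o v) (o w)
  m : Diag L → W.Mor
  src_m : ∀ p, p.IsPrime → W.src (m p) = o p.dom
  tgt_m : ∀ p, p.IsPrime → W.tgt (m p) = o p.cod

namespace PrimeValues

variable {L : Labels.{u}} {W : StrT.{u}} (F : PrimeValues L W)

theorem tensor_id (v w : List L.Ob) :
    W.str.tensorMor (W.str.id (F.o v)) (W.str.id (F.o w)) = W.str.id (F.o (v ++ w)) := by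
  rw [W.str.tensor_id, F.o_append]

/-- The morphism `n` is the value of the diagram `a` with one real vertex. -/
def Atom (a : Diag L) (n : W.Mor) : Prop :=
  ∃ v p w, p.IsPrime ∧ a = Diag.whisker v p w ∧
    n = W.str.tensorMor (W.str.id (F.o v)) (W.str.tensorMor (F.m p) (W.str.id (F.o w)))

variable {F} {a : Diag L} {n n' : W.Mor}

namespace Atom

theorem size_eq (h : F.Atom a n) : a.size = 1 := by
  obtain ⟨v, p, w, hp, rfl, -⟩ := h
  rw [Diag.whisker, Diag.size_tensor, Diag.size_tensor, Diag.size_id, Diag.size_id, hp.size_eq]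

theorem src_eq (h : F.Atom a n) : W.src n = F.o a.dom := by
  obtain ⟨v, p, w, hp, rfl, rfl⟩ := h
  rw [Diag.whisker, Diag.dom_tensor, Diag.dom_tensor, Diag.dom_id, Diag.dom_id, F.o_append,
    F.o_append, W.str.src_tensor, W.str.src_tensor, W.str.src_id, W.str.src_id, F.src_m p hp]

theorem tgt_eq (h : F.Atom a n) : W.tgt n = F.o a.cod := by
  obtain ⟨v, p, w, hp, rfl, rfl⟩ := h
  rw [Diag.whisker, Diag.cod_tensor, Diag.cod_tensor, Diag.cod_id, Diag.cod_id, F.o_append,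
    F.o_append, W.str.tgt_tensor, W.str.tgt_tensor, W.str.tgt_id, W.str.tgt_id, F.tgt_m p hp]

theorem unique (h : F.Atom a n) (h' : F.Atom a n') : n = n' := by
  obtain ⟨v, p, w, hp, rfl, rfl⟩ := h
  obtain ⟨v', p', w', hp', he, rfl⟩ := h'
  obtain ⟨rfl, rfl, rfl⟩ := Diag.whisker_inj hp hp' he
  rfl

theorem tensor_id (h : F.Atom a n) (x : List L.Ob) :
    F.Atom (a.tensor (Diag.id x)) (W.str.tensorMor n (W.str.id (F.o x))) := by
  obtain ⟨v, p, w, hp, rfl, rfl⟩ := h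
  refine ⟨v, p, w ++ x, hp, ?_, ?_⟩
  · rw [Diag.whisker, Diag.whisker, Diag.tensor_assoc, Diag.tensor_assoc, Diag.tensor_id]
  · rw [W.str.tensorMor_assoc, W.str.tensorMor_assoc, F.tensor_id]

theorem id_tensor (h : F.Atom a n) (x : List L.Ob) :
    F.Atom ((Diag.id x).tensor a) (W.str.tensorMor (W.str.id (F.o x)) n) := by
  obtain ⟨v, p, w, hp, rfl, rfl⟩ := h
  refine ⟨x ++ v, p, w, hp, ?_, ?_⟩
  · rw [Diag.whisker, Diag.whisker, ← Diag.tensor_assoc, Diag.tensor_id]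
  · rw [← W.str.tensorMor_assoc, F.tensor_id]

theorem of_isPrime {p : Diag L} (hp : p.IsPrime) : F.Atom p (F.m p) := by
  refine ⟨[], p, [], hp, ?_, ?_⟩
  · rw [Diag.whisker, Diag.tensor_id_nil, Diag.id_nil_tensor]
  · rw [F.o_nil, W.str.tensorMor_unit, W.str.unit_tensorMor]

end Atom

theorem exists_atom (h : a.size = 1) : ∃ n, F.Atom a n := by
  obtain ⟨v, p, w, hp, rfl⟩ := Diag.exists_whisker h
  exact ⟨_, v, p, w, hp, rfl, rfl⟩

variable (F) in
/-- The morphism is a value of the diagram. -/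
inductive Val : Diag L → W.Mor → Prop
  | id (w : List L.Ob) : Val (Diag.id w) (W.str.id (F.o w))
  | step {a q : Diag L} {n m : W.Mor} (ha : F.Atom a n) (hq : Val q m) (h : a.cod = q.dom)
      (h' : W.tgt n = W.src m) : Val (Diag.comp q a h) (W.str.comp m n h')

namespace Val

variable {f g q : Diag L} {k m m' : W.Mor}

theorem src_eq (h : F.Val q m) : W.src m = F.o q.dom := by
  induction h with
  | id w => rw [W.str.src_id, Diag.dom_id]
  | step ha _ h h' _ => rw [W.str.src_comp, Diag.dom_comp, ha.src_eq]

theorem tgt_eq (h : F.Val q m) : W.tgt m = F.o q.cod := by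
  induction h with
  | id w => rw [W.str.tgt_id, Diag.cod_id]
  | step ha _ h h' ih => rw [W.str.tgt_comp, Diag.cod_comp, ih]

theorem step' (ha : F.Atom a n) (hq : F.Val q m) (h : a.cod = q.dom) :
    F.Val (Diag.comp q a h) (W.str.comp m n (by rw [ha.tgt_eq, hq.src_eq, h])) :=
  hq.step ha h _

variable (F) in
theorem exists_val (q : Diag L) : ∃ m, F.Val q m := by
  generalize hn : q.size = n
  induction n generalizing q with
  | zero =>
    rw [Diag.eq_id_of_size_eq_zero hn]
    exact ⟨_, .id _⟩
  | succ n ih =>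
    obtain ⟨a, q', h, h1, h2, rfl⟩ := Diag.exists_comp_of_size_eq hn
    obtain ⟨k, hk⟩ := F.exists_atom h1
    obtain ⟨m, hm⟩ := ih q' h2
    exact ⟨_, step' hk hm h⟩

theorem eq_or_exists (hq : F.Val q m) : (∃ w, q = Diag.id w ∧ m = W.str.id (F.o w)) ∨
    ∃ (a q' : Diag L) (n m' : W.Mor) (h : a.cod = q'.dom) (h' : W.tgt n = W.src m'),
      F.Atom a n ∧ F.Val q' m' ∧ q = Diag.comp q' a h ∧ m = W.str.comp m' n h' := by
  cases hq with
  | id w => exact Or.inl ⟨w, rfl, rfl⟩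
  | step ha hq h h' => exact Or.inr ⟨_, _, _, _, h, h', ha, hq, rfl, rfl⟩

/-- Let `kx`, `ky`, `kt` be values of `x`, `y`, `t`. Uniqueness for atoms identifies `n` and `n'`,
and the hypotheses on `q` and `q'` identify `m` and `m'`, with the morphisms read off the diamond.
Both composites are then `kt ∘ (kx ⊗ ky)`, by the interchange law. -/
theorem eq_of_diamond {a q a' q' : Diag L} {n m n' m' : W.Mor} (hd : Diag.Diamond a q a' q')
    (ha : F.Atom a n) (ha' : F.Atom a' n') (hu : ∀ k, F.Val q k → m = k)
    (hu' : ∀ k, F.Val q' k → m' = k) (h : W.tgt n = W.src m) (h' : W.tgt n' = W.src m') :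
    W.str.comp m n h = W.str.comp m' n' h' := by
  obtain ⟨x, y, t, ht, ht', hx, hy, rfl, rfl, rfl, rfl⟩ := hd
  obtain ⟨kx, hkx⟩ := F.exists_atom hx
  obtain ⟨ky, hky⟩ := F.exists_atom hy
  obtain ⟨kt, hkt⟩ := exists_val F t
  have h1 := ha.unique (hkx.tensor_id y.dom)
  have h2 := ha'.unique (hky.id_tensor x.dom)
  have h3 := hu _ (step' (hky.id_tensor x.cod) hkt ht)
  have h4 := hu' _ (step' (hkx.tensor_id y.cod) hkt ht')
  simp only [← hkx.tgt_eq, ← hkx.src_eq, ← hky.tgt_eq, ← hky.src_eq] at h1 h2 h3 h4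
  subst h1 h2 h3 h4
  rw [W.str.src_comp] at h h'
  rw [← W.str.comp_assoc _ _ _ h, ← W.str.comp_assoc _ _ _ h']
  exact StrT.comp_congr rfl ((StrT.id_tensor_comp_tensor_id _ _ _).trans
    (StrT.tensor_id_comp_id_tensor _ _ _).symm)

/-- Induction on the number of real vertices, in the manner of a confluence proof: two values start
with atoms of the same diagram, and these atoms are equal or form a diamond. -/
theorem unique (h : F.Val q m) (h' : F.Val q m') : m = m' := by
  generalize hs : q.size = s
  induction s generalizing q m m' with
  | zero =>
    have key : ∀ {m}, F.Val q m → m = W.str.id (F.o q.dom) := by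
      intro m h
      rcases h.eq_or_exists with ⟨w, rfl, rfl⟩ | ⟨a, q', n, m', h1, h2, h3, h4, rfl, rfl⟩
      · rw [Diag.dom_id]
      · rw [Diag.size_comp, h3.size_eq] at hs
        omega
    rw [key h, key h']
  | succ s ih =>
    rcases h.eq_or_exists with ⟨w, rfl, rfl⟩ | ⟨a, q₁, n, m₁, h1, h2, h3, h4, rfl, rfl⟩
    · rw [Diag.size_id] at hs
      omega
    rcases h'.eq_or_exists with ⟨w, h5, -⟩ | ⟨a', q₂, n', m₂, h1', h2', h3', h4', he, rfl⟩
    · rw [h5, Diag.size_id] at hs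
      omega
    have hs' := hs
    rw [he] at hs'
    rw [Diag.size_comp, h3.size_eq] at hs
    rw [Diag.size_comp, h3'.size_eq] at hs'
    -- The remainders have one vertex fewer, so each has a single value. For a diamond this allows
    -- replacing the given value of the remainder by the one that factors through the common upper
    -- part.
    have u₁ : ∀ k, F.Val q₁ k → m₁ = k := fun k hk => ih h4 hk (by omega)
    have u₂ : ∀ k, F.Val q₂ k → m₂ = k := fun k hk => ih h4' hk (by omega)
    rcases Diag.eq_or_diamond h1 h1' h3.size_eq h3'.size_eq he with ⟨rfl, rfl⟩ | hd | hd
    · exact StrT.comp_congr (u₁ _ h4') (h3.unique h3')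
    · exact eq_of_diamond hd h3 h3' u₁ u₂ h2 h2'
    · exact (eq_of_diamond hd h3' h3 u₂ u₁ h2' h2).symm

/-- The vertices of `f` are put in front of a value of `g` one at a time; associativity on both
sides matches the brackets. -/
theorem comp (hg : F.Val g k) (hf : F.Val f m) (h : f.cod = g.dom) :
    F.Val (Diag.comp g f h) (W.str.comp k m (by rw [hf.tgt_eq, hg.src_eq, h])) := by
  induction hf with
  | id w =>
    rw [Diag.cod_id] at h
    subst h
    have h1 := Diag.comp_id g (Diag.cod_id _)
    have h2 := W.str.comp_id k (W.str.tgt_id _)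
    simp only [← hg.src_eq, h1, h2]
    exact hg
  | @step a q n m ha hq h1 h2 ih =>
    rw [Diag.cod_comp] at h
    have h3 := ih h
    have h4 := step' ha h3 (h1.trans (Diag.dom_comp _ _ _).symm)
    rw [Diag.comp_assoc g q a h1 h, W.str.comp_assoc k m n h2 (by rw [hq.tgt_eq, hg.src_eq, h])]
    exact h4

theorem tensor_id (hf : F.Val f m) (x : List L.Ob) :
    F.Val (f.tensor (Diag.id x)) (W.str.tensorMor m (W.str.id (F.o x))) := by
  induction hf with
  | id w =>
    rw [Diag.tensor_id, F.tensor_id]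
    exact .id _
  | @step a q n m ha hq h1 h2 ih =>
    have h3 := step' (ha.tensor_id x) ih (by rw [Diag.cod_tensor, Diag.dom_tensor, h1, Diag.cod_id,
      Diag.dom_id])
    -- The identity of `x` is split as a composite of two identities, so that interchange turns the
    -- composite of two tensor products into the tensor product of a composite with an identity.
    have h4 : Diag.comp (Diag.id x) (Diag.id x) (by rw [Diag.cod_id, Diag.dom_id]) = Diag.id x := by
      have := Diag.comp_id (Diag.id x) (by rw [Diag.cod_id])
      simpa only [Diag.dom_id] using this
    have h5 : W.str.comp (W.str.id (F.o x)) (W.str.id (F.o x))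
        (by rw [W.str.tgt_id, W.str.src_id]) = W.str.id (F.o x) := by
      have := W.str.comp_id (W.str.id (F.o x)) (by rw [W.str.tgt_id])
      simpa only [W.str.src_id] using this
    rw [← Diag.tensor_comp _ _ _ _ h1 (by rw [Diag.cod_id, Diag.dom_id]), h4,
      ← W.str.interchange _ _ _ _ h2 (by rw [W.str.tgt_id, W.str.src_id]), h5] at h3
    exact h3

theorem id_tensor (hf : F.Val f m) (x : List L.Ob) :
    F.Val ((Diag.id x).tensor f) (W.str.tensorMor (W.str.id (F.o x)) m) := by
  induction hf with
  | id w =>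
    rw [Diag.tensor_id, F.tensor_id]
    exact .id _
  | @step a q n m ha hq h1 h2 ih =>
    have h3 := step' (ha.id_tensor x) ih (by rw [Diag.cod_tensor, Diag.dom_tensor, h1, Diag.cod_id,
      Diag.dom_id])
    have h4 : Diag.comp (Diag.id x) (Diag.id x) (by rw [Diag.cod_id, Diag.dom_id]) = Diag.id x := by
      have := Diag.comp_id (Diag.id x) (by rw [Diag.cod_id])
      simpa only [Diag.dom_id] using this
    have h5 : W.str.comp (W.str.id (F.o x)) (W.str.id (F.o x))
        (by rw [W.str.tgt_id, W.str.src_id]) = W.str.id (F.o x) := by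
      have := W.str.comp_id (W.str.id (F.o x)) (by rw [W.str.tgt_id])
      simpa only [W.str.src_id] using this
    rw [← Diag.tensor_comp _ _ _ _ (by rw [Diag.cod_id, Diag.dom_id]) h1, h4,
      ← W.str.interchange _ _ _ _ (by rw [W.str.tgt_id, W.str.src_id]) h2, h5] at h3
    exact h3

/-- Written as `(id ⊗ g) ∘ (f ⊗ id)`, the tensor product is a composite of diagrams whose values are
already known. -/
theorem tensor (hf : F.Val f m) (hg : F.Val g k) : F.Val (f.tensor g) (W.str.tensorMor m k) := by
  have h : (f.tensor (Diag.id g.dom)).cod = ((Diag.id f.cod).tensor g).dom := by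
    rw [Diag.cod_tensor, Diag.dom_tensor, Diag.dom_id, Diag.cod_id]
  have h1 := (hg.id_tensor f.cod).comp (hf.tensor_id g.dom) h
  rw [← Diag.tensor_comp _ _ _ _ (Diag.dom_id _).symm (Diag.cod_id _), Diag.id_comp,
    Diag.comp_id] at h1
  simp only [← hf.tgt_eq, ← hg.src_eq] at h1
  rwa [StrT.id_tensor_comp_tensor_id] at h1

theorem of_isPrime {p : Diag L} (hp : p.IsPrime) : F.Val p (F.m p) := by
  have h := step' (F := F) (.of_isPrime hp) (.id p.cod) (Diag.dom_id _).symm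
  rw [Diag.id_comp] at h
  simp only [← F.tgt_m p hp] at h
  rwa [W.str.id_comp] at h

end Val

variable (F) in
/-- The value of a class of diagrams. -/
noncomputable def value (q : Diag L) : W.Mor := (Val.exists_val F q).choose

variable (F) in
theorem val_value (q : Diag L) : F.Val q (F.value q) := (Val.exists_val F q).choose_spec

theorem value_isPrime {p : Diag L} (hp : p.IsPrime) : F.value p = F.m p :=
  (F.val_value p).unique (.of_isPrime hp)

variable (F) in
theorem isStrictTensorFunctor_value :
    IsStrictTensorFunctor (Diag.str L) W.str F.o F.value where
  src_map q := (F.val_value q).src_eq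
  tgt_map q := (F.val_value q).tgt_eq
  map_id w := (F.val_value _).unique (.id w)
  map_comp g f h := (F.val_value _).unique ((F.val_value g).comp (F.val_value f) h)
  map_unit := F.o_nil
  map_tensorOb := F.o_append
  map_tensorMor f g := (F.val_value _).unique ((F.val_value f).tensor (F.val_value g))

/-- Every diagram is built from identities by composing with prime diagrams tensored with
identities, so a strict tensor functor has no freedom beyond its values on words and prime diagrams.
-/
theorem eq_value {m : Diag L → W.Mor} (hm : IsStrictTensorFunctor (Diag.str L) W.str F.o m)
    (h : ∀ p, p.IsPrime → m p = F.m p) (q : Diag L) : m q = F.value q := by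
  have ha : ∀ a n, F.Atom a n → m a = n := by
    rintro a n ⟨v, p, w, hp, rfl, rfl⟩
    refine (hm.map_tensorMor _ _).trans ?_
    rw [← h p hp]
    exact congrArg₂ _ (hm.map_id v)
      ((hm.map_tensorMor _ _).trans (congrArg _ (hm.map_id w)))
  have hv := F.val_value q
  generalize F.value q = k at hv
  induction hv with
  | id w => exact hm.map_id w
  | step hn _ h1 h2 ih =>
    exact (hm.map_comp _ _ h1).trans (StrT.comp_congr ih (ha _ _ hn))

end PrimeValues
end TensorCalculus

namespace TensorCalculus

/-! ### Prime diagrams -/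

open EdgeGraph

namespace Diag

variable {L L' : Labels.{u}}

/-- `q` is prime and its vertex is decorated by `f`. -/
def HasMor (q : Diag L) (f : L.Mor) : Prop :=
  ∃ Z, q.HasGraph Z ∧ Z.Prime ∧ ∀ v, Z.mor v = f

theorem IsPrime.exists_hasMor {q : Diag L} (hq : q.IsPrime) : ∃ f, q.HasMor f := by
  have h := q.hasGraph.isPrime_iff.1 hq
  obtain ⟨v, hv⟩ := h.1
  exact ⟨_, _, q.hasGraph, h, fun w => congrArg _ (hv w)⟩

namespace HasMor

variable {p q : Diag L} {f f' : L.Mor}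

theorem isPrime (h : q.HasMor f) : q.IsPrime := by
  obtain ⟨Z, hZ, hp, -⟩ := h
  exact hZ.isPrime_iff.2 hp

theorem unique (h : q.HasMor f) (h' : q.HasMor f') : f = f' := by
  obtain ⟨Z, hZ, hp, hf⟩ := h
  obtain ⟨Z', hZ', -, hf'⟩ := h'
  obtain ⟨j, -, -⟩ := hZ.iso hZ'
  obtain ⟨v, -⟩ := hp.1
  rw [← hf v, ← hf' (j.v v), j.mor]

/-- Domain and codomain have to be compared separately: in a strict tensor category the decoration
fixes only the tensor products of the two words, not the words themselves. -/
theorem eq (hp : p.HasMor f) (hq : q.HasMor f) (hd : p.dom = q.dom) (hc : p.cod = q.cod) :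
    p = q := by
  obtain ⟨Z, hZ, h1, h2⟩ := hp
  obtain ⟨Z', hZ', h1', h2'⟩ := hq
  rw [hZ.dom_eq, hZ'.dom_eq] at hd
  rw [hZ.cod_eq, hZ'.cod_eq] at hc
  exact hZ.eq_of_iso hZ' (Prime.iso hZ.isDiagram hZ'.isDiagram h1 h1'
    (fun v v' => (h2 v).trans (h2' v').symm) hd hc)

theorem isDom (h : q.HasMor f) : L.IsDom f q.dom := by
  obtain ⟨Z, hZ, hp, hf⟩ := h
  obtain ⟨v, -⟩ := hp.1
  rw [hZ.dom_eq, ← hf v]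
  exact Prime.isDom hZ.isDiagram hp v

theorem isCod (h : q.HasMor f) : L.IsCod f q.cod := by
  obtain ⟨Z, hZ, hp, hf⟩ := h
  obtain ⟨v, -⟩ := hp.1
  rw [hZ.cod_eq, ← hf v]
  exact Prime.isCod hZ.isDiagram hp v

theorem map (h : q.HasMor f) (φ : L.Hom L') : (q.map φ).HasMor (φ.m f) := by
  obtain ⟨Z, hZ, hp, hf⟩ := h
  exact ⟨_, hZ.map φ, hp, fun v => congrArg φ.m (hf v)⟩

end HasMor

/-- The prime diagram with given domain, codomain and decoration. -/
theorem exists_prime {w w' : List L.Ob} {f : L.Mor} (hw : w ≠ []) (hw' : w' ≠ [])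
    (hd : L.IsDom f w) (hc : L.IsCod f w') :
    ∃ q : Diag L, q.HasMor f ∧ q.dom = w ∧ q.cod = w' := by
  have h := hasGraph_ofGraph (isDiagram_primeGraph hw hw' hd hc)
  exact ⟨_, ⟨_, h, prime_primeGraph _ _ _, fun _ => rfl⟩, h.dom_eq.trans (inWord_primeGraph _ _ _),
    h.cod_eq.trans (outWord_primeGraph _ _ _)⟩

end Diag

/-- A morphism of tensor schemes prescribes domain and codomain of the image of `f` through its
action on objects. Only the decoration of the vertex is left to compare. -/
theorem primeScheme_hom_ext {D : TSch.{u}} {V : StrT.{u}} {φ ψ : D.Hom (primeScheme V)}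
    (ho : ∀ x, φ.o x = ψ.o x) (hm : ∀ f, ∃ g, (φ.m f).1.HasMor g ∧ (ψ.m f).1.HasMor g) :
    φ = ψ := by
  refine TSch.Hom.ext (funext ho) (funext fun f => ?_)
  obtain ⟨g, h1, h2⟩ := hm f
  refine Subtype.ext (h1.eq h2 ?_ ?_)
  · exact (φ.src_map f).trans ((congrArg (fun o => (D.src f).map o) (funext ho)).trans
      (ψ.src_map f).symm)
  · exact (φ.tgt_map f).trans ((congrArg (fun o => (D.tgt f).map o) (funext ho)).trans
      (ψ.tgt_map f).symm)

/-! ### The adjunction -/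

namespace TSch

/-- The free strict tensor category on a tensor scheme. -/
noncomputable abbrev free (D : TSch.{u}) : StrT.{u} :=
  ⟨List D.Ob, D.Diag, D.dom, D.cod, Diag.str D.labels⟩

variable (D : TSch.{u})

/-- Tensor product is juxtaposition, so a word is the tensor product of its letters. -/
theorem free_tensorWord (w : List D.Ob) : D.free.tensorWord (w.map fun x => [x]) = w := by
  induction w with
  | nil => rfl
  | cons x w ih => exact congrArg (List.cons x) ih

/-- The prime diagram decorated by a given morphism. -/
noncomputable def prime (f : D.Mor) : D.Diag :=
  (Diag.exists_prime (L := D.labels) (D.src_ne f) (D.tgt_ne f) rfl rfl).choose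

theorem hasMor_prime (f : D.Mor) : Diag.HasMor (D.prime f) f :=
  (Diag.exists_prime (L := D.labels) (D.src_ne f) (D.tgt_ne f) rfl rfl).choose_spec.1

theorem dom_prime (f : D.Mor) : Diag.dom (D.prime f) = D.src f := (D.hasMor_prime f).isDom.symm

theorem cod_prime (f : D.Mor) : Diag.cod (D.prime f) = D.tgt f := (D.hasMor_prime f).isCod.symm

variable {D} in
theorem eq_prime {p : D.Diag} {f : D.Mor} (h : Diag.HasMor p f) : p = D.prime f :=
  h.eq (D.hasMor_prime f) (h.isDom.symm.trans (D.dom_prime f).symm)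
    (h.isCod.symm.trans (D.cod_prime f).symm)

/-- The image of `f` under the unit is a prime diagram in `F(D)`, decorated by one-letter words and,
at its vertex, by the prime diagram `D.prime f`, which is itself a morphism of `F(D)`. -/
theorem exists_unit (f : D.Mor) : ∃ q : TensorCalculus.Diag D.free.labels, q.HasMor (D.prime f) ∧
    q.dom = (D.src f).map (fun x => [x]) ∧ q.cod = (D.tgt f).map fun x => [x] :=
  Diag.exists_prime (L := D.free.labels) (fun h => D.src_ne f (List.map_eq_nil_iff.1 h))
    (fun h => D.tgt_ne f (List.map_eq_nil_iff.1 h))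
    ((D.dom_prime f).trans (D.free_tensorWord _).symm)
    ((D.cod_prime f).trans (D.free_tensorWord _).symm)

/-- The morphism of tensor schemes into the prime diagrams in the free strict tensor category. -/
noncomputable def unit : D.Hom (primeScheme D.free) where
  o x := [x]
  m f := ⟨(D.exists_unit f).choose, (D.exists_unit f).choose_spec.1.isPrime⟩
  src_map f := (D.exists_unit f).choose_spec.2.1
  tgt_map f := (D.exists_unit f).choose_spec.2.2

theorem hasMor_unit (f : D.Mor) : (D.unit.m f).1.HasMor (D.prime f) :=
  (D.exists_unit f).choose_spec.1

/-- The functor of free strict tensor categories. -/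
noncomputable abbrev freeStrT : TSch.{u} ⥤ StrT.{u} :=
  freeFunctor (fun D => Diag.str D.labels) fun φ => Diag.isStrictTensorFunctor_map φ.labelsHom

/-- The unit of the adjunction. -/
noncomputable def unitHom : D ⟶ primeFunctor.obj (freeStrT.obj D) := D.unit

variable {D} {V : StrT.{u}}

/-- The morphism of tensor schemes that corresponds to a strict tensor functor. -/
noncomputable def adjunct (K : freeStrT.obj D ⟶ V) : D ⟶ primeFunctor.obj V :=
  D.unitHom ≫ primeFunctor.map K

theorem hasMor_adjunct (K : freeStrT.obj D ⟶ V) (f : D.Mor) :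
    Diag.HasMor (L := V.labels) ((adjunct K).m f).1 (StrT.Functor.m K (D.prime f)) :=
  (D.hasMor_unit f).map (StrT.Functor.labelsHom K)

theorem o_eq_tensorWord (K : D.free.Functor V) (w : List D.Ob) :
    K.o w = V.tensorWord (w.map fun x => K.o [x]) := by
  have h := K.o_tensorWord (w.map fun x => [x])
  rw [D.free_tensorWord, List.map_map] at h
  exact h

/-- The adjunct of `K` retains its values on one-letter words and, as decorations, its values on the
prime diagrams of `D`. The former determine `K` on words, and `eq_value` does the rest. -/
theorem adjunct_injective : Function.Injective (adjunct (D := D) (V := V)) := by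
  intro K K' h
  have ho : StrT.Functor.o K = StrT.Functor.o K' := by
    funext w
    refine (o_eq_tensorWord K w).trans (Eq.trans ?_ (o_eq_tensorWord K' w).symm)
    exact congrArg (fun o => V.tensorWord (w.map o)) (congrArg TSch.Hom.o h)
  have hm : ∀ f, StrT.Functor.m K (D.prime f) = StrT.Functor.m K' (D.prime f) := fun f => by
    have h1 := hasMor_adjunct K f
    rw [h] at h1
    exact h1.unique (hasMor_adjunct K' f)
  -- The values of `K'` serve as reference data; both functors extend their restriction to prime
  -- diagrams.
  let F : PrimeValues D.labels V :=
    { o := StrT.Functor.o K'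
      o_nil := (StrT.Functor.isFunctor K').map_unit
      o_append := (StrT.Functor.isFunctor K').map_tensorOb
      m := StrT.Functor.m K'
      src_m := fun p _ => (StrT.Functor.isFunctor K').src_map p
      tgt_m := fun p _ => (StrT.Functor.isFunctor K').tgt_map p }
  refine StrT.Functor.ext ho (funext fun q => ?_)
  have hK := StrT.Functor.isFunctor K
  rw [ho] at hK
  refine (PrimeValues.eq_value (F := F) hK (fun p hp => ?_) q).trans
    (PrimeValues.eq_value (F := F) (StrT.Functor.isFunctor K') (fun _ _ => rfl) q).symm
  obtain ⟨f, hf⟩ := hp.exists_hasMor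
  rw [eq_prime hf]
  exact hm f

theorem tensorWord_append (v w : List V.Ob) :
    V.tensorWord (v ++ w) = V.str.tensorOb (V.tensorWord v) (V.tensorWord w) := by
  induction v with
  | nil => exact (V.str.unit_tensorOb _).symm
  | cons x v ih => exact (congrArg (V.str.tensorOb x) ih).trans (V.str.tensorOb_assoc _ _ _).symm

/-- The decorations of the prime diagrams `ψ f` serve as values of the prime diagrams in `D`. They
have the right sources and targets since `ψ` respects words, and the resulting value functor has `ψ`
as its adjunct. -/
theorem adjunct_surjective : Function.Surjective (adjunct (D := D) (V := V)) := by
  intro ψ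
  let ψ' : D.Hom (primeScheme V) := ψ
  choose g hg using fun f => (ψ'.m f).2.exists_hasMor
  -- Values are required for all classes, but only those of prime ones matter; the identity of the
  -- unit object is a default for the others.
  have hex : ∀ p : D.Diag, ∃ k : V.Mor, ∀ f, Diag.HasMor p f → k = g f := fun p => by
    by_cases h : ∃ f, Diag.HasMor p f
    · obtain ⟨f, hf⟩ := h
      exact ⟨g f, fun f' hf' => congrArg g (hf.unique hf')⟩
    · exact ⟨V.str.id V.str.unit, fun f hf => (h ⟨f, hf⟩).elim⟩
  choose k hk using hex
  let F : PrimeValues D.labels V :=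
    { o := fun w => V.tensorWord (w.map ψ'.o)
      o_nil := rfl
      o_append := fun v w =>
        (congrArg V.tensorWord (List.map_append (f := ψ'.o))).trans (tensorWord_append _ _)
      m := k
      src_m := fun p hp => by
        obtain ⟨f, hf⟩ := hp.exists_hasMor
        rw [hk p f hf]
        refine (hg f).isDom.trans (congrArg V.tensorWord ((ψ'.src_map f).trans ?_))
        exact congrArg (List.map ψ'.o) hf.isDom
      tgt_m := fun p hp => by
        obtain ⟨f, hf⟩ := hp.exists_hasMor
        rw [hk p f hf]
        refine (hg f).isCod.trans (congrArg V.tensorWord ((ψ'.tgt_map f).trans ?_))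
        exact congrArg (List.map ψ'.o) hf.isCod }
  let K : freeStrT.obj D ⟶ V := (⟨F.o, F.value, F.isStrictTensorFunctor_value⟩ : D.free.Functor V)
  refine ⟨K, primeScheme_hom_ext (fun x => V.str.tensorOb_unit _) fun f => ⟨g f, ?_, hg f⟩⟩
  have h := hasMor_adjunct K f
  have hp := D.hasMor_prime f
  rwa [show StrT.Functor.m K (D.prime f) = g f from
    (PrimeValues.value_isPrime hp.isPrime).trans (hk _ f hp)] at h

/-- The bijection of the adjunction. -/
noncomputable def adjunctEquiv (D : TSch.{u}) (V : StrT.{u}) :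
    (freeStrT.obj D ⟶ V) ≃ (D ⟶ primeFunctor.obj V) :=
  Equiv.ofBijective adjunct ⟨adjunct_injective, adjunct_surjective⟩

/-- On the level of decorations both sides carry the push-forward of `D.prime f`, which is the prime
diagram of the image of `f`. -/
theorem unit_naturality {D E : TSch.{u}} (φ : D ⟶ E) :
    D.unitHom ≫ primeFunctor.map (freeStrT.map φ) = φ ≫ E.unitHom := by
  refine primeScheme_hom_ext (fun x => rfl) fun f =>
    ⟨_, (D.hasMor_unit f).map (StrT.Functor.labelsHom (freeStrT.map φ)), ?_⟩
  have h := eq_prime ((D.hasMor_prime f).map (TSch.Hom.labelsHom φ))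
  have h' : Diag.HasMor (L := E.free.labels) _ _ := E.hasMor_unit (TSch.Hom.m φ f)
  exact (congrArg _ h).mpr h'

/-- Free strict tensor categories are left adjoint to tensor schemes of prime diagrams. -/
noncomputable def adjunction : freeStrT ⊣ primeFunctor.{u} :=
  Adjunction.mkOfHomEquiv
    { homEquiv := adjunctEquiv
      homEquiv_naturality_left_symm := fun {D E V} φ ψ => by
        refine (Equiv.symm_apply_eq (adjunctEquiv D V)).2 ?_
        obtain ⟨K, rfl⟩ := (adjunctEquiv E V).surjective ψ
        refine Eq.trans ?_ (congrArg (fun K => adjunctEquiv D V (freeStrT.map φ ≫ K))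
          ((adjunctEquiv E V).symm_apply_apply K)).symm
        change φ ≫ E.unitHom ≫ primeFunctor.map K =
          D.unitHom ≫ primeFunctor.map (freeStrT.map φ ≫ K)
        rw [Functor.map_comp]
        exact (Category.assoc _ _ _).symm.trans ((congrArg (· ≫ primeFunctor.map K)
          (unit_naturality φ).symm).trans (Category.assoc _ _ _))
      homEquiv_naturality_right := fun {D V W} K K' => by
        change D.unitHom ≫ primeFunctor.map (K ≫ K') =
          (D.unitHom ≫ primeFunctor.map K) ≫ primeFunctor.map K'
        rw [Functor.map_comp, Category.assoc] }

end TSch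

end TensorCalculus

theorem theorem5p3p1 :
    ∃ (S : ∀ D : TensorCalculus.TSch.{u}, TensorCalculus.DiagramStructure D)
      (hS : ∀ {D E : TensorCalculus.TSch.{u}} (φ : D.Hom E),
        TensorCalculus.IsStrictTensorFunctor (S D) (S E)
          (List.map φ.o) (TensorCalculus.Diag.map φ.labelsHom)),
      (∀ D, TensorCalculus.IsDiagrammatic D (S D)) ∧
        Nonempty (TensorCalculus.freeFunctor S hS ⊣ TensorCalculus.primeFunctor.{u}) :=
  ⟨_, fun φ => TensorCalculus.Diag.isStrictTensorFunctor_map φ.labelsHom,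
    TensorCalculus.isDiagrammatic, ⟨TensorCalculus.TSch.adjunction⟩⟩
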